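/- Let $n\ge 2$ and let $Q(x_1,\dots,x_{n+2})=2x_1x_{n+2}+2x_2x_{n+1}+\sum_{i=3}^{n}x_i^2$, a quadratic form of signature $(n,2)$ on $\mathbb R^{n+2}$. Let $G=\mathrm{SO}^\circ(n,2)$ be the identity component of $\mathrm{SO}(Q)<\mathrm{SL}_{n+2}(\mathbb R)$, and let $H=\mathrm{SO}^\circ(n,1)$ be the identity component of $\{g\in G: gV=V\}$, where $V=\{x_1=x_{n+2}\}$. Let $K=\{g\in G: gg^T=1\}$, a maximal compact subgroup, and let $\mathfrak a$ be the space of diagonal matrices $v=\mathrm{diag}(v_1,v_2,0,\dots,0,-v_2,-v_1)$ with $v_1,v_2\in\mathbb R$. Let $\mathfrak a^+\subset\mathfrak a$ be the closed positive Weyl chamber, that is, $\{v_1\ge v_2\ge 0\}$ if $n\ge 3$ and $\{v_1\ge |v_2|\}$ if $n=2$. For $g\in G$ let $\mu(g)\in\mathfrak a^+$ be the Cartan projection, the unique element of $\mathfrak a^+$ with $g\in K\exp(\mu(g))K$. Let $\rho$ be the half-sum of the positive roots of $(\mathrm{Lie}\,G,\mathfrak a)$ counted with multiplicity (explicitly,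 $\rho(v)=\tfrac12(nv_1+(n-2)v_2)$). Fix any norm $\|\cdot\|$ on $\mathfrak a$. For a discrete subgroup $\Gamma<G$, the growth indicator $\psi_\Gamma:\mathfrak a^+\to\mathbb R\cup\{-\infty\}$ is $$\psi_\Gamma(v)=\|v\|\cdot\inf_{v\in\mathcal C}\ \limsup_{T\to\infty}\frac{\log\#\{\gamma\in\Gamma:\mu(\gamma)\in\mathcal C,\ \|\mu(\gamma)\|\le T\}}{T},$$ where the infimum is over all relatively open cones $\mathcal C\subset\mathfrak a^+$ containing $v$, $\log 0=-\infty$, and $\psi_\Gamma(0)=0$. Let $\Gamma<G$ be a discrete subgroup that is contained in $H$ and is a lattice in $H$. Then $\mu(H)$ is the ray $\{v\in\mathfrak a: v_1\ge 0,\ v_2=0\}$, and for $v\in\mathfrak a^+$ $$\psi_\Gamma(v)=\begin{cases}(n-1)\,v_1 & \text{if } v\in\mu(H),\\ -\infty & \text{if } v\notin\mu(H).\end{cases}$$ Consequently $\psi_\Gamma\le \frac{2(n-1)}{n}\,\rho$ on $\mathfrak a^+$, with equality on $\mu(H)$. -/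

import Mathlib

open MeasureTheory Filter
open scoped Matrix ENNReal

noncomputable section

namespace SOn2

/-- The quadratic form `Q(x₁, …, xₙ₊₂) = 2 x₁ xₙ₊₂ + 2 x₂ xₙ₊₁ + ∑_{i=3}^{n} xᵢ²` of signature
`(n, 2)` on `ℝⁿ⁺²`. The coordinate `xᵢ` has index `i - 1` in `Fin (n + 2)`. -/
def Q (n : ℕ) : QuadraticForm ℝ (Fin (n + 2) → ℝ) :=
  (2 : ℝ) • QuadraticMap.proj 0 (Fin.last (n + 1))
    + (2 : ℝ) • QuadraticMap.proj 1 ⟨n, by omega⟩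
    + ∑ i : Fin (n + 2) with 2 ≤ i.val ∧ i.val < n, QuadraticMap.proj i i

/-- `SO(Q)`, the elements of `SL(n + 2, ℝ)` that preserve `Q`. -/
def SOQ (n : ℕ) : Subgroup (Matrix.SpecialLinearGroup (Fin (n + 2)) ℝ) where
  carrier := {g | ∀ x, Q n (g.1 *ᵥ x) = Q n x}
  one_mem' x := by simp
  mul_mem' {a b} ha hb x := by
    have := ha (b.1 *ᵥ x)
    rw [Matrix.mulVec_mulVec] at this
    simpa [hb x] using this
  inv_mem' {a} ha x := by
    have h := ha ((a⁻¹).1 *ᵥ x)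
    have e : a.1 * (a⁻¹).1 = 1 := by
      rw [← Matrix.SpecialLinearGroup.coe_mul, mul_inv_cancel, Matrix.SpecialLinearGroup.coe_one]
    rw [Matrix.mulVec_mulVec, e, Matrix.one_mulVec] at h
    exact h.symm

/-- The identity component of a subgroup `L` (in the subspace topology), as a subgroup of the
ambient group. -/
def identityComponent {S : Type*} [Group S] [TopologicalSpace S] [IsTopologicalGroup S]
    (L : Subgroup S) : Subgroup S :=
  (Subgroup.connectedComponentOfOne L).map L.subtype

/-- `G = SO°(n, 2)`. -/
def G (n : ℕ) : Subgroup (Matrix.SpecialLinearGroup (Fin (n + 2)) ℝ) :=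
  identityComponent (SOQ n)

/-- The hyperplane `V = {x₁ = xₙ₊₂}`; the restriction of `Q` to it has signature `(n, 1)`. -/
def V (n : ℕ) : Submodule ℝ (Fin (n + 2) → ℝ) where
  carrier := {x | x 0 = x (Fin.last (n + 1))}
  add_mem' {a b} ha hb := by
    simp only [Set.mem_ofPred_eq, Pi.add_apply] at *
    rw [ha, hb]
  zero_mem' := rfl
  smul_mem' c x hx := by
    simp only [Set.mem_ofPred_eq, Pi.smul_apply] at *
    rw [hx]

/-- `{g ∈ G : g V = V}`. -/
def stabV (n : ℕ) : Subgroup (Matrix.SpecialLinearGroup (Fin (n + 2)) ℝ) where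
  carrier := {g | g ∈ G n ∧ (V n).map g.1.mulVecLin = V n}
  one_mem' := ⟨one_mem _, by simp⟩
  mul_mem' {a b} ha hb := by
    refine ⟨mul_mem ha.1 hb.1, ?_⟩
    rw [Matrix.SpecialLinearGroup.coe_mul, Matrix.mulVecLin_mul, Submodule.map_comp, hb.2, ha.2]
  inv_mem' {a} ha := by
    refine ⟨inv_mem ha.1, ?_⟩
    have e : (a⁻¹).1 * a.1 = 1 := by
      rw [← Matrix.SpecialLinearGroup.coe_mul, inv_mul_cancel, Matrix.SpecialLinearGroup.coe_one]
    conv_lhs => rw [← ha.2]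
    rw [← Submodule.map_comp, ← Matrix.mulVecLin_mul, e, Matrix.mulVecLin_one, Submodule.map_id]

/-- `H = SO°(n, 1)`, the identity component of the stabilizer of `V` in `G`. It acts on `V` as
`SO°(Q|_V)` and fixes the `Q`-orthogonal line of `V` pointwise. -/
def H (n : ℕ) : Subgroup (Matrix.SpecialLinearGroup (Fin (n + 2)) ℝ) :=
  identityComponent (stabV n)

/-- The maximal compact subgroup `K = {g ∈ G : g gᵀ = 1} = G ∩ SO(n + 2)`. -/
def K (n : ℕ) : Set (Matrix.SpecialLinearGroup (Fin (n + 2)) ℝ) :=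
  {g | g ∈ G n ∧ g.1 * g.1ᵀ = 1}

/-- The Cartan subspace `𝔞` is identified with `ℝ × ℝ`: the pair `v = (v₁, v₂)` stands for the
vector `(v₁, v₂, 0, …, 0, -v₂, -v₁)`, that is, for the diagonal matrix with these entries. -/
def aVec (n : ℕ) (v : ℝ × ℝ) : Fin (n + 2) → ℝ := fun i =>
  if i.val = 0 then v.1
  else if i.val = 1 then v.2
  else if i.val = n then -v.2
  else if i.val = n + 1 then -v.1
  else 0

/-- The closed positive Weyl chamber `𝔞⁺`. It is `{v₁ ≥ v₂ ≥ 0}` if `n ≥ 3`. If `n = 2`, then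
`v ↦ v₂` is not a root, and the chamber is `{v₁ ≥ |v₂|}`. -/
def aplus (n : ℕ) : Set (ℝ × ℝ) :=
  {v | |v.2| ≤ v.1 ∧ (n ≠ 2 → 0 ≤ v.2)}

/-- `v ∈ 𝔞⁺` and `g ∈ K exp(v) K`. -/
def IsCartanProj (n : ℕ) (g : Matrix.SpecialLinearGroup (Fin (n + 2)) ℝ) (v : ℝ × ℝ) : Prop :=
  v ∈ aplus n ∧ ∃ k ∈ K n, ∃ l ∈ K n,
    g.1 = k.1 * Matrix.diagonal (fun i => Real.exp (aVec n v i)) * l.1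

/-- The Cartan projection `μ`: for `g ∈ G`, the unique `μ(g) ∈ 𝔞⁺` with `g ∈ K exp(μ(g)) K`. -/
def cartanProj (n : ℕ) (g : Matrix.SpecialLinearGroup (Fin (n + 2)) ℝ) : ℝ × ℝ :=
  Classical.epsilon (IsCartanProj n g)

/-- `C` is a cone contained in `𝔞⁺` that is open in `𝔞⁺`. -/
def IsOpenCone (n : ℕ) (C : Set (ℝ × ℝ)) : Prop :=
  (∃ U : Set (ℝ × ℝ), IsOpen U ∧ C = aplus n ∩ U) ∧ ∀ x ∈ C, ∀ t : ℝ, 0 < t → t • x ∈ C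

/-- The growth indicator of `Γ`, computed with the norm `N` on `𝔞`:
`ψ_Γ(v) = N(v) · inf_{C ∋ v} limsup_{T → ∞} (log #{γ ∈ Γ : μ(γ) ∈ C, N(μ(γ)) ≤ T}) / T`
for `v ∈ 𝔞⁺`, with `log 0 = -∞`. -/
def growthIndicator (n : ℕ) (N : Seminorm ℝ (ℝ × ℝ))
    (Γ : Subgroup (Matrix.SpecialLinearGroup (Fin (n + 2)) ℝ)) (v : ℝ × ℝ) : EReal :=
  (N v : EReal) * ⨅ (C : Set (ℝ × ℝ)) (_ : IsOpenCone n C ∧ v ∈ C),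
    limsup (fun T : ℝ =>
      ENNReal.log (({γ | γ ∈ Γ ∧ cartanProj n γ ∈ C ∧ N (cartanProj n γ) ≤ T}.encard : ℕ∞) : ℝ≥0∞)
        / (T : EReal)) atTop

/-- The root space in `𝔤 = 𝔰𝔬(Q)` of a linear form `α` on `𝔞`: the matrices `X` in `𝔤`, i.e. with
`B(x, X x) = 0` for all `x`, where `B` is the symmetric bilinear form of `Q`,
such that `[v, X] = α(v) X` for all `v ∈ 𝔞`. -/
def rootSpace (n : ℕ) (α : (ℝ × ℝ) →ₗ[ℝ] ℝ) :
    Submodule ℝ (Matrix (Fin (n + 2)) (Fin (n + 2)) ℝ) where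
  carrier := {X | (∀ x, (Q n).polarBilin x (X *ᵥ x) = 0) ∧
    ∀ v : ℝ × ℝ, Matrix.diagonal (aVec n v) * X - X * Matrix.diagonal (aVec n v) = α v • X}
  add_mem' {X Y} hX hY := by
    refine ⟨fun x => ?_, fun v => ?_⟩
    · rw [Matrix.add_mulVec, map_add, hX.1, hY.1, add_zero]
    · rw [mul_add, add_mul, smul_add, ← hX.2 v, ← hY.2 v]; abel
  zero_mem' := ⟨fun x => by rw [Matrix.zero_mulVec, map_zero], fun v => by simp⟩
  smul_mem' c X hX := by
    refine ⟨fun x => ?_, fun v => ?_⟩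
    · rw [Matrix.smul_mulVec, map_smul, hX.1, smul_zero]
    · rw [Matrix.mul_smul, Matrix.smul_mul, ← smul_sub, hX.2 v, smul_comm]

/-- The half-sum `ρ` of the positive roots of `(𝔤, 𝔞)`, counted with multiplicity; a root is
positive if it is nonnegative on `𝔞⁺`. Linear forms that are not roots have multiplicity `0`. -/
def rho (n : ℕ) (v : ℝ × ℝ) : ℝ :=
  (1 / 2) * ∑ᶠ α ∈ {α : (ℝ × ℝ) →ₗ[ℝ] ℝ | α ≠ 0 ∧ ∀ w ∈ aplus n, 0 ≤ α w},
    (Module.finrank ℝ (rootSpace n α) : ℝ) * α v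

/-- `Γ` is a lattice in the topological group `L`: it is discrete, and `Γ \ L` has finite volume,
i.e. the left action of `Γ` on `L` has a fundamental domain of finite Haar measure. -/
def IsLattice {L : Type*} [Group L] [TopologicalSpace L] (Γ : Subgroup L) : Prop :=
  DiscreteTopology Γ ∧
    letI : MeasurableSpace L := borel L
    ∃ m : Measure L, m.IsHaarMeasure ∧ ∃ F : Set L, IsFundamentalDomain Γ F m ∧ m F < ∞

end SOn2

end

/-! An element of `H` fixes `eps` and acts on the sheet through `base` of the hyperboloid in `V`, a
model of hyperbolic `n`-space; `coshDist` is the hyperbolic cosine of the displacement of `base`.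
Every `h` in `H` is `k * flow t * l` with `k`, `l` in `K` and `cosh t` the displacement. The flow
sits in the second coordinate of `𝔞`, and a Weyl element, which lies in `K` but not in `H`, moves it
to the first. Hence `μ(h) = (t, 0)` (`cartanProj_of_mem_H`), and `μ(Γ)` lies on a single ray. Off
the ray some open cone misses `μ(Γ)`, so the indicator is `-∞`. On the ray it is the exponential
growth rate of the orbit of `base`, normalised by `N`, and this rate has to be shown to be `n - 1`.

The upper bound (`exists_count_le`) needs only discreteness. In half space coordinates a ball of
radius `T` meets `O(T * exp ((n - 1) * T))` cells of bounded diameter, and each cell contains a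
bounded number of orbit points.

The lower bound (`lattice_count_unbounded`) comes from finite covolume, through recurrence rather
than mixing. By Poincaré recurrence and Borel-Cantelli, the measures of the sets of points of a ball
`U` that return to `Γ U` at time `k` under the flow have infinite sum
(`tsum_measure_return_eq_top`). The points that return by means of a fixed `γ` form a set that is
thin in the `n - 1` directions expanded by the flow, so its measure is `O(exp (-(n - 1) * k))`,
uniformly in `γ` (`packing`, `measure_return_le`). Only elements with `coshDist` at most `16 * exp
k` can contribute, so a count of order `exp (s * k)` with `s < n - 1` would make the sum finite.

For the comparison with `ρ`, only its values on the ray matter, since the indicator is `-∞`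
elsewhere; `rho_fst` computes them from the root spaces. -/

noncomputable section

namespace SOn2

/-! ### Recurrence on the quotient by a lattice -/

section Recurrence

variable {L : Type*} [Group L] [TopologicalSpace L] [IsTopologicalGroup L]
  [LocallyCompactSpace L] [SecondCountableTopology L] [MeasurableSpace L] [BorelSpace L]

/-- Right translation commutes with the left action of `Γ` and preserves null sets. -/
theorem isFundamentalDomain_preimage_mul_right (Γ : Subgroup L) (m : Measure L) [m.IsHaarMeasure]
    {F : Set L} (hF : IsFundamentalDomain Γ F m) (a : L) :
    IsFundamentalDomain Γ ((· * a) ⁻¹' F) m := by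
  refine hF.preimage_of_equiv (f := (· * a)) ?_ (e := id) Function.bijective_id ?_
  · exact quasiMeasurePreserving_mul_right m a
  · intro g x
    exact mul_assoc _ _ _

/-- A group with a lattice is unimodular. -/
theorem measurePreserving_mul_right_of_lattice (Γ : Subgroup L) [Countable Γ] (m : Measure L)
    [m.IsHaarMeasure] {F : Set L} (hF : IsFundamentalDomain Γ F m) (hfin : m F < ∞) (a : L) :
    MeasurePreserving (· * a) m m := by
  have hmeas : Measurable (· * a : L → L) := measurable_mul_const a
  refine ⟨hmeas, ?_⟩
  -- By uniqueness of Haar measure, right translation scales `m` by a constant. Both `F` and its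
  -- right translate are fundamental domains, so they have equal measure, and `0 < m F < ∞` forces
  -- the constant to be `1`.
  have h := Measure.isMulLeftInvariant_eq_smul (Measure.map (· * a) m) m
  have hF0 : m F ≠ 0 := hF.measure_ne_zero (NeZero.ne m)
  have h1 : Measure.map (· * a) m F = m F := by
    refine ((MeasurableEquiv.mulRight a).map_apply F).trans ?_
    exact (isFundamentalDomain_preimage_mul_right Γ m hF a).measure_eq hF
  set c := Measure.haarScalarFactor (Measure.map (· * a) m) m
  have h2 : (c : ℝ≥0∞) * m F = m F := by
    have := congrArg (fun μ : Measure L => μ F) h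
    simp only [Measure.smul_apply, h1] at this
    exact this.symm
  have h3 : (c : ℝ≥0∞) = 1 := by
    have := (ENNReal.mul_eq_right hF0 hfin.ne).1 h2
    exact this
  have h4 : c = 1 := by exact_mod_cast h3
  rw [h, h4, one_smul]

/-- Poincaré recurrence on `Γ \ L`, in quantitative form: if `Γ` is a lattice in `L`, the
measures of the sets of points of `U` that return to `Γ U` under right multiplication by `a ^ k`
are not summable. -/
theorem tsum_measure_return_eq_top (Γ : Subgroup L) [Countable Γ] (m : Measure L)
    [m.IsHaarMeasure] {F : Set L} (hF : IsFundamentalDomain Γ F m) (hfin : m F < ∞) (a : L)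
    {U : Set L} (hU : MeasurableSet U) (hU0 : m U ≠ 0) :
    ∑' k : ℕ, m {x | x ∈ U ∧ ∃ γ : Γ, (γ : L) * x * a ^ k ∈ U} = ∞ := by
  by_contra hsum
  let X := Quotient (MulAction.orbitRel Γ L)
  let π : L → X := Quotient.mk _
  have hπ : Measurable π := measurable_quotient_mk''
  have hπ_eq : ∀ x y : L, π x = π y ↔ ∃ γ : Γ, (γ : L) * y = x := fun x y => by
    rw [Quotient.eq]; rfl
  have hπ_smul : ∀ (γ : Γ) (x : L), π ((γ : L) * x) = π x := fun γ x => (hπ_eq _ _).2 ⟨γ, rfl⟩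
  let T : X → X := Quotient.map (· * a) (by
    rintro x y ⟨γ, h⟩
    exact ⟨γ, by simp only [← h]; exact (mul_assoc _ _ _).symm⟩)
  have hTπ : ∀ x, T (π x) = π (x * a) := fun x => rfl
  have hTk : ∀ (k : ℕ) x, T^[k] (π x) = π (x * a ^ k) := by
    intro k
    induction k with
    | zero => intro x; simp
    | succ k ih => intro x; rw [Function.iterate_succ_apply, hTπ, ih, mul_assoc, pow_succ']
  -- The finite measure on `Γ \ L` induced by `m`; right translation by `a` descends to the map `T`.
  let ν : Measure X := (m.restrict F).map π
  have : IsFiniteMeasure (m.restrict F) := ⟨by simpa using hfin⟩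
  have : IsFiniteMeasure ν := by infer_instance
  have hTm : Measurable T := by
    refine measurable_from_quotient.2 ?_
    exact hπ.comp (measurable_mul_const a)
  have hT : MeasurePreserving T ν ν := by
    refine ⟨hTm, ?_⟩
    ext A hA
    rw [Measure.map_apply hTm hA, Measure.map_apply hπ (hTm hA), Measure.map_apply hπ hA,
      Measure.restrict_apply (hπ (hTm hA)), Measure.restrict_apply (hπ hA)]
    have hF' := isFundamentalDomain_preimage_mul_right Γ m hF a
    -- Unimodularity replaces `F` by its right translate; a `Γ`-invariant set has the same measure
    -- inside either fundamental domain.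
    have e1 : m (π ⁻¹' (T ⁻¹' A) ∩ (· * a) ⁻¹' F) = m (π ⁻¹' A ∩ F) := by
      have hp := measurePreserving_mul_right_of_lattice Γ m hF hfin a
      rw [← hp.measure_preimage ((hπ hA).nullMeasurableSet.inter hF.nullMeasurableSet)]
      rfl
    rw [← e1]
    refine hF.measure_set_eq hF' (hπ (hTm hA)) fun g => ?_
    ext x
    change T (π ((g : L) * x)) ∈ A ↔ T (π x) ∈ A
    rw [hπ_smul]
  let S : Set X := π '' U
  have hpreS : π ⁻¹' S = ⋃ γ : Γ, (fun x => (γ : L) * x) ⁻¹' U := by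
    ext x
    simp only [S, Set.mem_preimage, Set.mem_image, Set.mem_iUnion]
    constructor
    · rintro ⟨u, hu, h⟩
      obtain ⟨γ, rfl⟩ := (hπ_eq _ _).1 h
      exact ⟨γ, hu⟩
    · rintro ⟨γ, h⟩
      exact ⟨_, h, hπ_smul _ _⟩
  have hS : MeasurableSet S := by
    change MeasurableSet (π ⁻¹' S)
    rw [hpreS]
    exact MeasurableSet.iUnion fun γ => measurable_const_mul (γ : L) hU
  have hrec := hT.conservative.ae_mem_imp_frequently_image_mem hS.nullMeasurableSet
  let R : ℕ → Set L := fun k => {x | x ∈ U ∧ ∃ γ : Γ, (γ : L) * x * a ^ k ∈ U}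
  -- A point of `F` over a returning point of `S` is carried into `R k` by some `γ`, so the
  -- `Γ`-translates of `R k` cover these points of `F`. Overlaps of the translates only help.
  have hle : ∀ k, ν (S ∩ T^[k] ⁻¹' S) ≤ m (R k) := by
    intro k
    rw [Measure.map_apply hπ (hS.inter ((hTm.iterate k) hS)),
      Measure.restrict_apply (hπ (hS.inter ((hTm.iterate k) hS))), hF.measure_eq_tsum (R k)]
    refine le_trans (measure_mono ?_) (measure_iUnion_le _)
    rintro x ⟨⟨hxS, hxT⟩, hxF⟩
    obtain ⟨u, hu, hux⟩ := hxS
    obtain ⟨γ, rfl⟩ := (hπ_eq _ _).1 hux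
    simp only [Set.mem_preimage, hTk] at hxT
    obtain ⟨u', hu', hux'⟩ := hxT
    obtain ⟨γ', rfl⟩ := (hπ_eq _ _).1 hux'
    refine Set.mem_iUnion.2 ⟨γ⁻¹, ⟨(γ : L) * x, ⟨hu, γ' * γ⁻¹, ?_⟩, ?_⟩, hxF⟩
    · simpa [mul_assoc] using hu'
    · change ((γ⁻¹ : Γ) : L) * ((γ : L) * x) = x
      simp
  have hfinsum : ∑' k, ν (S ∩ T^[k] ⁻¹' S) ≠ ∞ :=
    ((ENNReal.tsum_le_tsum hle).trans_lt (lt_top_iff_ne_top.2 hsum)).ne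
  -- Borel-Cantelli allows almost every point only finitely many returns, while recurrence gives
  -- almost every point of `S` infinitely many; so `S` is null.
  have hev := ae_eventually_notMem hfinsum
  have hS0 : ν S = 0 := by
    refine measure_eq_zero_iff_ae_notMem.2 ?_
    filter_upwards [hrec, hev] with x h1 h2 hx
    obtain ⟨k, hk1, hk2⟩ := ((h1 hx).and_eventually h2).exists
    exact hk2 ⟨hx, hk1⟩
  rw [Measure.map_apply hπ hS, Measure.restrict_apply (hπ hS)] at hS0
  have h0 := hF.measure_zero_of_invariant (π ⁻¹' S) (fun g => by
    ext x
    rw [Set.mem_smul_set_iff_inv_smul_mem]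
    change π (((g⁻¹ : Γ) : L) * x) ∈ S ↔ π x ∈ S
    rw [hπ_smul]) hS0
  exact hU0 (measure_mono_null (Set.subset_preimage_image π U) h0)

end Recurrence

/-! ### The Gram matrix of `Q` and its orthogonal group -/

open Matrix

/-- The involution `i ↦ σ i` of the indices with `Q x = ∑ i, x i * x (σ i)`. -/
def dual (n : ℕ) (i : Fin (n + 2)) : Fin (n + 2) :=
  if i.val = 0 then Fin.last (n + 1)
  else if i.val = 1 then ⟨n, by omega⟩
  else if i.val = n then 1
  else if i.val = n + 1 then 0
  else i

theorem dual_val (n : ℕ) (i : Fin (n + 2)) :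
    (dual n i).val = if i.val = 0 then n + 1 else if i.val = 1 then n else if i.val = n then 1
      else if i.val = n + 1 then 0 else i.val := by
  unfold dual
  split_ifs <;> simp

theorem dual_dual {n : ℕ} (hn : 2 ≤ n) (i : Fin (n + 2)) : dual n (dual n i) = i := by
  apply Fin.ext
  rw [dual_val, dual_val]
  have := i.isLt
  grind

theorem dual_eq_iff {n : ℕ} (hn : 2 ≤ n) (i j : Fin (n + 2)) : j = dual n i ↔ i = dual n j :=
  ⟨fun h => by rw [h, dual_dual hn], fun h => by rw [h, dual_dual hn]⟩

/-- The Gram matrix of `Q`. -/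
def J (n : ℕ) : Matrix (Fin (n + 2)) (Fin (n + 2)) ℝ := fun i j => if j = dual n i then 1 else 0

theorem J_mulVec {n : ℕ} (x : Fin (n + 2) → ℝ) (i : Fin (n + 2)) :
    (J n *ᵥ x) i = x (dual n i) := by
  simp [J, mulVec, dotProduct]

theorem J_transpose {n : ℕ} (hn : 2 ≤ n) : (J n)ᵀ = J n := by
  ext i j
  simp only [transpose_apply, J, dual_eq_iff hn i j]

theorem J_mul_J {n : ℕ} (hn : 2 ≤ n) : J n * J n = 1 := by
  apply Matrix.ext_of_mulVec_single
  intro i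
  rw [← mulVec_mulVec, one_mulVec]
  ext j
  rw [J_mulVec, J_mulVec, dual_dual hn]

theorem sum_split {n : ℕ} (hn : 2 ≤ n) (g : Fin (n + 2) → ℝ) :
    ∑ i, g i = g 0 + g (Fin.last (n + 1)) + g 1 + g ⟨n, by omega⟩
      + ∑ i : Fin (n + 2) with 2 ≤ i.val ∧ i.val < n, g i := by
  have hu : (Finset.univ : Finset (Fin (n + 2))) =
      insert 0 (insert (Fin.last (n + 1)) (insert 1 (insert ⟨n, by omega⟩
        (Finset.univ.filter fun i : Fin (n + 2) => 2 ≤ i.val ∧ i.val < n)))) := by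
    ext i
    simp only [Finset.mem_univ, Finset.mem_insert, Finset.mem_filter, true_and, Fin.ext_iff,
      Fin.val_zero, Fin.val_last, Fin.val_one, true_iff]
    have := i.isLt
    omega
  conv_lhs => rw [hu]
  rw [Finset.sum_insert, Finset.sum_insert, Finset.sum_insert, Finset.sum_insert]
  · ring
  all_goals
    simp only [Finset.mem_insert, Finset.mem_filter, Finset.mem_univ, true_and, Fin.ext_iff,
      Fin.val_zero, Fin.val_last, Fin.val_one]
    omega

theorem Q_eq {n : ℕ} (hn : 2 ≤ n) (x : Fin (n + 2) → ℝ) : Q n x = x ⬝ᵥ (J n *ᵥ x) := by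
  rw [dotProduct, sum_split hn]
  simp only [J_mulVec]
  have h0 : dual n 0 = Fin.last (n + 1) := by simp [dual]
  have h1 : dual n 1 = ⟨n, by omega⟩ := by simp [dual]
  have h2 : dual n ⟨n, by omega⟩ = 1 := by
    rw [← h1, dual_dual hn]
  have h3 : dual n (Fin.last (n + 1)) = 0 := by
    rw [← h0, dual_dual hn]
  have h4 : ∑ i : Fin (n + 2) with 2 ≤ i.val ∧ i.val < n, x i * x (dual n i)
      = ∑ i : Fin (n + 2) with 2 ≤ i.val ∧ i.val < n, x i * x i := by
    refine Finset.sum_congr rfl fun i hi => ?_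
    have : dual n i = i := by
      apply Fin.ext
      rw [dual_val]
      simp only [Finset.mem_filter] at hi
      split_ifs <;> omega
    rw [this]
  rw [h0, h1, h2, h3, h4, Q]
  simp only [_root_.add_apply, _root_.smul_apply, QuadraticMap.proj_apply,
    _root_.sum_apply, smul_eq_mul]
  ring

theorem dotProduct_J_comm {n : ℕ} (hn : 2 ≤ n) (x y : Fin (n + 2) → ℝ) :
    x ⬝ᵥ (J n *ᵥ y) = (J n *ᵥ x) ⬝ᵥ y := by
  rw [dotProduct_mulVec, ← mulVec_transpose, J_transpose hn]

theorem J_mulVec_J {n : ℕ} (hn : 2 ≤ n) (x : Fin (n + 2) → ℝ) : J n *ᵥ (J n *ᵥ x) = x := by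
  rw [mulVec_mulVec, J_mul_J hn, one_mulVec]

theorem J_dotProduct_J {n : ℕ} (hn : 2 ≤ n) (x y : Fin (n + 2) → ℝ) :
    (J n *ᵥ x) ⬝ᵥ (J n *ᵥ y) = x ⬝ᵥ y := by
  rw [← dotProduct_J_comm hn, J_mulVec_J hn]

/-- Symmetric matrices with the same quadratic form are equal. -/
theorem eq_of_quadratic_eq {ι : Type*} [Fintype ι] [DecidableEq ι] {A B : Matrix ι ι ℝ}
    (hA : Aᵀ = A) (hB : Bᵀ = B) (h : ∀ x, x ⬝ᵥ (A *ᵥ x) = x ⬝ᵥ (B *ᵥ x)) : A = B := by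
  ext i j
  have hs : ∀ M : Matrix ι ι ℝ, (Pi.single i 1 + Pi.single j 1 : ι → ℝ) ⬝ᵥ
      (M *ᵥ (Pi.single i 1 + Pi.single j 1)) = M i i + M i j + M j i + M j j := by
    intro M
    simp [mulVec_add, add_dotProduct, dotProduct_add, Matrix.col]
    ring
  have hd : ∀ (M : Matrix ι ι ℝ) (k : ι), (Pi.single k 1 : ι → ℝ) ⬝ᵥ
      (M *ᵥ (Pi.single k 1)) = M k k := by
    intro M k
    simp [Matrix.col]
  have h1 := h (Pi.single i 1 + Pi.single j 1)
  have h2 := h (Pi.single i 1)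
  have h3 := h (Pi.single j 1)
  rw [hs, hs] at h1
  rw [hd, hd] at h2 h3
  have hA' : A j i = A i j := congrFun (congrFun hA i) j
  have hB' : B j i = B i j := congrFun (congrFun hB i) j
  linarith

theorem eq_of_bilinear_eq {ι : Type*} [Fintype ι] [DecidableEq ι] {A B : Matrix ι ι ℝ}
    (h : ∀ x y, x ⬝ᵥ (A *ᵥ y) = x ⬝ᵥ (B *ᵥ y)) : A = B := by
  ext i j
  have := h (Pi.single i 1) (Pi.single j 1)
  simpa [Matrix.col] using this

theorem dotProduct_mulVec_mulVec {ι : Type*} [Fintype ι] (g M : Matrix ι ι ℝ) (x y : ι → ℝ) :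
    (g *ᵥ x) ⬝ᵥ (M *ᵥ (g *ᵥ y)) = x ⬝ᵥ ((gᵀ * M * g) *ᵥ y) := by
  rw [← mulVec_mulVec, ← mulVec_mulVec, dotProduct_mulVec x, vecMul_transpose]

theorem mem_SOQ_iff {n : ℕ} (hn : 2 ≤ n) (g : SpecialLinearGroup (Fin (n + 2)) ℝ) :
    g ∈ SOQ n ↔ g.1ᵀ * J n * g.1 = J n := by
  have key : ∀ x, Q n (g.1 *ᵥ x) = x ⬝ᵥ ((g.1ᵀ * J n * g.1) *ᵥ x) := fun x => by
    rw [Q_eq hn, dotProduct_mulVec_mulVec]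
  constructor
  · intro h
    refine eq_of_quadratic_eq ?_ (J_transpose hn) fun x => ?_
    · rw [transpose_mul, transpose_mul, transpose_transpose, J_transpose hn, Matrix.mul_assoc]
    · rw [← key, h x, Q_eq hn]
  · intro h x
    rw [key, h, Q_eq hn]

theorem SOQ.bilin {n : ℕ} (hn : 2 ≤ n) {g : SpecialLinearGroup (Fin (n + 2)) ℝ} (hg : g ∈ SOQ n)
    (x y : Fin (n + 2) → ℝ) : (g.1 *ᵥ x) ⬝ᵥ (J n *ᵥ (g.1 *ᵥ y)) = x ⬝ᵥ (J n *ᵥ y) := by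
  rw [dotProduct_mulVec_mulVec, (mem_SOQ_iff hn g).1 hg]

theorem SL.coe_inv_mul {ι : Type*} [Fintype ι] [DecidableEq ι] (g : SpecialLinearGroup ι ℝ) :
    (g⁻¹).1 * g.1 = 1 :=
  congrArg Subtype.val (inv_mul_cancel g)

theorem SL.coe_mul_inv {ι : Type*} [Fintype ι] [DecidableEq ι] (g : SpecialLinearGroup ι ℝ) :
    g.1 * (g⁻¹).1 = 1 :=
  congrArg Subtype.val (mul_inv_cancel g)

theorem SL.inv_mulVec_mulVec {ι : Type*} [Fintype ι] [DecidableEq ι]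
    (g : SpecialLinearGroup ι ℝ) (x : ι → ℝ) : (g⁻¹).1 *ᵥ (g.1 *ᵥ x) = x := by
  rw [mulVec_mulVec, SL.coe_inv_mul, one_mulVec]

theorem SL.mulVec_inv_mulVec {ι : Type*} [Fintype ι] [DecidableEq ι]
    (g : SpecialLinearGroup ι ℝ) (x : ι → ℝ) : g.1 *ᵥ ((g⁻¹).1 *ᵥ x) = x := by
  rw [mulVec_mulVec, SL.coe_mul_inv, one_mulVec]

theorem SL.mul_mulVec {ι : Type*} [Fintype ι] [DecidableEq ι]
    (g h : SpecialLinearGroup ι ℝ) (x : ι → ℝ) : (g * h).1 *ᵥ x = g.1 *ᵥ (h.1 *ᵥ x) :=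
  (mulVec_mulVec x g.1 h.1).symm

theorem SOQ.bilin_inv {n : ℕ} (hn : 2 ≤ n) {g : SpecialLinearGroup (Fin (n + 2)) ℝ}
    (hg : g ∈ SOQ n) (x y : Fin (n + 2) → ℝ) :
    x ⬝ᵥ (J n *ᵥ (g.1 *ᵥ y)) = ((g⁻¹).1 *ᵥ x) ⬝ᵥ (J n *ᵥ y) := by
  rw [← SOQ.bilin hn hg ((g⁻¹).1 *ᵥ x) y, SL.mulVec_inv_mulVec]

/-! ### The negative definite plane -/

/-- The vector `e₁ - eₙ₊₂`, which spans the `Q`-orthogonal complement of `V`. -/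
def eps (n : ℕ) : Fin (n + 2) → ℝ := Pi.single 0 1 - Pi.single (Fin.last (n + 1)) 1

/-- The vector `e₂ - eₙ₊₁`, the base point of the hyperboloid in `V`. -/
def base (n : ℕ) : Fin (n + 2) → ℝ := Pi.single 1 1 - Pi.single ⟨n, by omega⟩ 1

theorem eps_dotProduct {n : ℕ} (x : Fin (n + 2) → ℝ) :
    eps n ⬝ᵥ x = x 0 - x (Fin.last (n + 1)) := by
  simp [eps, sub_dotProduct]

theorem base_dotProduct {n : ℕ} (x : Fin (n + 2) → ℝ) :
    base n ⬝ᵥ x = x 1 - x ⟨n, by omega⟩ := by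
  simp [base, sub_dotProduct]

theorem dual_zero (n : ℕ) : dual n 0 = Fin.last (n + 1) := by simp [dual]

theorem dual_one (n : ℕ) : dual n 1 = ⟨n, by omega⟩ := by simp [dual]

theorem dual_last {n : ℕ} (hn : 2 ≤ n) : dual n (Fin.last (n + 1)) = 0 := by
  rw [← dual_zero, dual_dual hn]

theorem dual_n {n : ℕ} (hn : 2 ≤ n) : dual n ⟨n, by omega⟩ = 1 := by
  rw [← dual_one, dual_dual hn]

theorem dual_mid {n : ℕ} {i : Fin (n + 2)} (h : 2 ≤ i.val ∧ i.val < n) : dual n i = i := by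
  apply Fin.ext
  rw [dual_val]
  split_ifs <;> omega

theorem J_single {n : ℕ} (hn : 2 ≤ n) (i : Fin (n + 2)) :
    J n *ᵥ (Pi.single i 1) = Pi.single (dual n i) 1 := by
  ext j
  rw [J_mulVec, Pi.single_apply, Pi.single_apply]
  simp only [dual_eq_iff hn i j, eq_comm]

theorem J_eps {n : ℕ} (hn : 2 ≤ n) : J n *ᵥ eps n = -eps n := by
  rw [eps, mulVec_sub, J_single hn, J_single hn, dual_zero, dual_last hn, neg_sub]

theorem J_base {n : ℕ} (hn : 2 ≤ n) : J n *ᵥ base n = -base n := by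
  rw [base, mulVec_sub, J_single hn, J_single hn, dual_one, dual_n hn, neg_sub]

theorem eps_dotProduct_eps (n : ℕ) : eps n ⬝ᵥ eps n = 2 := by
  rw [eps_dotProduct]
  simp [eps, Fin.ext_iff]
  norm_num

theorem base_dotProduct_base {n : ℕ} (hn : 2 ≤ n) : base n ⬝ᵥ base n = 2 := by
  have : n ≠ 1 := by omega
  have : (⟨n, by omega⟩ : Fin (n + 2)) ≠ 1 := by
    simp only [ne_eq, Fin.ext_iff, Fin.val_one]; exact this
  rw [base_dotProduct]
  simp [base, this, this.symm]
  norm_num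

theorem eps_dotProduct_base {n : ℕ} (hn : 2 ≤ n) : eps n ⬝ᵥ base n = 0 := by
  have h1 : n ≠ 0 := by omega
  have h2 : ¬ (Fin.last (n + 1) = (1 : Fin (n + 2))) := by
    simp only [Fin.ext_iff, Fin.val_one, Fin.val_last]; omega
  rw [eps_dotProduct]
  simp [base, Fin.ext_iff, h1, Ne.symm h1]

theorem index_cases {n : ℕ} (i : Fin (n + 2)) :
    i = 0 ∨ i = Fin.last (n + 1) ∨ i = 1 ∨ i = ⟨n, by omega⟩ ∨ (2 ≤ i.val ∧ i.val < n) := by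
  have hi := i.isLt
  simp only [Fin.ext_iff, Fin.val_zero, Fin.val_last, Fin.val_one]
  omega

/-- The projection to the negative definite plane. -/
theorem sub_J {n : ℕ} (hn : 2 ≤ n) (x : Fin (n + 2) → ℝ) :
    x - J n *ᵥ x = (eps n ⬝ᵥ x) • eps n + (base n ⬝ᵥ x) • base n := by
  ext i
  simp only [Pi.sub_apply, J_mulVec, Pi.add_apply, Pi.smul_apply, smul_eq_mul, eps_dotProduct,
    base_dotProduct]
  have a1 : n ≠ 0 := by omega
  have a2 : n ≠ 1 := by omega
  rcases index_cases i with rfl | rfl | rfl | rfl | h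
  · simp [dual_zero, eps, base, Fin.ext_iff, a1.symm]
  · simp [dual_last hn, eps, base, Fin.ext_iff, a1]
  · simp [dual_one, eps, base, Fin.ext_iff, a1, a2.symm]
  · simp [dual_n hn, eps, base, Fin.ext_iff, a1, a2]
  · rw [dual_mid h]
    have b1 : i.val ≠ 0 := by omega
    have b2 : i.val ≠ 1 := by omega
    have b3 : i.val ≠ n := by omega
    have b4 : i.val ≠ n + 1 := by omega
    simp [eps, base, Fin.ext_iff, b1, b2, b3, b4]

/-- The matrix `1 - J` is twice the orthogonal projection to the negative plane spanned by `eps` and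
`base`. For elements of `H` the first two terms on the right are invariant, so Euclidean lengths are
controlled by the pairing with `base` alone. -/
theorem dotProduct_self_eq {n : ℕ} (hn : 2 ≤ n) (x : Fin (n + 2) → ℝ) :
    x ⬝ᵥ x = x ⬝ᵥ (J n *ᵥ x) + (eps n ⬝ᵥ x) ^ 2 + (base n ⬝ᵥ x) ^ 2 := by
  have h : x ⬝ᵥ x - x ⬝ᵥ (J n *ᵥ x) = x ⬝ᵥ (x - J n *ᵥ x) := by rw [dotProduct_sub]
  rw [sub_J hn, dotProduct_add, dotProduct_smul, dotProduct_smul, dotProduct_comm x (eps n),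
    dotProduct_comm x (base n)] at h
  simp only [smul_eq_mul] at h
  linarith

theorem mem_V_iff {n : ℕ} (x : Fin (n + 2) → ℝ) : x ∈ V n ↔ eps n ⬝ᵥ x = 0 := by
  rw [eps_dotProduct, sub_eq_zero]
  rfl

/-! ### Identity components -/

section IdentityComponent

variable {S : Type*} [Group S] [TopologicalSpace S] [IsTopologicalGroup S]

theorem mem_identityComponent_iff {L : Subgroup S} {g : S} :
    g ∈ identityComponent L ↔ ∃ h : g ∈ L, (⟨g, h⟩ : L) ∈ connectedComponent (1 : L) := by
  constructor
  · rintro ⟨⟨x, hx⟩, h, rfl⟩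
    exact ⟨hx, h⟩
  · rintro ⟨h, hg⟩
    exact ⟨⟨g, h⟩, hg, rfl⟩

theorem identityComponent_le (L : Subgroup S) : identityComponent L ≤ L := fun _ h =>
  (mem_identityComponent_iff.1 h).1

theorem mem_identityComponent_of_path {X : Type*} [TopologicalSpace X] [PreconnectedSpace X]
    {L : Subgroup S} {φ : X → S} (hφ : Continuous φ) (hL : ∀ x, φ x ∈ L) {x₀ : X}
    (h1 : φ x₀ = 1) (x : X) : φ x ∈ identityComponent L := by
  refine mem_identityComponent_iff.2 ⟨hL x, ?_⟩
  let ψ : X → L := fun x => ⟨φ x, hL x⟩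
  have hψ : Continuous ψ := hφ.subtype_mk hL
  have h := (isPreconnected_range hψ).subset_connectedComponent (x := ψ x₀) ⟨x₀, rfl⟩
  have e : ψ x₀ = 1 := Subtype.ext h1
  rw [e] at h
  exact h ⟨x, rfl⟩

/-- Intermediate values on a connected set. This is how connectedness of `H` enters: it fixes the
sign of the action on `eps` and the sheet of the hyperboloid. -/
theorem pos_of_mem_identityComponent {L : Subgroup S} {F : S → ℝ} (hF : Continuous F)
    (h0 : ∀ g ∈ L, F g ≠ 0) (h1 : 0 < F 1) {g : S} (hg : g ∈ identityComponent L) : 0 < F g := by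
  obtain ⟨hgL, hc⟩ := mem_identityComponent_iff.1 hg
  by_contra hneg
  have hcont : ContinuousOn (fun x : L => F x) (connectedComponent (1 : L)) :=
    (hF.comp continuous_subtype_val).continuousOn
  obtain ⟨x, -, hx⟩ := isPreconnected_connectedComponent.intermediate_value hc
    (mem_connectedComponent (x := (1 : L))) hcont ⟨not_lt.1 hneg, h1.le⟩
  exact h0 x x.2 hx

theorem isClosed_identityComponent {L : Subgroup S} (hL : IsClosed (L : Set S)) :
    IsClosed (identityComponent L : Set S) := by
  have : (identityComponent L : Set S) = ((↑) : L → S) '' connectedComponent (1 : L) := rfl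
  rw [this]
  exact hL.isClosedEmbedding_subtypeVal.isClosedMap _ isClosed_connectedComponent

end IdentityComponent

variable {n : ℕ}

theorem G_le_SOQ (n : ℕ) : G n ≤ SOQ n := identityComponent_le _

theorem mem_stabV_iff {g : SpecialLinearGroup (Fin (n + 2)) ℝ} :
    g ∈ stabV n ↔ g ∈ G n ∧ (∀ x ∈ V n, g.1 *ᵥ x ∈ V n) ∧ (∀ x ∈ V n, (g⁻¹).1 *ᵥ x ∈ V n) := by
  constructor
  · rintro ⟨hg, hV⟩
    refine ⟨hg, fun x hx => ?_, fun x hx => ?_⟩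
    · rw [← hV]; exact ⟨x, hx, rfl⟩
    · rw [← hV] at hx
      obtain ⟨y, hy, rfl⟩ := hx
      rw [mulVecLin_apply, SL.inv_mulVec_mulVec]
      exact hy
  · rintro ⟨hg, h1, h2⟩
    refine ⟨hg, le_antisymm ?_ fun x hx => ?_⟩
    · rintro _ ⟨x, hx, rfl⟩
      exact h1 x hx
    · exact ⟨_, h2 x hx, SL.mulVec_inv_mulVec g x⟩

theorem H_le_stabV (n : ℕ) : H n ≤ stabV n := identityComponent_le _

theorem H_le_G (n : ℕ) : H n ≤ G n := fun _ h => (mem_stabV_iff.1 (H_le_stabV n h)).1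

theorem H_le_SOQ (n : ℕ) : H n ≤ SOQ n := (H_le_G n).trans (G_le_SOQ n)

theorem continuous_coe_SL {ι : Type*} [Fintype ι] [DecidableEq ι] :
    Continuous (fun g : SpecialLinearGroup ι ℝ => g.1) := continuous_subtype_val

theorem isClosed_SOQ (hn : 2 ≤ n) :
    IsClosed (SOQ n : Set (SpecialLinearGroup (Fin (n + 2)) ℝ)) := by
  have : (SOQ n : Set (SpecialLinearGroup (Fin (n + 2)) ℝ)) = {g | g.1ᵀ * J n * g.1 = J n} := by
    ext g; exact mem_SOQ_iff hn g
  rw [this]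
  have := @continuous_coe_SL (Fin (n + 2)) _ _
  exact isClosed_eq (by fun_prop) continuous_const

theorem isClosed_stabV (hn : 2 ≤ n) :
    IsClosed (stabV n : Set (SpecialLinearGroup (Fin (n + 2)) ℝ)) := by
  have : (stabV n : Set (SpecialLinearGroup (Fin (n + 2)) ℝ)) = (G n : Set _) ∩
      ((⋂ x ∈ V n, {g | eps n ⬝ᵥ (g.1 *ᵥ x) = 0}) ∩
        (⋂ x ∈ V n, {g | eps n ⬝ᵥ ((g⁻¹).1 *ᵥ x) = 0})) := by
    ext g
    simp only [Set.mem_inter_iff, Set.mem_iInter, Set.mem_ofPred_eq, SetLike.mem_coe,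
      mem_stabV_iff, mem_V_iff]
  rw [this]
  have h1 := @continuous_coe_SL (Fin (n + 2)) _ _
  have h2 : Continuous fun g : SpecialLinearGroup (Fin (n + 2)) ℝ => (g⁻¹).1 :=
    h1.comp continuous_inv
  refine (isClosed_identityComponent (isClosed_SOQ hn)).inter (IsClosed.inter ?_ ?_)
  · refine isClosed_biInter fun x _ => isClosed_eq ?_ continuous_const
    exact Continuous.dotProduct continuous_const (h1.matrix_mulVec continuous_const)
  · refine isClosed_biInter fun x _ => isClosed_eq ?_ continuous_const
    exact Continuous.dotProduct continuous_const (h2.matrix_mulVec continuous_const)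

/-- Closedness makes `H` locally compact and second countable, as the recurrence argument requires.
-/
theorem isClosed_H (hn : 2 ≤ n) :
    IsClosed (H n : Set (SpecialLinearGroup (Fin (n + 2)) ℝ)) :=
  isClosed_identityComponent (isClosed_stabV hn)

theorem SOQ.inv_mulVec_eps (g : SpecialLinearGroup (Fin (n + 2)) ℝ)
    (he : g.1 *ᵥ eps n = eps n) : (g⁻¹).1 *ᵥ eps n = eps n := by
  conv_lhs => rw [← he]
  rw [SL.inv_mulVec_mulVec]

/-- Since `J` negates `eps`, a Euclidean pairing with `eps` becomes a pairing for the form of `Q`,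
to which invariance under `SOQ` applies. -/
theorem eps_dotProduct_eq (hn : 2 ≤ n) (x : Fin (n + 2) → ℝ) :
    eps n ⬝ᵥ x = -(eps n ⬝ᵥ (J n *ᵥ x)) := by
  rw [dotProduct_J_comm hn, J_eps hn, neg_dotProduct, neg_neg]

theorem base_dotProduct_eq (hn : 2 ≤ n) (x : Fin (n + 2) → ℝ) :
    base n ⬝ᵥ x = -(base n ⬝ᵥ (J n *ᵥ x)) := by
  rw [dotProduct_J_comm hn, J_base hn, neg_dotProduct, neg_neg]

theorem eps_dotProduct_mulVec (hn : 2 ≤ n) {g : SpecialLinearGroup (Fin (n + 2)) ℝ}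
    (hg : g ∈ SOQ n) (he : g.1 *ᵥ eps n = eps n) (x : Fin (n + 2) → ℝ) :
    eps n ⬝ᵥ (g.1 *ᵥ x) = eps n ⬝ᵥ x := by
  rw [eps_dotProduct_eq hn, SOQ.bilin_inv hn hg, SOQ.inv_mulVec_eps g he, ← eps_dotProduct_eq hn]

theorem mem_stabV_of_mulVec_eps (hn : 2 ≤ n) {g : SpecialLinearGroup (Fin (n + 2)) ℝ}
    (hg : g ∈ G n) (he : g.1 *ᵥ eps n = eps n) : g ∈ stabV n := by
  refine mem_stabV_iff.2 ⟨hg, fun x hx => ?_, fun x hx => ?_⟩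
  · rw [mem_V_iff] at *
    rw [eps_dotProduct_mulVec hn (G_le_SOQ n hg) he, hx]
  · rw [mem_V_iff] at *
    rw [eps_dotProduct_mulVec hn (inv_mem (G_le_SOQ n hg)) (SOQ.inv_mulVec_eps g he), hx]

/-! ### Membership in `G` and `H` through connected families of matrices -/

section Paths

variable {X : Type*} [TopologicalSpace X] [PreconnectedSpace X]
  {φ : X → Matrix (Fin (n + 2)) (Fin (n + 2)) ℝ}

/-- Preserving `J` forces determinant `±1`, and the sign cannot change along a connected family. -/
theorem det_eq_one_of_path (hn : 2 ≤ n) (hφ : Continuous φ)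
    (hJ : ∀ x, (φ x)ᵀ * J n * φ x = J n) {x₀ : X} (h1 : φ x₀ = 1) (x : X) : (φ x).det = 1 := by
  have hJ0 : (J n).det ≠ 0 := by
    intro h
    have := congrArg det (J_mul_J hn)
    rw [det_mul, h, det_one] at this
    norm_num at this
  have hsq : ∀ y, (φ y).det = 1 ∨ (φ y).det = -1 := by
    intro y
    have h := congrArg det (hJ y)
    rw [det_mul, det_mul, det_transpose] at h
    have : ((φ y).det) ^ 2 = 1 := by
      apply mul_left_cancel₀ hJ0
      linarith
    have h0 : ((φ y).det - 1) * ((φ y).det + 1) = 0 := by linarith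
    rcases mul_eq_zero.1 h0 with h' | h'
    · left; linarith
    · right; linarith
  rcases hsq x with h | h
  · exact h
  · obtain ⟨y, -, hy⟩ := isPreconnected_univ.intermediate_value (Set.mem_univ x)
      (Set.mem_univ x₀) (Continuous.matrix_det hφ).continuousOn
      (show (0 : ℝ) ∈ Set.Icc (φ x).det (φ x₀).det by rw [h, h1, det_one]; norm_num)
    have hy' : (φ y).det = 0 := hy
    rcases hsq y with h' | h' <;> rw [h'] at hy' <;> norm_num at hy'

theorem mem_G_of_path (hn : 2 ≤ n) (hφ : Continuous φ)
    (hJ : ∀ x, (φ x)ᵀ * J n * φ x = J n) {x₀ : X} (h1 : φ x₀ = 1) (x : X)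
    {g : SpecialLinearGroup (Fin (n + 2)) ℝ} (hg : g.1 = φ x) : g ∈ G n := by
  let ψ : X → SpecialLinearGroup (Fin (n + 2)) ℝ :=
    fun y => ⟨φ y, det_eq_one_of_path hn hφ hJ h1 y⟩
  have hψ : Continuous ψ := hφ.subtype_mk _
  have e : g = ψ x := Subtype.ext hg
  rw [e]
  exact mem_identityComponent_of_path hψ (fun y => (mem_SOQ_iff hn _).2 (hJ y))
    (x₀ := x₀) (Subtype.ext h1) x

/-- The diagonal flow, the horospherical elements and the rotations fixing `eps` are all placed in
`H` by this criterion. -/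
theorem mem_H_of_path (hn : 2 ≤ n) (hφ : Continuous φ)
    (hJ : ∀ x, (φ x)ᵀ * J n * φ x = J n) {x₀ : X} (h1 : φ x₀ = 1)
    (he : ∀ x, φ x *ᵥ eps n = eps n) (x : X)
    {g : SpecialLinearGroup (Fin (n + 2)) ℝ} (hg : g.1 = φ x) : g ∈ H n := by
  let ψ : X → SpecialLinearGroup (Fin (n + 2)) ℝ :=
    fun y => ⟨φ y, det_eq_one_of_path hn hφ hJ h1 y⟩
  have hψ : Continuous ψ := hφ.subtype_mk _
  have e : g = ψ x := Subtype.ext hg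
  rw [e]
  exact mem_identityComponent_of_path hψ (fun y => mem_stabV_of_mulVec_eps hn
    (mem_G_of_path hn hφ hJ h1 y rfl) (he y)) (x₀ := x₀) (Subtype.ext h1) x

end Paths

/-! ### The action of `H` -/

theorem eq_smul_eps_of_orthogonal {y : Fin (n + 2) → ℝ} (h : ∀ v ∈ V n, y ⬝ᵥ v = 0) :
    y = ((eps n ⬝ᵥ y) / 2) • eps n := by
  set c := (eps n ⬝ᵥ y) / 2 with hc
  have hv : y - c • eps n ∈ V n := by
    rw [mem_V_iff, dotProduct_sub, dotProduct_smul, eps_dotProduct_eps, smul_eq_mul]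
    linarith
  have h1 := h _ hv
  have h2 : (y - c • eps n) ⬝ᵥ (y - c • eps n) = 0 := by
    rw [sub_dotProduct, h1, smul_dotProduct, (mem_V_iff _).1 hv, smul_zero, sub_zero]
  exact sub_eq_zero.1 (dotProduct_self_eq_zero.1 h2)

/-- An isometry of `Q` that preserves `V` also preserves its `Q`-orthogonal line, which `eps` spans.
-/
theorem stabV.mulVec_eps (hn : 2 ≤ n) {g : SpecialLinearGroup (Fin (n + 2)) ℝ}
    (hg : g ∈ stabV n) : g.1 *ᵥ eps n = ((eps n ⬝ᵥ (g.1 *ᵥ eps n)) / 2) • eps n := by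
  obtain ⟨hG, -, hV⟩ := mem_stabV_iff.1 hg
  refine eq_smul_eps_of_orthogonal fun v hv => ?_
  have hJV : ∀ w ∈ V n, (g.1 *ᵥ eps n) ⬝ᵥ (J n *ᵥ w) = 0 := fun w hw => by
    rw [← SL.mulVec_inv_mulVec g w, SOQ.bilin hn (G_le_SOQ n hG), dotProduct_J_comm hn,
      J_eps hn, neg_dotProduct, (mem_V_iff _).1 (hV w hw), neg_zero]
  have hJvV : J n *ᵥ v ∈ V n := by
    rw [mem_V_iff, ← neg_eq_zero, ← eps_dotProduct_eq hn]
    exact (mem_V_iff _).1 hv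
  have := hJV _ hJvV
  rwa [J_mulVec_J hn] at this

/-- The factor by which `eps` is scaled is `±1`, because `Q` is nonzero on `eps`; connectedness
selects `+1`. -/
theorem H.mulVec_eps (hn : 2 ≤ n) {g : SpecialLinearGroup (Fin (n + 2)) ℝ}
    (hg : g ∈ H n) : g.1 *ᵥ eps n = eps n := by
  set F : SpecialLinearGroup (Fin (n + 2)) ℝ → ℝ := fun g => eps n ⬝ᵥ (g.1 *ᵥ eps n) with hF
  have hcont : Continuous F := Continuous.dotProduct continuous_const
    (continuous_coe_SL.matrix_mulVec continuous_const)
  have hsq : ∀ g ∈ stabV n, F g ^ 2 = 4 := by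
    intro g hg
    have h1 := stabV.mulVec_eps hn hg
    have h2 := SOQ.bilin hn (G_le_SOQ n (mem_stabV_iff.1 hg).1) (eps n) (eps n)
    rw [h1, mulVec_smul, J_eps hn, smul_neg, dotProduct_neg, dotProduct_neg, smul_dotProduct,
      dotProduct_smul, eps_dotProduct_eps, smul_eq_mul, smul_eq_mul] at h2
    simp only [hF]
    linarith
  have hpos := pos_of_mem_identityComponent hcont
    (fun g hg h0 => by have := hsq g hg; rw [h0] at this; norm_num at this)
    (by simp [hF, eps_dotProduct_eps]) hg
  have h2 : F g = 2 := by
    have := hsq g (H_le_stabV n hg)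
    nlinarith
  have h3 := stabV.mulVec_eps hn (H_le_stabV n hg)
  have h4 : eps n ⬝ᵥ (g.1 *ᵥ eps n) = 2 := h2
  rwa [h4, div_self (two_ne_zero), one_smul] at h3

/-- The hyperbolic cosine of the distance by which `g` moves the base point. -/
def coshDist (n : ℕ) (g : SpecialLinearGroup (Fin (n + 2)) ℝ) : ℝ :=
  (base n ⬝ᵥ (g.1 *ᵥ base n)) / 2

theorem continuous_coshDist : Continuous (coshDist n) :=
  (Continuous.dotProduct continuous_const
    (continuous_coe_SL.matrix_mulVec continuous_const)).div_const _

theorem coshDist_one (hn : 2 ≤ n) : coshDist n 1 = 1 := by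
  simp [coshDist, base_dotProduct_base hn]

theorem base_mem_V (hn : 2 ≤ n) : base n ∈ V n := (mem_V_iff _).2 (eps_dotProduct_base hn)

theorem base_dotProduct_mulVec (g : SpecialLinearGroup (Fin (n + 2)) ℝ) :
    base n ⬝ᵥ (g.1 *ᵥ base n) = 2 * coshDist n g := by
  rw [coshDist]; ring

/-- In `dotProduct_self_eq` the form contributes `-2`, the pairing with `eps` vanishes on `V`, and
the pairing with `base` is `2 * coshDist n g`. -/
theorem mulVec_base_dotProduct_self (hn : 2 ≤ n) {g : SpecialLinearGroup (Fin (n + 2)) ℝ}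
    (hg : g ∈ stabV n) :
    (g.1 *ᵥ base n) ⬝ᵥ (g.1 *ᵥ base n) = 4 * coshDist n g ^ 2 - 2 := by
  obtain ⟨hG, hV, -⟩ := mem_stabV_iff.1 hg
  rw [dotProduct_self_eq hn, SOQ.bilin hn (G_le_SOQ n hG), base_dotProduct_mulVec,
    (mem_V_iff _).1 (hV _ (base_mem_V hn)), J_base hn, dotProduct_neg, base_dotProduct_base hn]
  ring

theorem zero_le_dotProduct_self {ι : Type*} [Fintype ι] (x : ι → ℝ) : 0 ≤ x ⬝ᵥ x :=
  Finset.sum_nonneg fun i _ => mul_self_nonneg (x i)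

theorem dotProduct_sq_le {ι : Type*} [Fintype ι] (x y : ι → ℝ) :
    (x ⬝ᵥ y) ^ 2 ≤ (x ⬝ᵥ x) * (y ⬝ᵥ y) := by
  have := Finset.sum_mul_sq_le_sq_mul_sq Finset.univ x y
  simpa only [dotProduct, sq] using this

/-- A zero would make a squared length equal to `-2`, so the identity component stays on the
positive sheet. Cauchy-Schwarz then gives `coshDist ^ 2 ≥ 1`. -/
theorem one_le_coshDist (hn : 2 ≤ n) {g : SpecialLinearGroup (Fin (n + 2)) ℝ}
    (hg : g ∈ H n) : 1 ≤ coshDist n g := by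
  have hpos := pos_of_mem_identityComponent continuous_coshDist
    (fun g hg h0 => by
      have h1 := mulVec_base_dotProduct_self hn hg
      have h2 := zero_le_dotProduct_self (g.1 *ᵥ base n)
      rw [h1, h0] at h2
      norm_num at h2)
    (by rw [coshDist_one hn]; norm_num) hg
  have h1 := dotProduct_sq_le (base n) (g.1 *ᵥ base n)
  rw [mulVec_base_dotProduct_self hn (H_le_stabV n hg), base_dotProduct_mulVec,
    base_dotProduct_base hn] at h1
  nlinarith

theorem coshDist_inv (hn : 2 ≤ n) {g : SpecialLinearGroup (Fin (n + 2)) ℝ}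
    (hg : g ∈ H n) : coshDist n g⁻¹ = coshDist n g := by
  unfold coshDist
  rw [base_dotProduct_eq hn, base_dotProduct_eq hn (g.1 *ᵥ base n),
    SOQ.bilin_inv hn (inv_mem (H_le_SOQ n hg)), inv_inv, dotProduct_comm, ← dotProduct_J_comm hn]

theorem coshDist_inv_mul (hn : 2 ≤ n) {g : SpecialLinearGroup (Fin (n + 2)) ℝ}
    (hg : g ∈ H n) (h : SpecialLinearGroup (Fin (n + 2)) ℝ) :
    2 * coshDist n (g⁻¹ * h) = -((g.1 *ᵥ base n) ⬝ᵥ (J n *ᵥ (h.1 *ᵥ base n))) := by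
  rw [← base_dotProduct_mulVec, base_dotProduct_eq hn, SL.mul_mulVec,
    SOQ.bilin_inv hn (inv_mem (H_le_SOQ n hg)), inv_inv]

/-- The triangle inequality in the lossy form `cosh (a + b) ≤ 2 cosh a cosh b`, obtained from
Cauchy-Schwarz without a distance function. The loss only affects constants, not exponents. -/
theorem coshDist_mul_le (hn : 2 ≤ n) {g h : SpecialLinearGroup (Fin (n + 2)) ℝ}
    (hg : g ∈ H n) (hh : h ∈ H n) :
    coshDist n (g * h) ≤ 2 * (coshDist n g * coshDist n h) := by
  have h1 := coshDist_inv_mul hn (inv_mem hg) h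
  rw [inv_inv] at h1
  have h2 := dotProduct_sq_le ((g⁻¹).1 *ᵥ base n) (J n *ᵥ (h.1 *ᵥ base n))
  rw [J_dotProduct_J hn, mulVec_base_dotProduct_self hn (H_le_stabV n hh),
    mulVec_base_dotProduct_self hn (H_le_stabV n (inv_mem hg)), coshDist_inv hn hg] at h2
  have hg1 := one_le_coshDist hn hg
  have hh1 := one_le_coshDist hn hh
  have h3 : (2 * coshDist n (g * h)) ^ 2 ≤ (4 * (coshDist n g * coshDist n h)) ^ 2 := by
    rw [h1, neg_sq]
    refine h2.trans ?_
    nlinarith [sq_nonneg (coshDist n g), sq_nonneg (coshDist n h)]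
  linarith [(abs_le.1 (abs_le_of_sq_le_sq h3 (by positivity))).2]

/-- Displacement of the base point bounds the operator norm, which makes the sublevel sets of
`coshDist` compact. -/
theorem mulVec_dotProduct_self_le (hn : 2 ≤ n) {g : SpecialLinearGroup (Fin (n + 2)) ℝ}
    (hg : g ∈ H n) (x : Fin (n + 2) → ℝ) :
    (g.1 *ᵥ x) ⬝ᵥ (g.1 *ᵥ x) ≤ (4 * coshDist n g ^ 2) * (x ⬝ᵥ x) := by
  have h1 := dotProduct_self_eq hn (g.1 *ᵥ x)
  rw [SOQ.bilin hn (H_le_SOQ n hg), eps_dotProduct_mulVec hn (H_le_SOQ n hg) (H.mulVec_eps hn hg)]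
    at h1
  have h2 := dotProduct_self_eq hn x
  have h3 : (base n ⬝ᵥ (g.1 *ᵥ x)) ^ 2 ≤ (4 * coshDist n g ^ 2 - 2) * (x ⬝ᵥ x) := by
    rw [base_dotProduct_eq hn, SOQ.bilin_inv hn (H_le_SOQ n hg), neg_sq]
    refine (dotProduct_sq_le _ _).trans ?_
    rw [J_dotProduct_J hn, mulVec_base_dotProduct_self hn (H_le_stabV n (inv_mem hg)),
      coshDist_inv hn hg]
  have h4 := zero_le_dotProduct_self x
  nlinarith [sq_nonneg (base n ⬝ᵥ x)]

theorem H.isClosedEmbedding_coe (hn : 2 ≤ n) :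
    Topology.IsClosedEmbedding (fun h : H n => h.1.1) :=
  (SpecialLinearGroup.isClosedEmbedding_val).comp (isClosed_H hn).isClosedEmbedding_subtypeVal

theorem isCompact_coshDist_le (hn : 2 ≤ n) (R : ℝ) :
    IsCompact {h : H n | coshDist n h.1 ≤ R} := by
  have hK : IsCompact {M : Matrix (Fin (n + 2)) (Fin (n + 2)) ℝ |
      ∀ i j, M i j ∈ Set.Icc (-(2 * R)) (2 * R)} := by
    have := isCompact_univ_pi (fun _ : Fin (n + 2) => isCompact_univ_pi
      (fun _ : Fin (n + 2) => isCompact_Icc (a := -(2 * R)) (b := 2 * R)))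
    convert! this using 1
    ext M
    exact ⟨fun h i _ j _ => h i j, fun h i j => h i trivial j trivial⟩
  refine ((H.isClosedEmbedding_coe hn).isCompact_preimage hK).of_isClosed_subset
    (isClosed_le (continuous_coshDist.comp continuous_subtype_val) continuous_const) ?_
  intro h hh i j
  have h1 := mulVec_dotProduct_self_le hn h.2 (Pi.single j 1)
  have h2 : (h.1.1 i j) ^ 2 ≤ (h.1.1 *ᵥ Pi.single j 1) ⬝ᵥ (h.1.1 *ᵥ Pi.single j 1) := by
    have := Finset.single_le_sum (f := fun i => (h.1.1 *ᵥ Pi.single j 1) i ^ 2)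
      (fun i _ => sq_nonneg _) (Finset.mem_univ i)
    simpa [dotProduct, sq, Matrix.col] using this
  have h3 : (Pi.single j 1 : Fin (n + 2) → ℝ) ⬝ᵥ Pi.single j 1 = 1 := by simp
  have h4 := one_le_coshDist hn h.2
  have h5 : coshDist n h.1 ≤ R := hh
  rw [h3] at h1
  exact abs_le.1 (abs_le_of_sq_le_sq (by nlinarith) (by linarith))

theorem H.locallyCompactSpace (hn : 2 ≤ n) : LocallyCompactSpace (H n) := by
  have : LocallyCompactSpace (Matrix (Fin (n + 2)) (Fin (n + 2)) ℝ) :=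
    inferInstanceAs (LocallyCompactSpace (Fin (n + 2) → Fin (n + 2) → ℝ))
  exact (H.isClosedEmbedding_coe hn).locallyCompactSpace

theorem H.secondCountableTopology (hn : 2 ≤ n) : SecondCountableTopology (H n) := by
  have : SecondCountableTopology (Matrix (Fin (n + 2)) (Fin (n + 2)) ℝ) :=
    inferInstanceAs (SecondCountableTopology (Fin (n + 2) → Fin (n + 2) → ℝ))
  exact (H.isClosedEmbedding_coe hn).isEmbedding.secondCountableTopology

/-! ### Rotations as products of two reflections -/

theorem cos_sin_dotProduct_self {ι : Type*} [Fintype ι] {u v : ι → ℝ} (hu : u ⬝ᵥ u = 2) (hv : v ⬝ᵥ v = 2) (huv : u ⬝ᵥ v = 0) (s : ℝ) :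
    (Real.cos s • u + Real.sin s • v) ⬝ᵥ (Real.cos s • u + Real.sin s • v) = 2 := by
  simp only [add_dotProduct, dotProduct_add, smul_dotProduct, dotProduct_smul, hu, hv, huv,
    dotProduct_comm v u, smul_eq_mul]
  nlinarith [Real.sin_sq_add_cos_sq s]

section Reflections

variable {ι : Type*} [DecidableEq ι]

/-- The Euclidean reflection in the hyperplane orthogonal to a vector `m` with `m ⬝ᵥ m = 2`. -/
def refl (m : ι → ℝ) : Matrix ι ι ℝ := 1 - vecMulVec m m

theorem refl_transpose (m : ι → ℝ) : (refl m)ᵀ = refl m := by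
  rw [refl, transpose_sub, transpose_one, transpose_vecMulVec]

variable [Fintype ι]

theorem refl_mulVec (m x : ι → ℝ) : refl m *ᵥ x = x - (m ⬝ᵥ x) • m := by
  rw [refl, sub_mulVec, one_mulVec, vecMulVec_mulVec]
  simp

theorem refl_mul_self {m : ι → ℝ} (hm : m ⬝ᵥ m = 2) : refl m * refl m = 1 := by
  apply Matrix.ext_of_mulVec_single
  intro i
  rw [← mulVec_mulVec, one_mulVec, refl_mulVec, refl_mulVec, dotProduct_sub, dotProduct_smul, hm,
    smul_eq_mul, sub_sub, ← add_smul]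
  rw [show ∀ a : ℝ, a + (a - a * 2) = 0 from fun a => by ring, zero_smul, sub_zero]

theorem refl_commute {m : ι → ℝ} {A : Matrix ι ι ℝ} (hA : Aᵀ = A) {s : ℝ} (hm : A *ᵥ m = s • m) :
    A * refl m = refl m * A := by
  rw [refl, mul_sub, sub_mul, mul_one, one_mul, mul_vecMulVec, vecMulVec_mul, ← mulVec_transpose,
    hA, hm, smul_vecMulVec, vecMulVec_smul]

/-- The rotation by the angle `2 s` in the plane of two orthogonal vectors `u` and `v` of square
length `2`. -/
def rot (u v : ι → ℝ) (s : ℝ) : Matrix ι ι ℝ := refl (Real.cos s • u + Real.sin s • v) * refl u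

variable {u v : ι → ℝ}

theorem continuous_rot : Continuous (rot u v) := by
  unfold rot refl
  have h : Continuous fun s : ℝ => Real.cos s • u + Real.sin s • v := by fun_prop
  exact (continuous_const.sub (h.matrix_vecMulVec h)).mul continuous_const

theorem rot_zero (hu : u ⬝ᵥ u = 2) : rot u v 0 = 1 := by
  rw [rot, Real.cos_zero, Real.sin_zero, one_smul, zero_smul, add_zero, refl_mul_self hu]

/-- Both reflection vectors lie in one eigenspace of `A`, so both reflections commute with `A`. It
is applied with `A = J` and with `A = 1`. -/
theorem rot_transpose_mul_mul (hu : u ⬝ᵥ u = 2) (hv : v ⬝ᵥ v = 2) (huv : u ⬝ᵥ v = 0)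
    {A : Matrix ι ι ℝ} (hA : Aᵀ = A) {c : ℝ} (hAu : A *ᵥ u = c • u) (hAv : A *ᵥ v = c • v)
    (s : ℝ) : (rot u v s)ᵀ * A * rot u v s = A := by
  set m := Real.cos s • u + Real.sin s • v with hm
  have hAm : A *ᵥ m = c • m := by
    rw [hm, mulVec_add, mulVec_smul, mulVec_smul, hAu, hAv, smul_add, smul_comm c, smul_comm c]
  have h1 := refl_mul_self (cos_sin_dotProduct_self hu hv huv s)
  have h2 := refl_mul_self hu
  rw [rot, transpose_mul, refl_transpose, refl_transpose, ← hm]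
  rw [← hm] at h1
  calc refl u * refl m * A * (refl m * refl u) = refl u * (refl m * (A * refl m)) * refl u := by
        simp only [Matrix.mul_assoc]
    _ = refl u * A * refl u := by
        rw [refl_commute hA hAm, Matrix.mul_assoc (refl u),
          ← Matrix.mul_assoc (refl m), h1, Matrix.one_mul, Matrix.mul_assoc]
    _ = A := by rw [Matrix.mul_assoc, refl_commute hA hAu, ← Matrix.mul_assoc, h2, Matrix.one_mul]

theorem rot_mulVec_left (hu : u ⬝ᵥ u = 2) (huv : u ⬝ᵥ v = 0) (s : ℝ) :
    rot u v s *ᵥ u = Real.cos (2 * s) • u + Real.sin (2 * s) • v := by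
  rw [rot, ← mulVec_mulVec, refl_mulVec, refl_mulVec, hu, dotProduct_sub, dotProduct_smul,
    add_dotProduct, smul_dotProduct, smul_dotProduct, hu, dotProduct_comm v u, huv, Real.cos_two_mul,
    Real.sin_two_mul]
  simp only [smul_eq_mul]
  module

theorem rot_mulVec_right (hv : v ⬝ᵥ v = 2) (huv : u ⬝ᵥ v = 0) (s : ℝ) :
    rot u v s *ᵥ v = Real.cos (2 * s) • v - Real.sin (2 * s) • u := by
  rw [rot, ← mulVec_mulVec, refl_mulVec, refl_mulVec, huv, zero_smul, sub_zero,
    add_dotProduct, smul_dotProduct, smul_dotProduct, hv, huv, Real.cos_two_mul', Real.cos_sq',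
    Real.sin_two_mul]
  simp only [smul_eq_mul]
  module

theorem rot_mulVec_of_orthogonal {x : ι → ℝ} (hu : u ⬝ᵥ x = 0) (hv : v ⬝ᵥ x = 0) (s : ℝ) :
    rot u v s *ᵥ x = x := by
  rw [rot, ← mulVec_mulVec, refl_mulVec, refl_mulVec, hu, zero_smul, sub_zero,
    add_dotProduct, smul_dotProduct, smul_dotProduct, hu, hv]
  simp

end Reflections

/-! ### The positive vectors complementary to `eps` and `base` -/

/-- The vector `e₁ + eₙ₊₂`. -/
def epsPos (n : ℕ) : Fin (n + 2) → ℝ := Pi.single 0 1 + Pi.single (Fin.last (n + 1)) 1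

/-- The vector `e₂ + eₙ₊₁`. -/
def basePos (n : ℕ) : Fin (n + 2) → ℝ := Pi.single 1 1 + Pi.single ⟨n, by omega⟩ 1

theorem epsPos_dotProduct (x : Fin (n + 2) → ℝ) :
    epsPos n ⬝ᵥ x = x 0 + x (Fin.last (n + 1)) := by
  simp [epsPos, add_dotProduct]

theorem basePos_dotProduct (x : Fin (n + 2) → ℝ) :
    basePos n ⬝ᵥ x = x 1 + x ⟨n, by omega⟩ := by
  simp [basePos, add_dotProduct]

theorem J_epsPos (hn : 2 ≤ n) : J n *ᵥ epsPos n = epsPos n := by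
  rw [epsPos, mulVec_add, J_single hn, J_single hn, dual_zero, dual_last hn]
  exact add_comm _ _

theorem J_basePos (hn : 2 ≤ n) : J n *ᵥ basePos n = basePos n := by
  rw [basePos, mulVec_add, J_single hn, J_single hn, dual_one, dual_n hn]
  exact add_comm _ _

theorem epsPos_dotProduct_epsPos (n : ℕ) : epsPos n ⬝ᵥ epsPos n = 2 := by
  rw [epsPos_dotProduct]
  simp [epsPos, Fin.ext_iff]
  norm_num

theorem basePos_dotProduct_basePos (hn : 2 ≤ n) : basePos n ⬝ᵥ basePos n = 2 := by
  have h : n ≠ 1 := by omega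
  rw [basePos_dotProduct]
  simp [basePos, Fin.ext_iff, h, h.symm]
  norm_num

theorem basePos_dotProduct_epsPos (hn : 2 ≤ n) : basePos n ⬝ᵥ epsPos n = 0 := by
  have h : n ≠ 0 := by omega
  rw [basePos_dotProduct]
  simp [epsPos, Fin.ext_iff, h]

/-- The `±1`-eigenspaces of `J` are orthogonal. -/
theorem dotProduct_eq_zero_of_J (hn : 2 ≤ n) {x y : Fin (n + 2) → ℝ} (hx : J n *ᵥ x = -x)
    (hy : J n *ᵥ y = y) : x ⬝ᵥ y = 0 := by
  have := dotProduct_J_comm hn x y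
  rw [hx, hy, neg_dotProduct] at this
  linarith

theorem J_eq_self_of_orthogonal (hn : 2 ≤ n) {x : Fin (n + 2) → ℝ} (h1 : eps n ⬝ᵥ x = 0)
    (h2 : base n ⬝ᵥ x = 0) : J n *ᵥ x = x := by
  have := sub_J hn x
  rw [h1, h2, zero_smul, zero_smul, add_zero, sub_eq_zero] at this
  exact this.symm

/-! ### The maximal compact subgroup -/

theorem K_mul_mem {g h : SpecialLinearGroup (Fin (n + 2)) ℝ} (hg : g ∈ K n) (hh : h ∈ K n) :
    g * h ∈ K n := by
  refine ⟨mul_mem hg.1 hh.1, ?_⟩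
  have e : (g * h).1 = g.1 * h.1 := rfl
  rw [e, transpose_mul, Matrix.mul_assoc, ← Matrix.mul_assoc h.1, hh.2, Matrix.one_mul, hg.2]

theorem K_inv_eq {g : SpecialLinearGroup (Fin (n + 2)) ℝ} (hg : g ∈ K n) : (g⁻¹).1 = g.1ᵀ := by
  have h := congrArg (fun M => (g⁻¹).1 * M) hg.2
  simp only [← Matrix.mul_assoc, SL.coe_inv_mul, Matrix.one_mul, Matrix.mul_one] at h
  exact h.symm

theorem K_inv_mem {g : SpecialLinearGroup (Fin (n + 2)) ℝ} (hg : g ∈ K n) : g⁻¹ ∈ K n := by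
  refine ⟨inv_mem hg.1, ?_⟩
  rw [K_inv_eq hg, transpose_transpose, mul_eq_one_comm, hg.2]

/-- All three terms on the right of `dotProduct_self_eq` are invariant under such an `l`, so `l` is
orthogonal. -/
theorem mem_K_of_base {l : SpecialLinearGroup (Fin (n + 2)) ℝ} (hn : 2 ≤ n) (hl : l ∈ H n)
    (hb : l.1 *ᵥ base n = base n) : l ∈ K n := by
  refine ⟨H_le_G n hl, ?_⟩
  rw [mul_eq_one_comm]
  refine eq_of_quadratic_eq (by rw [transpose_mul, transpose_transpose]) transpose_one fun x => ?_
  have h1 := dotProduct_mulVec_mulVec l.1 1 x x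
  rw [Matrix.mul_one, one_mulVec] at h1
  rw [← h1, one_mulVec, dotProduct_self_eq hn x, dotProduct_self_eq hn,
    SOQ.bilin hn (H_le_SOQ n hl), eps_dotProduct_mulVec hn (H_le_SOQ n hl) (H.mulVec_eps hn hl)]
  have h2 : base n ⬝ᵥ (l.1 *ᵥ x) = base n ⬝ᵥ x := by
    rw [base_dotProduct_eq hn, SOQ.bilin_inv hn (H_le_SOQ n hl), base_dotProduct_eq hn]
    conv_lhs => rw [← hb, SL.inv_mulVec_mulVec]
  rw [h2]

/-! ### The geodesic flow in `H` -/

theorem aVec_dual (hn : 2 ≤ n) (v : ℝ × ℝ) (i : Fin (n + 2)) :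
    aVec n v (dual n i) = -aVec n v i := by
  have h1 : n ≠ 0 := by omega
  have h2 : n ≠ 1 := by omega
  rcases index_cases i with rfl | rfl | rfl | rfl | h
  · simp [dual_zero, aVec, h1]
  · simp [dual_last hn, aVec, h1]
  · simp [dual_one, aVec, h1, h2]
  · simp [dual_n hn, aVec, h1, h2]
  · rw [dual_mid h]
    simp [aVec, show i.val ≠ 0 by omega, show i.val ≠ 1 by omega, show i.val ≠ n by omega,
      show i.val ≠ n + 1 by omega]

/-- The matrix `exp v`. -/
def expMat (n : ℕ) (v : ℝ × ℝ) : Matrix (Fin (n + 2)) (Fin (n + 2)) ℝ :=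
  diagonal fun i => Real.exp (aVec n v i)

theorem expMat_mulVec (v : ℝ × ℝ) (x : Fin (n + 2) → ℝ) (i : Fin (n + 2)) :
    (expMat n v *ᵥ x) i = Real.exp (aVec n v i) * x i := by
  rw [expMat, mulVec_diagonal]

theorem expMat_mul_J (hn : 2 ≤ n) (v : ℝ × ℝ) :
    (expMat n v)ᵀ * J n * expMat n v = J n := by
  apply Matrix.ext_of_mulVec_single
  intro i
  ext j
  rw [← mulVec_mulVec, ← mulVec_mulVec]
  rw [show (expMat n v)ᵀ = expMat n v from diagonal_transpose _, expMat_mulVec, J_mulVec,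
    expMat_mulVec, J_mulVec, aVec_dual hn, ← mul_assoc, ← Real.exp_add, add_neg_cancel,
    Real.exp_zero, one_mul]

theorem aVec_add (v w : ℝ × ℝ) (i : Fin (n + 2)) :
    aVec n (v + w) i = aVec n v i + aVec n w i := by
  unfold aVec
  split_ifs <;> simp <;> ring

theorem expMat_add (v w : ℝ × ℝ) : expMat n (v + w) = expMat n v * expMat n w := by
  simp only [expMat, diagonal_mul_diagonal, ← Real.exp_add, aVec_add]

theorem expMat_zero : expMat n 0 = 1 := by
  have : ∀ i, aVec n 0 i = 0 := fun i => by simp [aVec]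
  simp only [expMat, this, Real.exp_zero, diagonal_one]

theorem continuous_expMat : Continuous (expMat n) := by
  refine Continuous.matrix_diagonal (continuous_pi fun i => Real.continuous_exp.comp ?_)
  unfold aVec
  split_ifs <;> fun_prop

theorem det_expMat (hn : 2 ≤ n) (v : ℝ × ℝ) : (expMat n v).det = 1 :=
  det_eq_one_of_path hn continuous_expMat (expMat_mul_J hn) expMat_zero v

/-- The one-parameter subgroup of diagonal matrices in `H`. -/
def flow (hn : 2 ≤ n) (t : ℝ) : SpecialLinearGroup (Fin (n + 2)) ℝ :=
  ⟨expMat n (0, t), det_expMat hn _⟩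

theorem flow_mem_H (hn : 2 ≤ n) (t : ℝ) : flow hn t ∈ H n := by
  have hc : Continuous fun s : ℝ => expMat n (0, s) := continuous_expMat.comp (by fun_prop)
  refine mem_H_of_path hn hc (fun s => expMat_mul_J hn _) (x₀ := 0) expMat_zero (fun s => ?_) t rfl
  have h1 : n ≠ 0 := by omega
  ext i
  rw [expMat_mulVec]
  rcases index_cases i with rfl | rfl | rfl | rfl | h
  · simp [aVec]
  · simp [aVec, h1]
  · simp [eps, Fin.ext_iff, h1]
  · simp [eps, Fin.ext_iff, h1]
  · simp [eps, Fin.ext_iff, show i.val ≠ 0 by omega, show i.val ≠ n + 1 by omega]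

theorem flow_mul (hn : 2 ≤ n) (s t : ℝ) : flow hn s * flow hn t = flow hn (s + t) := by
  apply Subtype.ext
  have : ((0 : ℝ), s + t) = (0, s) + (0, t) := by simp
  change expMat n (0, s) * expMat n (0, t) = expMat n (0, s + t)
  rw [this, expMat_add]

theorem flow_zero (hn : 2 ≤ n) : flow hn 0 = 1 := Subtype.ext expMat_zero

theorem flow_inv (hn : 2 ≤ n) (t : ℝ) : (flow hn t)⁻¹ = flow hn (-t) := by
  rw [inv_eq_iff_mul_eq_one, flow_mul, add_neg_cancel, flow_zero]

theorem flow_pow (hn : 2 ≤ n) (t : ℝ) (k : ℕ) : flow hn t ^ k = flow hn (k * t) := by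
  induction k with
  | zero => simp [flow_zero]
  | succ k ih => rw [pow_succ, ih, flow_mul]; push_cast; ring_nf

theorem expMat_mulVec_single (v : ℝ × ℝ) (i : Fin (n + 2)) :
    expMat n v *ᵥ Pi.single i 1 = Real.exp (aVec n v i) • Pi.single i 1 := by
  ext j
  rw [expMat_mulVec]
  rcases eq_or_ne j i with rfl | h
  · simp
  · simp [h]

theorem flow_mulVec_base' (hn : 2 ≤ n) (t : ℝ) : (flow hn t).1 *ᵥ base n =
    Real.exp t • Pi.single 1 1 - Real.exp (-t) • Pi.single ⟨n, by omega⟩ 1 := by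
  have h1 : n ≠ 0 := by omega
  have h2 : n ≠ 1 := by omega
  change expMat n (0, t) *ᵥ base n = _
  rw [base, mulVec_sub, expMat_mulVec_single, expMat_mulVec_single]
  simp [aVec, h1, h2]

theorem flow_mulVec_base (hn : 2 ≤ n) (t : ℝ) :
    (flow hn t).1 *ᵥ base n = Real.cosh t • base n + Real.sinh t • basePos n := by
  rw [flow_mulVec_base', base, basePos, Real.cosh_eq, Real.sinh_eq]
  module

theorem base_dotProduct_basePos (hn : 2 ≤ n) : base n ⬝ᵥ basePos n = 0 :=
  dotProduct_eq_zero_of_J hn (J_base hn) (J_basePos hn)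

theorem coshDist_flow (hn : 2 ≤ n) (t : ℝ) : coshDist n (flow hn t) = Real.cosh t := by
  rw [coshDist, flow_mulVec_base, dotProduct_add, dotProduct_smul, dotProduct_smul,
    base_dotProduct_base hn, base_dotProduct_basePos hn]
  simp

/-! ### The Cartan decomposition of `H` -/

/-- The rotations in planes of positive vectors act transitively on directions. -/
theorem exists_rotation (hn : 2 ≤ n) {u : Fin (n + 2) → ℝ} (hJ : J n *ᵥ u = u)
    (hu : u ⬝ᵥ u = 2) : ∃ k ∈ H n, k.1 *ᵥ base n = base n ∧ k.1 *ᵥ basePos n = u := by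
  set c := (basePos n ⬝ᵥ u) / 2 with hc
  set w := u - c • basePos n with hw
  have hJw : J n *ᵥ w = w := by rw [hw, mulVec_sub, mulVec_smul, hJ, J_basePos hn]
  have hbw : basePos n ⬝ᵥ w = 0 := by
    rw [hw, dotProduct_sub, dotProduct_smul, basePos_dotProduct_basePos hn, smul_eq_mul]
    linarith
  have hww : w ⬝ᵥ w = 2 - 2 * c ^ 2 := by
    have : w ⬝ᵥ w = u ⬝ᵥ w := by
      conv_lhs => rw [hw, sub_dotProduct, smul_dotProduct, hbw, smul_zero, sub_zero]
    rw [this, hw, dotProduct_sub, hu, dotProduct_smul, dotProduct_comm, smul_eq_mul]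
    rw [show basePos n ⬝ᵥ u = 2 * c by rw [hc]; ring]
    ring
  have hc1 : c ^ 2 ≤ 1 := by
    have := zero_le_dotProduct_self w
    linarith
  have hcabs := abs_le.1 (abs_le_one_iff_mul_self_le_one.2 (by nlinarith : c * c ≤ 1))
  set s := √(1 - c ^ 2) with hs
  have hs2 : s ^ 2 = 1 - c ^ 2 := Real.sq_sqrt (by linarith)
  obtain ⟨v, hJv, hvv, hbv, hv⟩ : ∃ v, J n *ᵥ v = v ∧ v ⬝ᵥ v = 2 ∧ basePos n ⬝ᵥ v = 0 ∧
      u = c • basePos n + s • v := by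
    -- If `u` is `± basePos`, any orthogonal positive vector spans a rotation plane with it;
    -- `epsPos` is available already for `n = 2`.
    by_cases hs0 : s = 0
    · have hw0 : w = 0 := by
        rw [hs0] at hs2
        apply dotProduct_self_eq_zero.1
        rw [hww]; linarith
      refine ⟨epsPos n, J_epsPos hn, epsPos_dotProduct_epsPos n, basePos_dotProduct_epsPos hn, ?_⟩
      rw [hs0, zero_smul, add_zero]
      exact sub_eq_zero.1 hw0
    · refine ⟨s⁻¹ • w, ?_, ?_, ?_, ?_⟩
      · rw [mulVec_smul, hJw]
      · rw [smul_dotProduct, dotProduct_smul, hww, smul_eq_mul, smul_eq_mul]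
        field_simp
        linarith
      · rw [dotProduct_smul, hbw, smul_zero]
      · rw [smul_smul, mul_inv_cancel₀ hs0, one_smul, hw]
        abel
  have hbb := basePos_dotProduct_basePos hn
  have hJb : J n *ᵥ basePos n = (1 : ℝ) • basePos n := by rw [one_smul, J_basePos hn]
  have hJv' : J n *ᵥ v = (1 : ℝ) • v := by rw [one_smul, hJv]
  have hR := rot_transpose_mul_mul hbb hvv hbv (J_transpose hn) hJb hJv'
  have hfix : ∀ x, J n *ᵥ x = -x → ∀ r, rot (basePos n) v r *ᵥ x = x := fun x hx r => by
    apply rot_mulVec_of_orthogonal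
    · rw [dotProduct_comm]; exact dotProduct_eq_zero_of_J hn hx (J_basePos hn)
    · rw [dotProduct_comm]; exact dotProduct_eq_zero_of_J hn hx hJv
  -- The angle is halved because `rot` turns by twice its parameter.
  let k : SpecialLinearGroup (Fin (n + 2)) ℝ := ⟨rot (basePos n) v (Real.arccos c / 2),
    det_eq_one_of_path hn continuous_rot hR (rot_zero hbb) _⟩
  refine ⟨k, mem_H_of_path hn continuous_rot hR (rot_zero hbb) (hfix _ (J_eps hn)) _ rfl,
    hfix _ (J_base hn) _, ?_⟩
  have := rot_mulVec_left hbb hbv (Real.arccos c / 2)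
  rw [mul_div_cancel₀ _ (two_ne_zero), Real.cos_arccos hcabs.1 hcabs.2, Real.sin_arccos,
    ← hs, ← hv] at this
  exact this

/-- The image of `base` is `cosh t • base + q` with `q` positive and orthogonal to `base` and `eps`,
of squared length `2 * sinh t ^ 2`. A rotation `k` fixing `base` turns `basePos` to the direction of
`q`; then `k * flow t` and `h` agree on `base`, and they differ by an element of `K`. -/
theorem exists_flow_decomposition (hn : 2 ≤ n) {h : SpecialLinearGroup (Fin (n + 2)) ℝ}
    (hh : h ∈ H n) : ∃ k ∈ K n, ∃ l ∈ K n, h = k * flow hn (Real.arcosh (coshDist n h)) * l := by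
  set f := coshDist n h with hf
  have hf1 : 1 ≤ f := one_le_coshDist hn hh
  set t := Real.arcosh f with ht
  have hcosh : Real.cosh t = f := Real.cosh_arcosh hf1
  have hsinh : Real.sinh t ^ 2 = f ^ 2 - 1 := by
    have := Real.cosh_sq t
    rw [hcosh] at this; linarith
  set p := h.1 *ᵥ base n with hp
  set q := p - f • base n with hq
  have hpV : eps n ⬝ᵥ p = 0 := by
    rw [hp, eps_dotProduct_mulVec hn (H_le_SOQ n hh) (H.mulVec_eps hn hh), eps_dotProduct_base hn]
  have hbp : base n ⬝ᵥ p = 2 * f := base_dotProduct_mulVec h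
  have hbq : base n ⬝ᵥ q = 0 := by
    rw [hq, dotProduct_sub, hbp, dotProduct_smul, base_dotProduct_base hn, smul_eq_mul]; ring
  have hJq : J n *ᵥ q = q := by
    refine J_eq_self_of_orthogonal hn ?_ hbq
    rw [hq, dotProduct_sub, hpV, dotProduct_smul, eps_dotProduct_base hn]; simp
  have hqq : q ⬝ᵥ q = 2 * Real.sinh t ^ 2 := by
    have h1 : q ⬝ᵥ q = p ⬝ᵥ q := by
      conv_lhs => rw [hq, sub_dotProduct, smul_dotProduct, hbq, smul_zero, sub_zero]
    have h2 := mulVec_base_dotProduct_self hn (H_le_stabV n hh)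
    rw [← hp, ← hf] at h2
    rw [h1, hq, dotProduct_sub, h2, dotProduct_smul, dotProduct_comm, hbp, smul_eq_mul, hsinh]
    ring
  obtain ⟨k, hk, hkb, hkq⟩ : ∃ k ∈ H n, k.1 *ᵥ base n = base n ∧
      Real.sinh t • (k.1 *ᵥ basePos n) = q := by
    by_cases h0 : Real.sinh t = 0
    · refine ⟨1, one_mem _, by simp, ?_⟩
      rw [h0, zero_smul]
      rw [h0] at hqq
      exact (dotProduct_self_eq_zero.1 (by rw [hqq]; ring)).symm
    · obtain ⟨k, hk, hkb, hku⟩ := exists_rotation hn (u := (Real.sinh t)⁻¹ • q)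
        (by rw [mulVec_smul, hJq])
        (by rw [smul_dotProduct, dotProduct_smul, hqq, smul_eq_mul, smul_eq_mul]; field_simp)
      refine ⟨k, hk, hkb, ?_⟩
      rw [hku, smul_smul, mul_inv_cancel₀ h0, one_smul]
  have hkt : (k * flow hn t).1 *ᵥ base n = p := by
    rw [SL.mul_mulVec, flow_mulVec_base, mulVec_add, mulVec_smul, mulVec_smul, hkb, hkq, hcosh, hq]
    abel
  refine ⟨k, mem_K_of_base hn hk hkb, (k * flow hn t)⁻¹ * h, ?_, by group⟩
  refine mem_K_of_base hn (mul_mem (inv_mem (mul_mem hk (flow_mem_H hn t))) hh) ?_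
  rw [SL.mul_mulVec, ← hp, ← hkt, SL.inv_mulVec_mulVec]

/-! ### The Cartan projection on `H` -/

theorem single_zero_eq : (Pi.single 0 1 : Fin (n + 2) → ℝ) = (2 : ℝ)⁻¹ • (epsPos n + eps n) := by
  rw [epsPos, eps]; module

theorem single_last_eq : (Pi.single (Fin.last (n + 1)) 1 : Fin (n + 2) → ℝ)
    = (2 : ℝ)⁻¹ • (epsPos n - eps n) := by
  rw [epsPos, eps]; module

theorem single_one_eq : (Pi.single 1 1 : Fin (n + 2) → ℝ) = (2 : ℝ)⁻¹ • (basePos n + base n) := by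
  rw [basePos, base]; module

theorem single_n_eq : (Pi.single ⟨n, by omega⟩ 1 : Fin (n + 2) → ℝ)
    = (2 : ℝ)⁻¹ • (basePos n - base n) := by
  rw [basePos, base]; module

/-- An element of `K` that represents the exchange of the two coordinates of `𝔞`. -/
theorem exists_weyl (hn : 2 ≤ n) : ∃ w ∈ K n, ∀ t : ℝ,
    expMat n (0, t) = (w⁻¹).1 * expMat n (t, 0) * w.1 := by
  have hbb := basePos_dotProduct_basePos hn
  have hee := epsPos_dotProduct_epsPos n
  have hbe := basePos_dotProduct_epsPos hn
  have hbb' := base_dotProduct_base hn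
  have hee' := eps_dotProduct_eps n
  have hbe' : base n ⬝ᵥ eps n = 0 := by rw [dotProduct_comm, eps_dotProduct_base hn]
  have hneg : ∀ x : Fin (n + 2) → ℝ, (-1 : ℝ) • x = -x := neg_one_smul ℝ
  -- A quarter turn in a positive plane, combined with a quarter turn in the negative plane. Running
  -- both with one parameter gives a path from `1` in `G`. The result moves `eps`, so it is not in
  -- `H`.
  set A := rot (basePos n) (epsPos n) with hA
  set B := rot (base n) (eps n) with hB
  have hAJ := rot_transpose_mul_mul hbb hee hbe (J_transpose hn) (c := 1)
    (by rw [one_smul, J_basePos hn]) (by rw [one_smul, J_epsPos hn])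
  have hBJ := rot_transpose_mul_mul hbb' hee' hbe' (J_transpose hn) (c := -1)
    (by rw [J_base hn, hneg]) (by rw [J_eps hn, hneg])
  have hA1 := rot_transpose_mul_mul hbb hee hbe transpose_one (c := 1) (by simp) (by simp)
  have hB1 := rot_transpose_mul_mul hbb' hee' hbe' transpose_one (c := 1) (by simp) (by simp)
  have hmul : ∀ (M : Matrix (Fin (n + 2)) (Fin (n + 2)) ℝ), (∀ s, (A s)ᵀ * M * A s = M) →
      (∀ s, (B s)ᵀ * M * B s = M) → ∀ s, (A s * B s)ᵀ * M * (A s * B s) = M := by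
    intro M h1 h2 s
    calc (A s * B s)ᵀ * M * (A s * B s) = (B s)ᵀ * ((A s)ᵀ * M * A s) * B s := by
          rw [transpose_mul]; simp only [Matrix.mul_assoc]
      _ = M := by rw [h1, h2]
  have hJ := hmul _ hAJ hBJ
  have h1 := hmul _ hA1 hB1
  have hc : Continuous fun s => A s * B s := continuous_rot.mul continuous_rot
  have h0 : A 0 * B 0 = 1 := by rw [hA, hB, rot_zero hbb, rot_zero hbb', Matrix.one_mul]
  obtain ⟨w, hw⟩ : ∃ w : SpecialLinearGroup (Fin (n + 2)) ℝ,
      w.1 = A (Real.pi / 4) * B (Real.pi / 4) := ⟨⟨_, det_eq_one_of_path hn hc hJ h0 _⟩, rfl⟩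
  have hwv : ∀ x, w.1 *ᵥ x = A (Real.pi / 4) *ᵥ (B (Real.pi / 4) *ᵥ x) := fun x => by
    rw [mulVec_mulVec, hw]
  have hfixA : ∀ x, J n *ᵥ x = -x → ∀ s, A s *ᵥ x = x := fun x hx s => by
    apply rot_mulVec_of_orthogonal
    · rw [dotProduct_comm]; exact dotProduct_eq_zero_of_J hn hx (J_basePos hn)
    · rw [dotProduct_comm]; exact dotProduct_eq_zero_of_J hn hx (J_epsPos hn)
  have hfixB : ∀ x, J n *ᵥ x = x → ∀ s, B s *ᵥ x = x := fun x hx s => by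
    apply rot_mulVec_of_orthogonal
    · exact dotProduct_eq_zero_of_J hn (J_base hn) hx
    · exact dotProduct_eq_zero_of_J hn (J_eps hn) hx
  have hangle : 2 * (Real.pi / 4) = Real.pi / 2 := by ring
  have w1 : w.1 *ᵥ basePos n = epsPos n := by
    rw [hwv, hfixB _ (J_basePos hn), hA, rot_mulVec_left hbb hbe, hangle]; simp
  have w2 : w.1 *ᵥ epsPos n = -basePos n := by
    rw [hwv, hfixB _ (J_epsPos hn), hA, rot_mulVec_right hee hbe, hangle]; simp
  have w3 : w.1 *ᵥ base n = eps n := by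
    rw [hwv, hB, rot_mulVec_left hbb' hbe', hangle, Real.cos_pi_div_two, Real.sin_pi_div_two,
      zero_smul, one_smul, zero_add, hfixA _ (J_eps hn)]
  have w4 : w.1 *ᵥ eps n = -base n := by
    rw [hwv, hB, rot_mulVec_right hee' hbe', hangle, Real.cos_pi_div_two, Real.sin_pi_div_two,
      zero_smul, one_smul, zero_sub, mulVec_neg, hfixA _ (J_base hn)]
  refine ⟨w, ⟨mem_G_of_path hn hc hJ h0 (Real.pi / 4) hw, ?_⟩, fun t => ?_⟩
  · rw [mul_eq_one_comm]
    have := h1 (Real.pi / 4)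
    rwa [← hw, Matrix.mul_one] at this
  · have key : w.1 * expMat n (0, t) = expMat n (t, 0) * w.1 := by
      have n0 : n ≠ 0 := by omega
      have n1 : n ≠ 1 := by omega
      apply Matrix.ext_of_mulVec_single
      intro i
      rw [← mulVec_mulVec, ← mulVec_mulVec, expMat_mulVec_single, mulVec_smul]
      rcases index_cases i with rfl | rfl | rfl | rfl | h
      · have : w.1 *ᵥ Pi.single 0 1 = -Pi.single 1 1 := by
          rw [single_zero_eq, single_one_eq, mulVec_smul, mulVec_add, w2, w4]; module
        rw [this, mulVec_neg, expMat_mulVec_single]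
        simp [aVec]
      · have : w.1 *ᵥ Pi.single (Fin.last (n + 1)) 1 = -Pi.single ⟨n, by omega⟩ 1 := by
          rw [single_last_eq, single_n_eq, mulVec_smul, mulVec_sub, w2, w4]; module
        rw [this, mulVec_neg, expMat_mulVec_single]
        simp [aVec, n0, n1]
      · have : w.1 *ᵥ Pi.single 1 1 = Pi.single 0 1 := by
          rw [single_zero_eq, single_one_eq, mulVec_smul, mulVec_add, w1, w3]
        rw [this, expMat_mulVec_single]
        simp [aVec]
      · have : w.1 *ᵥ Pi.single ⟨n, by omega⟩ 1 = Pi.single (Fin.last (n + 1)) 1 := by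
          rw [single_last_eq, single_n_eq, mulVec_smul, mulVec_sub, w1, w3]
        rw [this, expMat_mulVec_single]
        simp [aVec, n0, n1]
      · have hJi : J n *ᵥ (Pi.single i 1) = Pi.single i 1 := by rw [J_single hn, dual_mid h]
        have : w.1 *ᵥ Pi.single i 1 = Pi.single i 1 := by
          rw [hwv, hfixB _ hJi, hA, rot_mulVec_of_orthogonal]
          · simp [basePos, Fin.ext_iff, show i.val ≠ 1 by omega, show i.val ≠ n by omega]
          · simp [epsPos, Fin.ext_iff, show i.val ≠ 0 by omega, show i.val ≠ n + 1 by omega]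
        rw [this, expMat_mulVec_single]
        simp [aVec, show i.val ≠ 0 by omega, show i.val ≠ 1 by omega, show i.val ≠ n by omega,
          show i.val ≠ n + 1 by omega]
    rw [Matrix.mul_assoc, ← key, ← Matrix.mul_assoc, SL.coe_inv_mul, Matrix.one_mul]

theorem trace_expMat (hn : 2 ≤ n) (v : ℝ × ℝ) : (expMat n v).trace =
    2 * Real.cosh v.1 + 2 * Real.cosh v.2
      + ∑ i : Fin (n + 2) with 2 ≤ i.val ∧ i.val < n, (1 : ℝ) := by
  have n0 : n ≠ 0 := by omega
  have n1 : n ≠ 1 := by omega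
  rw [expMat, trace_diagonal, sum_split hn]
  have : ∑ i : Fin (n + 2) with 2 ≤ i.val ∧ i.val < n, Real.exp (aVec n v i)
      = ∑ i : Fin (n + 2) with 2 ≤ i.val ∧ i.val < n, (1 : ℝ) := by
    refine Finset.sum_congr rfl fun i hi => ?_
    simp only [Finset.mem_filter] at hi
    simp [aVec, show i.val ≠ 0 by omega, show i.val ≠ 1 by omega, show i.val ≠ n by omega,
      show i.val ≠ n + 1 by omega]
  rw [this, Real.cosh_eq, Real.cosh_eq]
  simp [aVec, n0, n1]
  ring

/-- The matrix `g gᵀ` is conjugate to `exp (2 v)` by the left factor from `K`. The traces of it and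
of its square are the invariants used for uniqueness. -/
theorem IsCartanProj.trace_eq {g : SpecialLinearGroup (Fin (n + 2)) ℝ} {v : ℝ × ℝ}
    (h : IsCartanProj n g v) : (g.1 * g.1ᵀ).trace = (expMat n (v + v)).trace ∧
      (g.1 * g.1ᵀ * (g.1 * g.1ᵀ)).trace = (expMat n ((v + v) + (v + v))).trace := by
  obtain ⟨-, k, hk, l, hl, hg⟩ := h
  have hk' : k.1ᵀ * k.1 = 1 := by rw [mul_eq_one_comm, hk.2]
  have e : g.1 * g.1ᵀ = k.1 * expMat n (v + v) * k.1ᵀ := by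
    have hT : (expMat n v)ᵀ = expMat n v := diagonal_transpose _
    have hg' : g.1 = k.1 * expMat n v * l.1 := hg
    rw [expMat_add, hg', transpose_mul, transpose_mul, hT]
    calc k.1 * expMat n v * l.1 * (l.1ᵀ * (expMat n v * k.1ᵀ))
        = k.1 * expMat n v * (l.1 * l.1ᵀ) * (expMat n v * k.1ᵀ) := by
          simp only [Matrix.mul_assoc]
      _ = k.1 * (expMat n v * expMat n v) * k.1ᵀ := by
          rw [hl.2, Matrix.mul_one]; simp only [Matrix.mul_assoc]
  have tr : ∀ M, (k.1 * M * k.1ᵀ).trace = M.trace := fun M => by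
    rw [trace_mul_comm, ← Matrix.mul_assoc, hk', Matrix.one_mul]
  refine ⟨by rw [e, tr], ?_⟩
  rw [e, expMat_add (v + v) (v + v), ← tr (expMat n (v + v) * expMat n (v + v))]
  congr 1
  calc k.1 * expMat n (v + v) * k.1ᵀ * (k.1 * expMat n (v + v) * k.1ᵀ)
      = k.1 * expMat n (v + v) * (k.1ᵀ * k.1) * (expMat n (v + v) * k.1ᵀ) := by
        simp only [Matrix.mul_assoc]
    _ = _ := by rw [hk', Matrix.mul_one]; simp only [Matrix.mul_assoc]

/-- With `a`, `b`, `c` the hyperbolic cosines of `2 v₁`, `2 v₂`, `2 t`, the traces give `a + b = c +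
1` and `a² + b² = c² + 1`, hence `(a - 1)(b - 1) = 0`. In the chamber `b ≤ a`, so `b = 1` and `v₂ =
0`. Uniqueness is needed only for this wall. -/
theorem IsCartanProj.eq_of_snd_eq_zero (hn : 2 ≤ n) {g : SpecialLinearGroup (Fin (n + 2)) ℝ}
    {v : ℝ × ℝ} (hv : IsCartanProj n g v) {t : ℝ} (ht : IsCartanProj n g (t, 0)) :
    v = (t, 0) := by
  have h1 := hv.trace_eq.1.symm.trans ht.trace_eq.1
  have h2 := hv.trace_eq.2.symm.trans ht.trace_eq.2
  rw [trace_expMat hn, trace_expMat hn] at h1 h2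
  simp only [Prod.fst_add, Prod.snd_add, add_zero, Real.cosh_zero] at h1 h2
  simp only [← two_mul] at h1 h2
  have hd : ∀ x, Real.cosh (2 * x) = 2 * Real.cosh x ^ 2 - 1 := fun x => by
    have := Real.cosh_two_mul x
    have := Real.cosh_sq x
    linarith
  rw [hd (2 * v.1), hd (2 * v.2), hd (2 * t)] at h2
  have hle : |v.2| ≤ v.1 := hv.1.1
  have h3 : Real.cosh (2 * v.2) ≤ Real.cosh (2 * v.1) := by
    rw [Real.cosh_le_cosh, abs_mul, abs_mul, abs_of_nonneg ((abs_nonneg _).trans hle)]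
    gcongr
  have h4 := Real.one_le_cosh (2 * v.2)
  have h5 : (Real.cosh (2 * v.1) - 1) * (Real.cosh (2 * v.2) - 1) = 0 := by nlinarith
  have h6 : Real.cosh (2 * v.2) = 1 := by
    rcases mul_eq_zero.1 h5 with h | h <;> linarith
  have h7 : v.2 = 0 := by
    by_contra h
    exact absurd h6 (Real.one_lt_cosh.2 (by simpa using h)).ne'
  have h8 : |2 * v.1| = |2 * t| := by
    rw [← Real.cosh_abs, ← Real.cosh_abs (2 * t), h6] at h1
    have : Real.cosh |2 * v.1| = Real.cosh |2 * t| := by linarith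
    exact Real.cosh_strictMonoOn.injOn (Set.mem_Ici.2 (abs_nonneg _))
      (Set.mem_Ici.2 (abs_nonneg _)) this
  have ht0 : |(0 : ℝ)| ≤ t := ht.1.1
  rw [abs_zero] at ht0
  rw [abs_of_nonneg (by linarith [abs_nonneg v.2]), abs_of_nonneg (by linarith)] at h8
  exact Prod.ext (by simpa using h8) h7

/-- The decomposition inside `H` yields `(0, t)`, which for `t > 0` lies outside the chamber; the
Weyl element is absorbed into the two factors from `K`. -/
theorem isCartanProj_of_mem_H (hn : 2 ≤ n) {h : SpecialLinearGroup (Fin (n + 2)) ℝ}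
    (hh : h ∈ H n) : IsCartanProj n h (Real.arcosh (coshDist n h), 0) := by
  have ht := Real.arcosh_nonneg (one_le_coshDist hn hh)
  refine ⟨⟨by simpa using ht, fun _ => le_rfl⟩, ?_⟩
  obtain ⟨k, hk, l, hl, e⟩ := exists_flow_decomposition hn hh
  obtain ⟨w, hw, hwt⟩ := exists_weyl hn
  refine ⟨k * w⁻¹, K_mul_mem hk (K_inv_mem hw), w * l, K_mul_mem hw hl, ?_⟩
  have e' : h.1 = k.1 * expMat n (0, Real.arcosh (coshDist n h)) * l.1 := congrArg Subtype.val e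
  rw [hwt] at e'
  rw [e']
  change _ = k.1 * (w⁻¹).1 * expMat n (Real.arcosh (coshDist n h), 0) * (w.1 * l.1)
  simp only [Matrix.mul_assoc]

theorem cartanProj_of_mem_H (hn : 2 ≤ n) {h : SpecialLinearGroup (Fin (n + 2)) ℝ}
    (hh : h ∈ H n) : cartanProj n h = (Real.arcosh (coshDist n h), 0) := by
  have h1 := isCartanProj_of_mem_H hn hh
  exact (Classical.epsilon_spec (p := IsCartanProj n h) ⟨_, h1⟩).eq_of_snd_eq_zero hn h1

theorem cartanProj_image_H (hn : 2 ≤ n) :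
    cartanProj n '' (H n : Set (SpecialLinearGroup (Fin (n + 2)) ℝ))
      = {v | 0 ≤ v.1 ∧ v.2 = 0} := by
  ext v
  constructor
  · rintro ⟨h, hh, rfl⟩
    rw [cartanProj_of_mem_H hn hh]
    exact ⟨Real.arcosh_nonneg (one_le_coshDist hn hh), rfl⟩
  · rintro ⟨h1, h2⟩
    refine ⟨flow hn v.1, flow_mem_H hn _, ?_⟩
    rw [cartanProj_of_mem_H hn (flow_mem_H hn _), coshDist_flow, Real.arcosh_cosh h1]
    exact Prod.ext rfl h2.symm

/-! ### The horospherical subgroup -/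

/-- The indices of the free coordinates of the vectors of `V` with `x₂ = xₙ₊₁ = 0`. -/
abbrev HoroIndex (n : ℕ) : Type := {j : Fin (n + 2) // j.val ≠ 1 ∧ j.val < n}

/-- The dimension of the horospherical group, and the source of the exponent `n - 1` in both
counting bounds. -/
theorem card_horoIndex (hn : 2 ≤ n) : Fintype.card (HoroIndex n) = n - 1 := by
  rw [Fintype.card_subtype]
  have : (Finset.univ.filter fun j : Fin (n + 2) => j.val ≠ 1 ∧ j.val < n)
      = (((Finset.range n).erase 1).attachFin fun m hm => by
          have := Finset.mem_range.1 (Finset.mem_of_mem_erase hm); omega) := by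
    ext j
    simp
  rw [this, Finset.card_attachFin, Finset.card_erase_of_mem (by simp; omega), Finset.card_range]

/-- The vector of `V` with `x₂ = xₙ₊₁ = 0` and the given free coordinates. -/
def horoVec (hn : 2 ≤ n) (z : HoroIndex n → ℝ) : Fin (n + 2) → ℝ := fun i =>
  if h : i.val ≠ 1 ∧ i.val < n then z ⟨i, h⟩
  else if i.val = n + 1 then z ⟨0, by simp, by simp; omega⟩ else 0

theorem horoVec_apply (hn : 2 ≤ n) (z : HoroIndex n → ℝ) (j : HoroIndex n) :
    horoVec hn z j.1 = z j := by
  simp [horoVec, j.2.1, j.2.2]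

theorem horoVec_one (hn : 2 ≤ n) (z : HoroIndex n → ℝ) : horoVec hn z 1 = 0 := by
  have : n ≠ 0 := by omega
  simp [horoVec, this]

theorem horoVec_n (hn : 2 ≤ n) (z : HoroIndex n → ℝ) : horoVec hn z ⟨n, by omega⟩ = 0 := by
  simp [horoVec]

theorem horoVec_last (hn : 2 ≤ n) (z : HoroIndex n → ℝ) :
    horoVec hn z (Fin.last (n + 1)) = horoVec hn z 0 := by
  have : 0 < n := by omega
  simp [horoVec, this]

theorem horoVec_add (hn : 2 ≤ n) (z z' : HoroIndex n → ℝ) :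
    horoVec hn (z + z') = horoVec hn z + horoVec hn z' := by
  ext i
  simp only [horoVec, Pi.add_apply]
  split_ifs <;> simp

theorem horoVec_zero (hn : 2 ≤ n) : horoVec hn 0 = 0 := by
  ext i
  simp [horoVec]

theorem continuous_horoVec (hn : 2 ≤ n) : Continuous (horoVec hn) := by
  refine continuous_pi fun i => ?_
  unfold horoVec
  split_ifs <;> fun_prop

theorem J_horoVec (hn : 2 ≤ n) (z : HoroIndex n → ℝ) : J n *ᵥ horoVec hn z = horoVec hn z := by
  apply J_eq_self_of_orthogonal hn
  · rw [eps_dotProduct, horoVec_last, sub_self]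
  · rw [base_dotProduct, horoVec_one, horoVec_n, sub_self]

theorem sq_le_horoVec_dotProduct_self (hn : 2 ≤ n) (z : HoroIndex n → ℝ) (j : HoroIndex n) :
    z j ^ 2 ≤ horoVec hn z ⬝ᵥ horoVec hn z := by
  have := Finset.single_le_sum (f := fun i => horoVec hn z i * horoVec hn z i)
    (fun i _ => mul_self_nonneg _) (Finset.mem_univ j.1)
  rw [sq]
  simp only [horoVec_apply] at this
  exact this

theorem horoVec_dotProduct_self_le (hn : 2 ≤ n) {z : HoroIndex n → ℝ} {c : ℝ} (hc : 0 ≤ c)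
    (h : ∀ j, |z j| ≤ c) : horoVec hn z ⬝ᵥ horoVec hn z ≤ (n + 2) * c ^ 2 := by
  have h1 : ∀ i ∈ Finset.univ, horoVec hn z i * horoVec hn z i ≤ c ^ 2 := by
    intro i _
    rw [← sq, sq_le_sq, abs_of_nonneg hc]
    unfold horoVec
    split_ifs
    · exact h _
    · exact h _
    · simpa using hc
  have := Finset.sum_le_card_nsmul _ _ _ h1
  simpa [dotProduct] using this

/-- The unipotent matrix of `x ↦ x + xₙ₊₁ w - (w ⬝ x + (w ⬝ w) xₙ₊₁ / 2) e₂`. -/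
def unip (n : ℕ) (w : Fin (n + 2) → ℝ) : Matrix (Fin (n + 2)) (Fin (n + 2)) ℝ :=
  1 + vecMulVec w (Pi.single ⟨n, by omega⟩ 1)
    - vecMulVec (Pi.single 1 1) (w + ((w ⬝ᵥ w) / 2) • Pi.single ⟨n, by omega⟩ 1)

theorem unip_mulVec (w x : Fin (n + 2) → ℝ) : unip n w *ᵥ x =
    x + x ⟨n, by omega⟩ • w - (w ⬝ᵥ x + (w ⬝ᵥ w) / 2 * x ⟨n, by omega⟩) • Pi.single 1 1 := by
  rw [unip, sub_mulVec, add_mulVec, one_mulVec, vecMulVec_mulVec, vecMulVec_mulVec,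
    add_dotProduct, smul_dotProduct, single_dotProduct, op_smul_eq_smul,
    op_smul_eq_smul, one_mul, smul_eq_mul]

theorem continuous_unip : Continuous (unip n) := by
  unfold unip
  have h : Continuous fun w : Fin (n + 2) → ℝ => w ⬝ᵥ w := continuous_id.dotProduct continuous_id
  refine (continuous_const.add (continuous_id.matrix_vecMulVec continuous_const)).sub
    (continuous_const.matrix_vecMulVec (continuous_id.add ?_))
  exact (h.div_const 2).smul continuous_const

theorem unip_J (hn : 2 ≤ n) (z : HoroIndex n → ℝ) :
    (unip n (horoVec hn z))ᵀ * J n * unip n (horoVec hn z) = J n := by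
  refine eq_of_bilinear_eq fun x y => ?_
  set w := horoVec hn z with hw
  have n1 : (⟨n, by omega⟩ : Fin (n + 2)) ≠ 1 := by
    simp only [ne_eq, Fin.ext_iff, Fin.val_one]; omega
  have e1 : w ⬝ᵥ (J n *ᵥ y) = w ⬝ᵥ y := by rw [dotProduct_J_comm hn, J_horoVec]
  have e2 : J n *ᵥ (Pi.single 1 1) = Pi.single ⟨n, by omega⟩ 1 := by
    rw [J_single hn, dual_one]
  rw [← dotProduct_mulVec_mulVec, unip_mulVec, unip_mulVec, mulVec_sub, mulVec_add, mulVec_smul,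
    mulVec_smul, J_horoVec, e2, ← hw]
  have e3 : w ⟨n, by omega⟩ = 0 := horoVec_n hn z
  have e4 : w 1 = 0 := horoVec_one hn z
  have e5 : (J n *ᵥ y) 1 = y ⟨n, by omega⟩ := by rw [J_mulVec, dual_one]
  simp only [sub_dotProduct, add_dotProduct, dotProduct_sub, dotProduct_add, smul_dotProduct,
    dotProduct_smul, Pi.add_apply, Pi.sub_apply, Pi.smul_apply, e1, e3, e4, e5, single_dotProduct, dotProduct_single, smul_eq_mul, mul_zero,
    mul_one, one_mul, Pi.single_apply, n1, if_false]
  rw [dotProduct_comm x w]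
  ring

theorem unip_mul (hn : 2 ≤ n) (z z' : HoroIndex n → ℝ) :
    unip n (horoVec hn z) * unip n (horoVec hn z') = unip n (horoVec hn (z + z')) := by
  apply Matrix.ext_of_mulVec_single
  intro i
  set x : Fin (n + 2) → ℝ := Pi.single i 1
  have n1 : (⟨n, by omega⟩ : Fin (n + 2)) ≠ 1 := by
    simp only [ne_eq, Fin.ext_iff, Fin.val_one]; omega
  rw [horoVec_add]
  have e3 := horoVec_n hn z'
  have e4 := horoVec_one hn z
  set w := horoVec hn z
  set w' := horoVec hn z'
  rw [← mulVec_mulVec, unip_mulVec w' x, unip_mulVec w, unip_mulVec (w + w')]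
  simp only [dotProduct_sub, dotProduct_add, add_dotProduct, dotProduct_smul, Pi.add_apply,
    Pi.sub_apply, Pi.smul_apply, smul_eq_mul, e3, e4, dotProduct_single, Pi.single_apply, n1,
    if_false, mul_zero, zero_mul, sub_zero, add_zero, dotProduct_comm w' w]
  module

theorem unip_zero : unip n 0 = 1 := by
  simp [unip]

/-- The elements of the horospherical subgroup of `H`. -/
def horo (hn : 2 ≤ n) (z : HoroIndex n → ℝ) : SpecialLinearGroup (Fin (n + 2)) ℝ :=
  ⟨unip n (horoVec hn z), det_eq_one_of_path hn (continuous_unip.comp (continuous_horoVec hn))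
    (unip_J hn) (x₀ := 0) (by simp [horoVec_zero, unip_zero]) z⟩

theorem horo_mem_H (hn : 2 ≤ n) (z : HoroIndex n → ℝ) : horo hn z ∈ H n := by
  refine mem_H_of_path hn (continuous_unip.comp (continuous_horoVec hn))
    (unip_J hn) (x₀ := 0) (by simp [horoVec_zero, unip_zero]) (fun z => ?_) z rfl
  have n0 : n ≠ 0 := by omega
  have h1 : eps n ⟨n, by omega⟩ = 0 := by simp [eps, Fin.ext_iff, n0]
  have h2 : horoVec hn z ⬝ᵥ eps n = 0 := by
    rw [dotProduct_comm]
    exact dotProduct_eq_zero_of_J hn (J_eps hn) (J_horoVec hn z)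
  simp only [Function.comp_apply]
  rw [unip_mulVec, h1, h2]
  simp

theorem horo_mul (hn : 2 ≤ n) (z z' : HoroIndex n → ℝ) :
    horo hn z * horo hn z' = horo hn (z + z') := Subtype.ext (unip_mul hn z z')

theorem horo_zero (hn : 2 ≤ n) : horo hn 0 = 1 :=
  Subtype.ext (by simp only [horo, horoVec_zero, unip_zero]; rfl)

theorem horo_inv (hn : 2 ≤ n) (z : HoroIndex n → ℝ) : (horo hn z)⁻¹ = horo hn (-z) := by
  rw [inv_eq_iff_mul_eq_one, horo_mul, add_neg_cancel, horo_zero]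

/-- Conjugation by `flow t` stretches the horospherical parameter by `exp t`; this expansion makes
the return sets thin. -/
theorem coshDist_conj_horo (hn : 2 ≤ n) (z : HoroIndex n → ℝ) (t : ℝ) :
    coshDist n (flow hn t * horo hn z * flow hn (-t)) =
      1 + (horoVec hn z ⬝ᵥ horoVec hn z) / 4 * Real.exp t ^ 2 := by
  have n1 : (⟨n, by omega⟩ : Fin (n + 2)) ≠ 1 := by
    simp only [ne_eq, Fin.ext_iff, Fin.val_one]; omega
  have hsymm : ∀ y, base n ⬝ᵥ ((flow hn t).1 *ᵥ y) = ((flow hn t).1 *ᵥ base n) ⬝ᵥ y := fun y => by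
    have hT : (flow hn t).1ᵀ = (flow hn t).1 := diagonal_transpose _
    rw [dotProduct_mulVec, ← mulVec_transpose, hT]
  rw [coshDist, SL.mul_mulVec, SL.mul_mulVec, hsymm, flow_mulVec_base', flow_mulVec_base']
  have e3 := horoVec_n hn z
  have e4 := horoVec_one hn z
  have hE : ∀ y, (horo hn z).1 *ᵥ y = unip n (horoVec hn z) *ᵥ y := fun y => rfl
  rw [hE, unip_mulVec]
  set w := horoVec hn z
  have hexp : Real.exp t * Real.exp (-t) = 1 := by rw [← Real.exp_add]; simp
  simp only [neg_neg, sub_dotProduct, smul_dotProduct, dotProduct_sub, dotProduct_smul,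
    single_dotProduct, dotProduct_single, Pi.add_apply,
    Pi.sub_apply, Pi.smul_apply, smul_eq_mul, e3, e4, Pi.single_apply, n1,
    n1.symm, if_true, if_false, mul_zero, sub_zero, add_zero, mul_one, one_mul]
  linear_combination hexp

theorem coshDist_horo (hn : 2 ≤ n) (z : HoroIndex n → ℝ) :
    coshDist n (horo hn z) = 1 + (horoVec hn z ⬝ᵥ horoVec hn z) / 4 := by
  have := coshDist_conj_horo hn z 0
  simpa [flow_zero] using this

/-! ### Packing and the lower bound -/

section Packing

variable [MeasurableSpace (H n)] [BorelSpace (H n)]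

/-- The flow and the horospherical elements, as elements of `H`. -/
def flowH (hn : 2 ≤ n) (t : ℝ) : H n := ⟨flow hn t, flow_mem_H hn t⟩

/-- The horospherical elements, as elements of `H`. -/
def horoH (hn : 2 ≤ n) (z : HoroIndex n → ℝ) : H n := ⟨horo hn z, horo_mem_H hn z⟩

/-- Differences in `S` stay bounded after conjugation by the flow, so `S` has width `O(exp (-t))` in
every horospherical direction. About `exp t` horospherical translates per direction are then
disjoint and fit in one fixed ball, and left invariance gives them all the measure of `S`. -/
theorem packing (hn : 2 ≤ n) (m : Measure (H n)) [m.IsHaarMeasure] {t : ℝ}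
    (ht : 24 ≤ Real.exp t) {S : Set (H n)} (hS : MeasurableSet S)
    (h1 : ∀ x ∈ S, ∀ y ∈ S, coshDist n (x⁻¹ * y : H n) ≤ 8)
    (h2 : ∀ x ∈ S, ∀ y ∈ S, coshDist n (flowH hn t * (x⁻¹ * y) * flowH hn (-t) : H n) ≤ 8) :
    ENNReal.ofReal ((Real.exp t / 48) ^ (n - 1)) * m S ≤
      m {h : H n | coshDist n h.1 ≤ 16 * (1 + (n + 2) / 4)} := by
  rcases S.eq_empty_or_nonempty with rfl | ⟨x₀, hx₀⟩
  · simp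
  set M := ⌊Real.exp t / 24⌋₊ with hM
  have hM1 : (M : ℝ) ≤ Real.exp t / 24 := Nat.floor_le (by positivity)
  have hM2 : Real.exp t / 48 ≤ M := by
    have h3 : 1 ≤ M := Nat.le_floor (by rw [Nat.cast_one, le_div_iff₀] <;> linarith)
    have h4 : (1 : ℝ) ≤ M := by exact_mod_cast h3
    have := Nat.lt_floor_add_one (Real.exp t / 24)
    rw [← hM] at this
    linarith
  -- A grid in the unit cube. After expansion, distinct grid points give `coshDist` at least `1 + 24
  -- ^ 2 / 4 = 145`, more than the bound `2 * 8 * 8 = 128` for overlapping translates.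
  let z : (HoroIndex n → Fin M) → HoroIndex n → ℝ := fun p j => 24 * Real.exp (-t) * (p j).val
  let T : (HoroIndex n → Fin M) → Set (H n) := fun p =>
    (fun y => (x₀ * (horoH hn (z p))⁻¹) * y) ⁻¹' S
  have hTm : ∀ p, MeasurableSet (T p) := fun p => measurable_const_mul _ hS
  have hTS : ∀ p, m (T p) = m S := fun p => measure_preimage_mul m _ S
  have hexp : Real.exp t * Real.exp (-t) = 1 := by rw [← Real.exp_add]; simp
  have hdisj : Pairwise (Function.onFun Disjoint T) := by
    intro p q hpq
    rw [Function.onFun, Set.disjoint_left]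
    intro y hp hq
    obtain ⟨j, hj⟩ := Function.ne_iff.1 hpq
    set s : H n := (horoH hn (z p))⁻¹ * y with hs
    set s' : H n := (horoH hn (z q))⁻¹ * y with hs'
    have hp' : x₀ * s ∈ S := by simpa [T, hs, mul_assoc] using hp
    have hq' : x₀ * s' ∈ S := by simpa [T, hs', mul_assoc] using hq
    have a1 := h2 x₀ hx₀ _ hp'
    have a2 := h2 x₀ hx₀ _ hq'
    rw [inv_mul_cancel_left] at a1 a2
    have hfl : (flowH hn (-t))⁻¹ = flowH hn t := Subtype.ext (by
      change (flow hn (-t))⁻¹ = flow hn t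
      rw [flow_inv, neg_neg])
    have hfl' : (flowH hn t)⁻¹ = flowH hn (-t) := Subtype.ext (flow_inv hn t)
    have a3 := coshDist_mul_le hn (flowH hn t * s' * flowH hn (-t)).2
      (inv_mem (flowH hn t * s * flowH hn (-t)).2)
    rw [coshDist_inv hn (flowH hn t * s * flowH hn (-t)).2] at a3
    have e : (flowH hn t * s' * flowH hn (-t)) * (flowH hn t * s * flowH hn (-t))⁻¹ =
        flowH hn t * (s' * s⁻¹) * flowH hn (-t) := by
      rw [_root_.mul_inv_rev, _root_.mul_inv_rev, hfl, hfl']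
      rw [← hfl']; group
    have e2 : s' * s⁻¹ = horoH hn (z p - z q) := by
      apply Subtype.ext
      change (horo hn (z q))⁻¹ * y * ((horo hn (z p))⁻¹ * y)⁻¹ = horo hn (z p - z q)
      rw [_root_.mul_inv_rev, inv_inv, sub_eq_add_neg, add_comm (z p), ← horo_mul, ← horo_inv]
      group
    have a4 : coshDist n ((flowH hn t * s' * flowH hn (-t)) *
        (flowH hn t * s * flowH hn (-t))⁻¹ : H n).1 ≤ 128 := by
      refine a3.trans ?_
      have b1 := one_le_coshDist hn (flowH hn t * s * flowH hn (-t)).2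
      nlinarith
    rw [e, e2] at a4
    have a5 : 1 + (horoVec hn (z p - z q) ⬝ᵥ horoVec hn (z p - z q)) / 4 * Real.exp t ^ 2 ≤ 128 := by
      rw [← coshDist_conj_horo]; exact a4
    have a6 := sq_le_horoVec_dotProduct_self hn (z p - z q) j
    have a7 : (24 * Real.exp (-t)) ^ 2 ≤ (z p - z q) j ^ 2 := by
      have : (z p - z q) j ^ 2 =
          (24 * Real.exp (-t)) ^ 2 * (((p j).val : ℝ) - ((q j).val : ℝ)) ^ 2 := by
        simp only [z, Pi.sub_apply]; ring
      rw [this]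
      refine le_mul_of_one_le_right (sq_nonneg _) ?_
      have hne : ((p j).val : ℤ) - ((q j).val : ℤ) ≠ 0 := by
        intro h0
        exact hj (Fin.ext (by omega))
      have h1 : (1 : ℤ) ≤ (((p j).val : ℤ) - ((q j).val : ℤ)) ^ 2 := sq_pos_iff.2 hne
      exact_mod_cast h1
    have a8 : (24 * Real.exp (-t)) ^ 2 / 4 * Real.exp t ^ 2 = 144 := by
      have : (24 * Real.exp (-t)) ^ 2 / 4 * Real.exp t ^ 2
        = 144 * (Real.exp t * Real.exp (-t)) ^ 2 := by ring
      rw [this, hexp]; norm_num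
    have a9 : (24 * Real.exp (-t)) ^ 2 / 4 * Real.exp t ^ 2 ≤
        (horoVec hn (z p - z q) ⬝ᵥ horoVec hn (z p - z q)) / 4 * Real.exp t ^ 2 := by
      gcongr
      exact a7.trans a6
    linarith
  have hsub : ∀ p, T p ⊆ {h : H n | coshDist n h.1 ≤ 16 * (1 + (n + 2) / 4)} := by
    intro p y hy
    set s : H n := (horoH hn (z p))⁻¹ * y with hs
    have hp' : x₀ * s ∈ S := by simpa [T, hs, mul_assoc] using hy
    have a1 := h1 x₀ hx₀ _ hp'
    rw [inv_mul_cancel_left] at a1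
    have e : y = horoH hn (z p) * s := by rw [hs, mul_inv_cancel_left]
    have a2 := coshDist_mul_le hn (horoH hn (z p)).2 s.2
    have a3 : coshDist n (horoH hn (z p)).1 ≤ 1 + (n + 2) / 4 := by
      change coshDist n (horo hn (z p)) ≤ _
      rw [coshDist_horo]
      have := horoVec_dotProduct_self_le hn (z := z p) zero_le_one (fun j => by
        have hpj : ((p j).val : ℝ) ≤ M := by exact_mod_cast (p j).2.le
        rw [abs_of_nonneg (by positivity)]
        calc 24 * Real.exp (-t) * (p j).val ≤ 24 * Real.exp (-t) * (Real.exp t / 24) := by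
              gcongr; exact hpj.trans hM1
          _ = Real.exp t * Real.exp (-t) := by ring
          _ = 1 := hexp)
      linarith
    have b1 := one_le_coshDist hn s.2
    change coshDist n y.1 ≤ _
    rw [e]
    refine a2.trans ?_
    have : (0 : ℝ) ≤ n := by positivity
    nlinarith
  calc ENNReal.ofReal ((Real.exp t / 48) ^ (n - 1)) * m S
      ≤ ((M ^ (n - 1) : ℕ) : ℝ≥0∞) * m S := by
        gcongr
        rw [← ENNReal.ofReal_natCast]
        apply ENNReal.ofReal_le_ofReal
        push_cast
        gcongr
    _ = ∑ p : HoroIndex n → Fin M, m (T p) := by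
        simp only [hTS, Finset.sum_const, Finset.card_univ, Fintype.card_fun, card_horoIndex hn,
          Fintype.card_fin, nsmul_eq_mul]
    _ = m (⋃ p, T p) := by
        rw [measure_iUnion hdisj hTm, tsum_fintype]
    _ ≤ _ := measure_mono (Set.iUnion_subset hsub)

end Packing

theorem flowH_pow (hn : 2 ≤ n) (t : ℝ) (k : ℕ) : flowH hn t ^ k = flowH hn (k * t) :=
  Subtype.ext (flow_pow hn t k)

theorem flowH_inv (hn : 2 ≤ n) (t : ℝ) : (flowH hn t)⁻¹ = flowH hn (-t) :=
  Subtype.ext (flow_inv hn t)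

/-- The measure of the set of points near the identity that return, after time `t`, to a
neighbourhood of a given lattice point. -/
theorem measure_return_le [MeasurableSpace (H n)] [BorelSpace (H n)] (hn : 2 ≤ n)
    (m : Measure (H n)) [m.IsHaarMeasure] {t : ℝ} (ht : 24 ≤ Real.exp t) (γ : H n) :
    m {x : H n | coshDist n x.1 < 2 ∧ coshDist n (γ * x * flowH hn (-t) : H n).1 < 2} ≤
      m {h : H n | coshDist n h.1 ≤ 16 * (1 + (n + 2) / 4)} /
        ENNReal.ofReal ((Real.exp t / 48) ^ (n - 1)) := by
  have hcont : Continuous fun h : H n => coshDist n h.1 :=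
    continuous_coshDist.comp continuous_subtype_val
  have hopen : IsOpen {x : H n | coshDist n x.1 < 2 ∧
      coshDist n (γ * x * flowH hn (-t) : H n).1 < 2} := by
    refine (isOpen_lt hcont continuous_const).and (isOpen_lt ?_ continuous_const)
    exact hcont.comp ((continuous_const.mul continuous_id).mul continuous_const)
  have hdiff : ∀ x y : H n, coshDist n x.1 < 2 → coshDist n y.1 < 2 →
      coshDist n (x⁻¹ * y : H n).1 ≤ 8 := by
    intro x y hx hy
    have h1 := coshDist_mul_le hn (inv_mem x.2) y.2
    rw [coshDist_inv hn x.2] at h1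
    have h2 := one_le_coshDist hn x.2
    refine h1.trans ?_
    nlinarith
  have hpos : 0 < (Real.exp t / 48) ^ (n - 1) := by positivity
  rw [ENNReal.le_div_iff_mul_le (Or.inl (ENNReal.ofReal_pos.2 hpos).ne')
    (Or.inl ENNReal.ofReal_ne_top), mul_comm]
  refine packing hn m ht hopen.measurableSet (fun x hx y hy => hdiff x y hx.1 hy.1)
    (fun x hx y hy => ?_)
  have h := hdiff _ _ hx.2 hy.2
  -- The lattice element cancels, so the bound is uniform in `γ`.
  have e : (γ * x * flowH hn (-t))⁻¹ * (γ * y * flowH hn (-t)) =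
      flowH hn t * (x⁻¹ * y) * flowH hn (-t) := by
    rw [_root_.mul_inv_rev, _root_.mul_inv_rev, flowH_inv, neg_neg]
    group
  rwa [e] at h

/-- The number of points of a lattice in balls of large radius `t` is not bounded by
`C * exp (s * t)` with `s < n - 1`. -/
theorem lattice_count_unbounded (hn : 2 ≤ n) (Δ : Subgroup (H n)) (hΔ : IsLattice Δ) {C s : ℝ}
    (hs : s < n - 1) {k₀ : ℕ}
    (hcount : ∀ k : ℕ, k₀ ≤ k → (({γ : Δ | coshDist n (γ : H n) ≤ 16 * Real.exp k}.encard : ℕ∞) :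
      ℝ≥0∞) ≤ ENNReal.ofReal (C * Real.exp (s * k))) : False := by
  obtain ⟨hdisc, hmeas⟩ := hΔ
  let _ : MeasurableSpace (H n) := borel (H n)
  have : BorelSpace (H n) := ⟨rfl⟩
  obtain ⟨m, hm, F, hF, hfin⟩ := hmeas
  have := H.locallyCompactSpace hn
  have := H.secondCountableTopology hn
  have : Countable Δ := TopologicalSpace.separableSpace_iff_countable.1 inferInstance
  set U : Set (H n) := {h | coshDist n h.1 < 2} with hU
  have hcont : Continuous fun h : H n => coshDist n h.1 :=
    continuous_coshDist.comp continuous_subtype_val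
  have hUo : IsOpen U := isOpen_lt hcont continuous_const
  have hU0 : m U ≠ 0 := (hUo.measure_pos m ⟨1, by
    change coshDist n 1 < 2
    rw [coshDist_one hn]; norm_num⟩).ne'
  have hUfin : m U < ∞ := lt_of_le_of_lt (measure_mono fun h (hh : coshDist n h.1 < 2) => hh.le)
    (isCompact_coshDist_le hn 2).measure_lt_top
  set B := m {h : H n | coshDist n h.1 ≤ 16 * (1 + (n + 2) / 4)} with hB
  have hBfin : B < ∞ := (isCompact_coshDist_le hn _).measure_lt_top
  have hrec := tsum_measure_return_eq_top Δ m hF hfin (flowH hn (-1)) hUo.measurableSet hU0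
  set R : ℕ → Set (H n) :=
    fun k => {x | x ∈ U ∧ ∃ γ : Δ, (γ : H n) * x * flowH hn (-1) ^ k ∈ U} with hR
  have hpow : ∀ k : ℕ, flowH hn (-1) ^ k = flowH hn (-k) := fun k => by
    rw [flowH_pow, mul_neg_one]
  have hpiece : ∀ (k : ℕ) (γ : Δ), 24 ≤ Real.exp k →
      m {x | x ∈ U ∧ (γ : H n) * x * flowH hn (-1) ^ k ∈ U} ≤
        B / ENNReal.ofReal ((Real.exp k / 48) ^ (n - 1)) := by
    intro k γ hk
    rw [hpow]
    exact measure_return_le hn m hk γ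
  -- Two applications of `coshDist_mul_le`: `x * flow (-k)` has `coshDist` at most `2 * 2 * exp k`,
  -- and dividing the endpoint in `U` by it gives `2 * 2 * (4 * exp k)`.
  have hsub : ∀ k : ℕ, R k ⊆ ⋃ γ ∈ {γ : Δ | coshDist n (γ : H n) ≤ 16 * Real.exp k},
      {x | x ∈ U ∧ (γ : H n) * x * flowH hn (-1) ^ k ∈ U} := by
    rintro k x ⟨hx, γ, hγ⟩
    refine Set.mem_iUnion₂.2 ⟨γ, ?_, hx, hγ⟩
    set u := (γ : H n) * x * flowH hn (-1) ^ k with hu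
    have e : (γ : H n) = u * (x * flowH hn (-k))⁻¹ := by rw [hu, hpow]; group
    have h1 := coshDist_mul_le hn u.2 (inv_mem (x * flowH hn (-k)).2)
    rw [coshDist_inv hn (x * flowH hn (-k)).2] at h1
    have h2 := coshDist_mul_le hn x.2 (flowH hn (-k)).2
    have h3 : coshDist n (flowH hn (-k)).1 ≤ Real.exp k := by
      change coshDist n (flow hn (-k)) ≤ _
      rw [coshDist_flow, Real.cosh_neg, Real.cosh_eq]
      have : Real.exp (-k) ≤ Real.exp k := Real.exp_le_exp.2 (by
        have : (0 : ℝ) ≤ k := by positivity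
        linarith)
      linarith
    have h4 : coshDist n u.1 < 2 := hγ
    have h5 : coshDist n x.1 < 2 := hx
    have h6 := one_le_coshDist hn (flowH hn (-k)).2
    have h7 := one_le_coshDist hn (x * flowH hn (-k)).2
    have h8 := one_le_coshDist hn x.2
    have h9 := one_le_coshDist hn u.2
    change coshDist n (γ : H n).1 ≤ _
    rw [e]
    refine h1.trans ?_
    have h10 : coshDist n (x * flowH hn (-k) : H n).1 ≤ 4 * Real.exp k := by
      refine h2.trans ?_
      nlinarith
    nlinarith
  obtain ⟨k₁, hk₁⟩ : ∃ k₁ : ℕ, 24 ≤ Real.exp k₁ := by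
    obtain ⟨k, hk⟩ := exists_nat_ge (24 : ℝ)
    exact ⟨k, hk.trans (by linarith [Real.add_one_le_exp (k : ℝ)])⟩
  -- The product of the assumed count and the measure of one piece is a constant times `r ^ k`, a
  -- convergent geometric series.
  set r := Real.exp (s - (n - 1)) with hr
  have hr1 : r < 1 := by
    have := Real.exp_lt_exp.2 (by linarith : s - (n - 1) < 0)
    rwa [Real.exp_zero] at this
  have hbound : ∀ k : ℕ, max k₀ k₁ ≤ k →
      m (R k) ≤ ENNReal.ofReal (C * 48 ^ (n - 1) * r ^ k) * B := by
    intro k hk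
    have hk24 : 24 ≤ Real.exp k := hk₁.trans (Real.exp_le_exp.2 (by
      exact_mod_cast (le_max_right _ _).trans hk))
    set A := {γ : Δ | coshDist n (γ : H n) ≤ 16 * Real.exp k} with hA
    calc m (R k) ≤ m (⋃ γ ∈ A, {x | x ∈ U ∧ (γ : H n) * x * flowH hn (-1) ^ k ∈ U}) :=
          measure_mono (hsub k)
      _ ≤ ∑' γ : A, m {x | x ∈ U ∧ ((γ : Δ) : H n) * x * flowH hn (-1) ^ k ∈ U} :=
          measure_biUnion_le m (Set.to_countable A) _
      _ ≤ ∑' γ : A, B / ENNReal.ofReal ((Real.exp k / 48) ^ (n - 1)) :=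
          ENNReal.tsum_le_tsum fun γ => hpiece k γ hk24
      _ = (A.encard : ℝ≥0∞) * (B / ENNReal.ofReal ((Real.exp k / 48) ^ (n - 1))) :=
          ENNReal.tsum_set_const A _
      _ ≤ ENNReal.ofReal (C * Real.exp (s * k)) *
            (B / ENNReal.ofReal ((Real.exp k / 48) ^ (n - 1))) := by
          gcongr
          exact hcount k ((le_max_left _ _).trans hk)
      _ = ENNReal.ofReal (C * 48 ^ (n - 1) * r ^ k) * B := by
          rw [ENNReal.div_eq_inv_mul, ← ENNReal.ofReal_inv_of_pos (by positivity), ← mul_assoc,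
            ← ENNReal.ofReal_mul' (by positivity)]
          congr 2
          have e1 : r ^ k = Real.exp (s * k) * (Real.exp k ^ (n - 1))⁻¹ := by
            rw [hr, ← Real.exp_nat_mul, ← Real.exp_nat_mul, ← Real.exp_neg, ← Real.exp_add]
            congr 1
            rw [Nat.cast_sub (by omega)]
            push_cast
            ring
          rw [e1, div_pow]
          field_simp
  set k₂ := max k₀ k₁
  have hsumm : ∑' k, m (R (k + k₂)) ≠ ∞ := by
    refine ne_top_of_le_ne_top ?_ (ENNReal.tsum_le_tsum fun k => hbound (k + k₂) (by omega))
    rw [ENNReal.tsum_mul_right]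
    refine ENNReal.mul_ne_top ?_ hBfin.ne
    have hle : ∀ k : ℕ, ENNReal.ofReal (C * 48 ^ (n - 1) * r ^ (k + k₂)) ≤
        ENNReal.ofReal (|C| * 48 ^ (n - 1) * r ^ k) := fun k => by
      apply ENNReal.ofReal_le_ofReal
      have h1 : r ^ (k + k₂) ≤ r ^ k :=
        pow_le_pow_of_le_one (Real.exp_nonneg _) hr1.le (Nat.le_add_right k k₂)
      gcongr
      exact le_abs_self C
    refine ne_top_of_le_ne_top ?_ (ENNReal.tsum_le_tsum hle)
    have hsum : Summable fun k : ℕ => |C| * 48 ^ (n - 1) * r ^ k :=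
      (summable_geometric_of_lt_one (Real.exp_nonneg _) hr1).mul_left _
    exact hsum.tsum_ofReal_ne_top
  have : ∑' k, m (R k) ≠ ∞ := by
    -- The finitely many early terms, where the count or the packing bound is unavailable, are each
    -- at most `m U`.
    rw [← ENNReal.summable.sum_add_tsum_nat_add' (k := k₂)]
    refine ENNReal.add_ne_top.2 ⟨?_, hsumm⟩
    refine ENNReal.sum_ne_top.2 fun k _ => ?_
    exact (lt_of_le_of_lt (measure_mono fun x hx => hx.1) hUfin).ne
  exact this hrec

/-! ### Upper bound for the number of lattice points -/

theorem finite_coshDist_le (hn : 2 ≤ n) (Δ : Subgroup (H n)) [DiscreteTopology Δ] (R : ℝ) :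
    {γ : Δ | coshDist n (γ : H n) ≤ R}.Finite := by
  have hcl : IsClosed (Δ : Set (H n)) := Subgroup.isClosed_of_discrete
  exact isCompact_iff_finite.1
    (hcl.isClosedEmbedding_subtypeVal.isCompact_preimage (isCompact_coshDist_le hn R))

theorem eq_horo_coordinates (hn : 2 ≤ n) {p : Fin (n + 2) → ℝ} (hp : p ∈ V n) :
    p = p 1 • Pi.single 1 1 + p ⟨n, by omega⟩ • Pi.single ⟨n, by omega⟩ 1
      + horoVec hn fun j => p j.1 := by
  have n0 : n ≠ 0 := by omega
  have n1 : n ≠ 1 := by omega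
  have h0 : p 0 = p (Fin.last (n + 1)) := hp
  have hpos : 0 < n := by omega
  ext i
  rcases index_cases i with rfl | rfl | rfl | rfl | h
  · simp [horoVec, Fin.ext_iff, n0, hpos]
  · simp [horoVec, Fin.ext_iff, n0, h0]
  · simp [horoVec_one, Fin.ext_iff, n1.symm]
  · simp [horoVec_n, Fin.ext_iff, n1]
  · simp [horoVec, Fin.ext_iff, show i.val ≠ 1 by omega, show i.val ≠ n by omega, h.2]

theorem bilin_horo_coordinates (hn : 2 ≤ n) {p q : Fin (n + 2) → ℝ} (hp : p ∈ V n)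
    (hq : q ∈ V n) : p ⬝ᵥ (J n *ᵥ q) = p 1 * q ⟨n, by omega⟩ + p ⟨n, by omega⟩ * q 1
      + (horoVec hn fun j => p j.1) ⬝ᵥ (horoVec hn fun j => q j.1) := by
  have n1 : (⟨n, by omega⟩ : Fin (n + 2)) ≠ 1 := by
    simp only [ne_eq, Fin.ext_iff, Fin.val_one]; omega
  have gen : ∀ (a b a' b' : ℝ) (z z' : HoroIndex n → ℝ),
      (a • Pi.single 1 1 + b • Pi.single ⟨n, by omega⟩ 1 + horoVec hn z) ⬝ᵥ
        (J n *ᵥ (a' • Pi.single 1 1 + b' • Pi.single ⟨n, by omega⟩ 1 + horoVec hn z')) =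
      a * b' + b * a' + horoVec hn z ⬝ᵥ horoVec hn z' := by
    intro a b a' b' z z'
    rw [mulVec_add, mulVec_add, mulVec_smul, mulVec_smul, J_single hn, J_single hn,
      dual_one, dual_n hn, J_horoVec]
    simp only [add_dotProduct, dotProduct_add, smul_dotProduct, dotProduct_smul,
      single_dotProduct, dotProduct_single, Pi.add_apply, Pi.smul_apply, Pi.single_apply, horoVec_one, horoVec_n, n1, n1.symm,
      if_true, if_false, smul_eq_mul]
    ring
  conv_lhs => rw [eq_horo_coordinates hn hp, eq_horo_coordinates hn hq]
  exact gen _ _ _ _ _ _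

/-- The height of the upper half space model, at the orbit point of `g`. -/
def height (n : ℕ) (g : SpecialLinearGroup (Fin (n + 2)) ℝ) : ℝ :=
  -(g.1 *ᵥ base n) ⟨n, by omega⟩

/-- The horizontal coordinates of the upper half space model, at the orbit point of `g`. -/
def horizontal (n : ℕ) (g : SpecialLinearGroup (Fin (n + 2)) ℝ) (j : HoroIndex n) : ℝ :=
  (g.1 *ᵥ base n) j.1 / height n g

theorem mulVec_base_mem_V (hn : 2 ≤ n) {g : SpecialLinearGroup (Fin (n + 2)) ℝ} (hg : g ∈ H n) :
    g.1 *ᵥ base n ∈ V n := by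
  rw [mem_V_iff, eps_dotProduct_mulVec hn (H_le_SOQ n hg) (H.mulVec_eps hn hg),
    eps_dotProduct_base hn]

theorem horoVec_smul (hn : 2 ≤ n) (c : ℝ) (z : HoroIndex n → ℝ) :
    horoVec hn (fun j => c * z j) = c • horoVec hn z := by
  ext i
  simp only [horoVec, Pi.smul_apply, smul_eq_mul]
  split_ifs <;> simp

/-- The last identity is `Q = -2` on the orbit of `base`. It makes the product of the second
coordinate and `height` positive, and their sum is `2 * coshDist`, so both are positive. -/
theorem half_space_facts (hn : 2 ≤ n) {g : SpecialLinearGroup (Fin (n + 2)) ℝ} (hg : g ∈ H n) :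
    0 < height n g ∧ height n g < 2 * coshDist n g ∧
      (g.1 *ᵥ base n) 1 = 2 * coshDist n g - height n g ∧
      (g.1 *ᵥ base n) 1 * height n g = 1 + height n g ^ 2 *
        (horoVec hn (horizontal n g) ⬝ᵥ horoVec hn (horizontal n g)) / 2 := by
  set p := g.1 *ᵥ base n with hp
  set y := height n g with hy
  have hyp : p ⟨n, by omega⟩ = -y := by rw [hy, height, neg_neg]
  have h1 : p 1 = 2 * coshDist n g - y := by
    have := base_dotProduct_mulVec g
    rw [base_dotProduct, ← hp, hyp] at this
    linarith
  have hV := mulVec_base_mem_V hn hg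
  have h2 := bilin_horo_coordinates hn hV hV
  rw [SOQ.bilin hn (H_le_SOQ n hg), J_base hn, dotProduct_neg, base_dotProduct_base hn, ← hp,
    hyp] at h2
  have h3 := zero_le_dotProduct_self (horoVec hn fun j => p j.1)
  have h4 := one_le_coshDist hn hg
  have hpos : 0 < y := by nlinarith
  have h5 : (horoVec hn fun j => p j.1) = y • horoVec hn (horizontal n g) := by
    rw [← horoVec_smul]
    congr 1
    ext j
    rw [horizontal, ← hy, ← hp]
    field_simp
  rw [h5, smul_dotProduct, dotProduct_smul, smul_eq_mul, smul_eq_mul] at h2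
  have h6 := zero_le_dotProduct_self (horoVec hn (horizontal n g))
  have h7 : p 1 * y = 1 + y ^ 2 *
      (horoVec hn (horizontal n g) ⬝ᵥ horoVec hn (horizontal n g)) / 2 := by linarith
  refine ⟨hpos, ?_, h1, h7⟩
  have h8 : 0 < p 1 * y := by rw [h7]; positivity
  have h9 : 0 < p 1 := (mul_pos_iff_of_pos_right hpos).1 h8
  linarith

/-- The distance formula of the upper half space model. -/
theorem coshDist_inv_mul_eq (hn : 2 ≤ n) {g h : SpecialLinearGroup (Fin (n + 2)) ℝ} (hg : g ∈ H n)
    (hh : h ∈ H n) : 2 * coshDist n (g⁻¹ * h) =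
      height n g / height n h + height n h / height n g + height n g * height n h *
        (horoVec hn (horizontal n g - horizontal n h) ⬝ᵥ
          horoVec hn (horizontal n g - horizontal n h)) / 2 := by
  obtain ⟨hy, -, -, e1⟩ := half_space_facts hn hg
  obtain ⟨hy', -, -, e2⟩ := half_space_facts hn hh
  rw [coshDist_inv_mul hn hg, bilin_horo_coordinates hn (mulVec_base_mem_V hn hg)
    (mulVec_base_mem_V hn hh)]
  have hw : ∀ {g : SpecialLinearGroup (Fin (n + 2)) ℝ}, 0 < height n g →
      (horoVec hn fun j => (g.1 *ᵥ base n) j.1) = height n g • horoVec hn (horizontal n g) := by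
    intro g hg
    rw [← horoVec_smul]
    congr 1
    ext j
    rw [horizontal]
    field_simp
  rw [hw hy, hw hy']
  have hs : horoVec hn (horizontal n g - horizontal n h)
      = horoVec hn (horizontal n g) - horoVec hn (horizontal n h) := by
    rw [eq_sub_iff_add_eq, ← horoVec_add, sub_add_cancel]
  rw [hs]
  have f1 : (g.1 *ᵥ base n) ⟨n, by omega⟩ = -height n g := by rw [height, neg_neg]
  have f2 : (h.1 *ᵥ base n) ⟨n, by omega⟩ = -height n h := by rw [height, neg_neg]
  rw [f1, f2]
  set a := (g.1 *ᵥ base n) 1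
  set b := (h.1 *ᵥ base n) 1
  set y := height n g
  set y' := height n h
  set X := horoVec hn (horizontal n g)
  set X' := horoVec hn (horizontal n h)
  have ha : a = 1 / y + y * (X ⬝ᵥ X) / 2 := by field_simp; linarith
  have hb : b = 1 / y' + y' * (X' ⬝ᵥ X') / 2 := by field_simp; linarith
  simp only [smul_dotProduct, dotProduct_smul, sub_dotProduct, dotProduct_sub, smul_eq_mul,
    dotProduct_comm X' X]
  rw [ha, hb]
  field_simp
  ring

/-- The cell of the orbit point of `g` in a decomposition of the upper half space into cells of
bounded diameter. -/
def cell (n : ℕ) (g : SpecialLinearGroup (Fin (n + 2)) ℝ) : ℤ × (HoroIndex n → ℤ) :=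
  (⌊Real.log (height n g)⌋,
    fun j => ⌊horizontal n g j * Real.exp ⌊Real.log (height n g)⌋⌋)

theorem exp_floor_log {y : ℝ} (hy : 0 < y) :
    Real.exp ⌊Real.log y⌋ ≤ y ∧ y ≤ 3 * Real.exp ⌊Real.log y⌋ := by
  constructor
  · calc Real.exp ⌊Real.log y⌋ ≤ Real.exp (Real.log y) := Real.exp_le_exp.2 (Int.floor_le _)
      _ = y := Real.exp_log hy
  · calc y = Real.exp (Real.log y) := (Real.exp_log hy).symm
      _ ≤ Real.exp (1 + ⌊Real.log y⌋) := Real.exp_le_exp.2 (by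
          linarith [Int.lt_floor_add_one (Real.log y)])
      _ = Real.exp 1 * Real.exp ⌊Real.log y⌋ := Real.exp_add _ _
      _ ≤ 3 * Real.exp ⌊Real.log y⌋ := by
          gcongr
          linarith [Real.exp_one_lt_d9]

/-- In the distance formula `height` plays the part of the reciprocal of the usual vertical
coordinate. The horizontal mesh of a cell is therefore `1 / E`, and the last term of the formula
stays bounded. -/
theorem coshDist_le_of_cell_eq (hn : 2 ≤ n) {g h : SpecialLinearGroup (Fin (n + 2)) ℝ}
    (hg : g ∈ H n) (hh : h ∈ H n) (e : cell n g = cell n h) :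
    coshDist n (g⁻¹ * h) ≤ 3 + 9 * (n + 2) / 4 := by
  obtain ⟨hy, -, -, -⟩ := half_space_facts hn hg
  obtain ⟨hy', -, -, -⟩ := half_space_facts hn hh
  have e1 : ⌊Real.log (height n g)⌋ = ⌊Real.log (height n h)⌋ := congrArg Prod.fst e
  have e2 : ∀ j, ⌊horizontal n g j * Real.exp ⌊Real.log (height n g)⌋⌋ =
      ⌊horizontal n h j * Real.exp ⌊Real.log (height n g)⌋⌋ := fun j => by
    have := congrFun (congrArg Prod.snd e) j
    simp only [cell] at this
    rw [this, e1]
  obtain ⟨h1, h2⟩ := exp_floor_log hy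
  obtain ⟨h3, h4⟩ := exp_floor_log hy'
  rw [← e1] at h3 h4
  have key := coshDist_inv_mul_eq hn hg hh
  set E := Real.exp ⌊Real.log (height n g)⌋ with hE
  have hEpos : 0 < E := Real.exp_pos _
  set y := height n g
  set y' := height n h
  have h5 : y / y' ≤ 3 := by rw [div_le_iff₀ hy']; linarith
  have h6 : y' / y ≤ 3 := by rw [div_le_iff₀ hy]; linarith
  have h7 := horoVec_dotProduct_self_le hn (z := horizontal n g - horizontal n h) (c := 1 / E)
    (by positivity) (fun j => by
      have := Int.abs_sub_lt_one_of_floor_eq_floor (e2 j)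
      rw [← sub_mul, abs_mul, abs_of_pos hEpos] at this
      rw [le_div_iff₀ hEpos, Pi.sub_apply]
      exact this.le)
  set D := horoVec hn (horizontal n g - horizontal n h) ⬝ᵥ
    horoVec hn (horizontal n g - horizontal n h)
  have hD : 0 ≤ D := zero_le_dotProduct_self _
  have h8 : y * y' * D ≤ 9 * (n + 2) := by
    calc y * y' * D ≤ (3 * E) * (3 * E) * ((n + 2) * (1 / E) ^ 2) := by gcongr
      _ = 9 * (n + 2) := by field_simp; ring
  linarith

theorem floor_mem_Icc {x B : ℝ} (h : |x| ≤ B) :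
    ⌊x⌋ ∈ Finset.Icc (-(⌈B⌉₊ : ℤ)) (⌈B⌉₊ : ℤ) := by
  have h1 := Nat.le_ceil B
  obtain ⟨h2, h3⟩ := abs_le.1 h
  rw [Finset.mem_Icc]
  constructor
  · rw [Int.le_floor]; push_cast; linarith
  · have := (Int.floor_le x).trans (h3.trans h1)
    exact_mod_cast this

/-- With `a` the second coordinate and `y` the height, `a * y ≥ 1` and both are at most `2 * F`,
which confines `log y`. The rescaled horizontal coordinates have squares at most `2 * a * y ≤ 8 * F
^ 2`, below `(3 * F) ^ 2`. -/
theorem cell_mem (hn : 2 ≤ n) {g : SpecialLinearGroup (Fin (n + 2)) ℝ}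
    (hg : g ∈ H n) {F : ℝ} (hF : coshDist n g ≤ F) :
    cell n g ∈ Finset.Icc (-(⌈Real.log (2 * F)⌉₊ : ℤ)) (⌈Real.log (2 * F)⌉₊ : ℤ) ×ˢ
      Fintype.piFinset fun _ : HoroIndex n => Finset.Icc (-(⌈3 * F⌉₊ : ℤ)) (⌈3 * F⌉₊ : ℤ) := by
  obtain ⟨hy, hy2, h1, h2⟩ := half_space_facts hn hg
  obtain ⟨h3, -⟩ := exp_floor_log hy
  set y := height n g with hyd
  set f := coshDist n g
  set a := (g.1 *ᵥ base n) 1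
  set D := horoVec hn (horizontal n g) ⬝ᵥ horoVec hn (horizontal n g) with hD
  have hD0 : 0 ≤ D := zero_le_dotProduct_self _
  have hf1 : 1 ≤ f := one_le_coshDist hn hg
  have ha : a ≤ 2 * f := by linarith
  have hF0 : 0 < F := by linarith
  rw [Finset.mem_product, Fintype.mem_piFinset]
  refine ⟨floor_mem_Icc ?_, fun j => floor_mem_Icc ?_⟩
  · rw [abs_le]
    constructor
    · rw [← Real.log_inv]
      apply Real.log_le_log (by positivity)
      rw [inv_le_iff_one_le_mul₀ (by positivity)]
      have : 1 ≤ a * y := by rw [h2]; have := mul_nonneg (sq_nonneg y) hD0; linarith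
      nlinarith
    · exact Real.log_le_log hy (by linarith)
  · rw [← hyd]
    set E := Real.exp ⌊Real.log y⌋
    have hE : 0 < E := Real.exp_pos _
    have h4 := sq_le_horoVec_dotProduct_self hn (horizontal n g) j
    rw [← hD] at h4
    refine abs_le_of_sq_le_sq ?_ (by linarith)
    rw [mul_pow]
    calc horizontal n g j ^ 2 * E ^ 2 ≤ D * y ^ 2 := by gcongr
      _ ≤ 2 * (a * y) := by rw [h2]; linarith
      _ ≤ 2 * ((2 * f) * (2 * f)) := by gcongr
      _ ≤ (3 * F) ^ 2 := by nlinarith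

theorem exists_count_le (hn : 2 ≤ n) (Δ : Subgroup (H n)) [DiscreteTopology Δ] :
    ∃ C : ℝ, 0 < C ∧ ∀ T : ℝ, 0 ≤ T →
      (({γ : Δ | coshDist n (γ : H n) ≤ Real.cosh T}.encard : ℕ∞) : ℝ≥0∞) ≤
        ENNReal.ofReal (C * (2 * T + 5) * Real.exp ((n - 1) * T)) := by
  classical
  set A₀ := (finite_coshDist_le hn Δ (3 + 9 * (n + 2) / 4)).toFinset with hA₀
  refine ⟨(A₀.card + 1) * 9 ^ (n - 1), by positivity, fun T hT => ?_⟩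
  set F := Real.cosh T with hF
  have hF1 : 1 ≤ F := Real.one_le_cosh T
  have hFe : F ≤ Real.exp T := by
    rw [hF, Real.cosh_eq]
    have : Real.exp (-T) ≤ Real.exp T := Real.exp_le_exp.2 (by linarith)
    linarith
  have hfin := finite_coshDist_le hn Δ F
  set A := hfin.toFinset with hA
  set a := ⌈Real.log (2 * F)⌉₊
  set b := ⌈3 * F⌉₊
  set I := Finset.Icc (-(a : ℤ)) (a : ℤ) ×ˢ
      Fintype.piFinset fun _ : HoroIndex n => Finset.Icc (-(b : ℤ)) (b : ℤ) with hI
  -- Within one cell, dividing by a fixed element `γ₀` maps injectively into the finite set `A₀`,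
  -- which does not depend on `T`.
  have hcard : A.card ≤ A₀.card * I.card := by
    refine Finset.card_le_mul_card_image_of_maps_to (f := fun γ : Δ => cell n (γ : H n))
      (fun γ hγ => ?_) _ fun c _ => ?_
    · exact cell_mem hn (γ : H n).2 (by simpa [hA] using hγ)
    · by_cases hne : (A.filter fun γ : Δ => cell n (γ : H n) = c).Nonempty
      · obtain ⟨γ₀, hγ₀⟩ := hne
        refine Finset.card_le_card_of_injOn (fun γ => γ₀⁻¹ * γ) (fun γ hγ => ?_)
          fun _ _ _ _ h => mul_left_cancel h
        simp only [Finset.mem_filter, Finset.coe_filter, Set.mem_ofPred_eq] at hγ₀ hγ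
        have := coshDist_le_of_cell_eq hn (γ₀ : H n).2 (γ : H n).2 (hγ₀.2.trans hγ.2.symm)
        simpa [hA₀] using this
      · rw [Finset.not_nonempty_iff_eq_empty.1 hne]; simp
  have hIcard : I.card = (2 * a + 1) * (2 * b + 1) ^ (n - 1) := by
    rw [hI, Finset.card_product, Fintype.card_piFinset, Finset.prod_const, Finset.card_univ,
      card_horoIndex hn, Int.card_Icc, Int.card_Icc]
    congr 2 <;> omega
  have ha : (a : ℝ) ≤ T + 2 := by
    have h1 : Real.log (2 * F) ≤ T + 1 := by
      rw [Real.log_mul (by norm_num) (by positivity)]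
      have h2 : Real.log F ≤ T := by
        rw [Real.log_le_iff_le_exp (by positivity)]; exact hFe
      have h3 := Real.log_two_lt_d9
      linarith
    have := Nat.ceil_lt_add_one (Real.log_nonneg (by linarith : 1 ≤ 2 * F))
    linarith
  have hb : (2 * b + 1 : ℝ) ≤ 9 * Real.exp T := by
    have := Nat.ceil_lt_add_one (by linarith : 0 ≤ 3 * F)
    linarith
  have henc : {γ : Δ | coshDist n (γ : H n) ≤ F}.encard = A.card := by
    rw [hfin.encard_eq_coe_toFinset_card]
  rw [henc]
  have hreal : (A.card : ℝ) ≤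
      (A₀.card + 1) * 9 ^ (n - 1) * (2 * T + 5) * Real.exp ((n - 1) * T) := by
    calc (A.card : ℝ) ≤ ((A₀.card * I.card : ℕ) : ℝ) := by exact_mod_cast hcard
      _ = A₀.card * ((2 * a + 1) * (2 * b + 1) ^ (n - 1)) := by rw [hIcard]; push_cast; ring
      _ ≤ (A₀.card + 1) * ((2 * T + 5) * (9 * Real.exp T) ^ (n - 1)) := by
          have h1 : (2 * a + 1 : ℝ) ≤ 2 * T + 5 := by linarith
          have h2 : (A₀.card : ℝ) ≤ A₀.card + 1 := by linarith
          gcongr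
      _ = _ := by
          rw [mul_pow, ← Real.exp_nat_mul, Nat.cast_sub (by omega)]
          push_cast
          ring
  calc ((A.card : ℕ∞) : ℝ≥0∞) = ENNReal.ofReal (A.card : ℝ) := by simp
    _ ≤ _ := ENNReal.ofReal_le_ofReal hreal

/-! ### The half-sum of the positive roots on `μ(H)` -/

theorem polarBilin_eq (hn : 2 ≤ n) (x y : Fin (n + 2) → ℝ) :
    (Q n).polarBilin x y = 2 * (x ⬝ᵥ (J n *ᵥ y)) := by
  rw [QuadraticMap.polarBilin_apply_apply, QuadraticMap.polar, Q_eq hn, Q_eq hn, Q_eq hn,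
    mulVec_add, add_dotProduct, dotProduct_add, dotProduct_add, dotProduct_J_comm hn y x,
    dotProduct_comm (J n *ᵥ y)]
  ring

theorem forall_dotProduct_mulVec_eq_zero_iff {ι : Type*} [Fintype ι] [DecidableEq ι]
    (M : Matrix ι ι ℝ) : (∀ x, x ⬝ᵥ (M *ᵥ x) = 0) ↔ ∀ i j, M i j = -M j i := by
  constructor
  · intro h i j
    have hs := h (Pi.single i 1 + Pi.single j 1)
    have hi := h (Pi.single i 1)
    have hj := h (Pi.single j 1)
    simp only [mulVec_add, add_dotProduct, dotProduct_add, mulVec_single_one, single_dotProduct,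
      one_mul, col_apply] at hs hi hj
    linarith
  · intro h x
    have hM : Mᵀ = -M := by ext i j; exact h j i
    have h1 : x ⬝ᵥ (M *ᵥ x) = -(x ⬝ᵥ (M *ᵥ x)) := by
      conv_lhs => rw [dotProduct_mulVec, ← mulVec_transpose, hM, neg_mulVec, neg_dotProduct,
        dotProduct_comm]
    linarith

theorem J_mul_apply (X : Matrix (Fin (n + 2)) (Fin (n + 2)) ℝ) (i j : Fin (n + 2)) :
    (J n * X) i j = X (dual n i) j := by
  simp [J, Matrix.mul_apply]

theorem mem_rootSpace_iff (hn : 2 ≤ n) (α : (ℝ × ℝ) →ₗ[ℝ] ℝ)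
    (X : Matrix (Fin (n + 2)) (Fin (n + 2)) ℝ) :
    X ∈ rootSpace n α ↔ (∀ i j, X (dual n i) j = -X (dual n j) i) ∧
      ∀ (v : ℝ × ℝ) i j, (aVec n v i - aVec n v j - α v) * X i j = 0 := by
  change ((∀ x, (Q n).polarBilin x (X *ᵥ x) = 0) ∧
    ∀ v : ℝ × ℝ, diagonal (aVec n v) * X - X * diagonal (aVec n v) = α v • X) ↔ _
  refine and_congr ?_ (forall_congr' fun v => ?_)
  · have e : (∀ i j, X (dual n i) j = -X (dual n j) i) ↔ ∀ x, x ⬝ᵥ ((J n * X) *ᵥ x) = 0 := by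
      rw [forall_dotProduct_mulVec_eq_zero_iff]
      simp only [J_mul_apply]
    rw [e]
    refine forall_congr' fun x => ?_
    rw [polarBilin_eq hn, mulVec_mulVec]
    simp
  · rw [← Matrix.ext_iff]
    refine forall_congr' fun i => forall_congr' fun j => ?_
    rw [Matrix.sub_apply, diagonal_mul, mul_diagonal, Matrix.smul_apply, smul_eq_mul,
      ← sub_eq_zero]
    rw [show aVec n v i * X i j - X i j * aVec n v j - α v * X i j
      = (aVec n v i - aVec n v j - α v) * X i j by ring]

/-- The indices `j` for which the difference of the first and the `j`-th diagonal entry is `α`. -/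
def rootIndex (n : ℕ) (α : (ℝ × ℝ) →ₗ[ℝ] ℝ) : Set (Fin (n + 2)) :=
  {j | (1 ≤ j.val ∧ j.val ≤ n) ∧ ∀ v : ℝ × ℝ, v.1 - aVec n v j = α v}

theorem aVec_zero_index (v : ℝ × ℝ) : aVec n v 0 = v.1 := by simp [aVec]

theorem aVec_last (hn : 2 ≤ n) (v : ℝ × ℝ) : aVec n v (Fin.last (n + 1)) = -v.1 := by
  rw [← dual_zero, aVec_dual hn, aVec_zero_index]

/-- A root space on which the first coordinate of `𝔞` is positive is determined by the first
rows of its elements. -/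
theorem finrank_rootSpace (hn : 2 ≤ n) (α : (ℝ × ℝ) →ₗ[ℝ] ℝ) (hα : 0 < α (1, 0)) :
    Module.finrank ℝ (rootSpace n α) = Nat.card (rootIndex n α) := by
  classical
  let f : rootSpace n α →ₗ[ℝ] (rootIndex n α → ℝ) :=
    { toFun := fun X j => X.1 0 j.1
      map_add' := fun _ _ => rfl
      map_smul' := fun _ _ => rfl }
  have hinj : Function.Injective f := by
    rw [← LinearMap.ker_eq_bot, LinearMap.ker_eq_bot']
    rintro ⟨X, hX⟩ h0
    obtain ⟨h1, h2⟩ := (mem_rootSpace_iff hn α X).1 hX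
    have hrow : ∀ j : Fin (n + 2), (1 ≤ j.val ∧ j.val ≤ n) → X 0 j = 0 := by
      intro j hj
      by_contra hne
      refine hne (congrFun h0 ⟨j, hj, fun v => ?_⟩)
      have := (mul_eq_zero.1 (h2 v 0 j)).resolve_right hne
      rw [aVec_zero_index] at this
      linarith
    refine Subtype.ext (Matrix.ext fun i j => ?_)
    change X i j = 0
    by_contra hne
    have hw := (mul_eq_zero.1 (h2 (1, 0) i j)).resolve_right hne
    have hval : ∀ i : Fin (n + 2), aVec n (1, 0) i =
        if i.val = 0 then 1 else if i.val = n + 1 then -1 else 0 := by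
      intro i
      unfold aVec
      split_ifs <;> first | rfl | (exfalso; omega) | simp
    have hcases : (i = 0 ∧ (1 ≤ j.val ∧ j.val ≤ n)) ∨ (i = 0 ∧ j = Fin.last (n + 1)) ∨
        ((1 ≤ i.val ∧ i.val ≤ n) ∧ j = Fin.last (n + 1)) := by
      rw [hval, hval] at hw
      simp only [Fin.ext_iff, Fin.val_zero, Fin.val_last]
      have hi := i.isLt
      have hj := j.isLt
      split_ifs at hw <;> first | omega | (exfalso; linarith)
    rcases hcases with ⟨rfl, hj⟩ | ⟨rfl, rfl⟩ | ⟨hi, rfl⟩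
    · exact hne (hrow j hj)
    -- The upper right corner equals its own negative, so `2 v₁` is not a root.
    · have := h1 (Fin.last (n + 1)) (Fin.last (n + 1))
      rw [dual_last hn] at this
      exact hne (by linarith)
    · have := h1 (dual n i) (Fin.last (n + 1))
      rw [dual_dual hn, dual_last hn, hrow (dual n i) ?_, neg_zero] at this
      · exact hne this
      · rw [dual_val]
        split_ifs <;> omega
  have hsurj : Function.Surjective f := by
    intro c
    let c' : Fin (n + 2) → ℝ := fun k => if h : k ∈ rootIndex n α then c ⟨k, h⟩ else 0
    have hc' : ∀ k v, c' k ≠ 0 → v.1 - aVec n v k = α v := by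
      intro k v hk
      by_contra hne
      refine hk (dif_neg fun hmem => hne (hmem.2 v))
    -- Antisymmetry with respect to `J` forces the last column once the first row is prescribed.
    let X : Matrix (Fin (n + 2)) (Fin (n + 2)) ℝ := fun i k =>
      (if i = 0 then c' k else 0) - (if k = Fin.last (n + 1) then c' (dual n i) else 0)
    have hX : X ∈ rootSpace n α := by
      refine (mem_rootSpace_iff hn α X).2 ⟨fun i j => ?_, fun v i j => ?_⟩
      · have e : ∀ i, dual n i = 0 ↔ i = Fin.last (n + 1) := fun i => by
          rw [eq_comm, dual_eq_iff hn, dual_zero]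
        simp only [X, e, dual_dual hn]
        ring
      · have h1 : (aVec n v i - aVec n v j - α v) * (if i = 0 then c' j else 0) = 0 := by
          split_ifs with h
          · by_cases h0 : c' j = 0
            · rw [h0, mul_zero]
            · rw [h, aVec_zero_index, hc' j v h0, sub_self, zero_mul]
          · rw [mul_zero]
        have h2 : (aVec n v i - aVec n v j - α v) *
            (if j = Fin.last (n + 1) then c' (dual n i) else 0) = 0 := by
          split_ifs with h
          · by_cases h0 : c' (dual n i) = 0
            · rw [h0, mul_zero]
            · have := hc' _ v h0
              rw [aVec_dual hn] at this
              rw [h, aVec_last hn, ← this]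
              ring
          · rw [mul_zero]
        simp only [X]
        rw [mul_sub, h1, h2, sub_zero]
    refine ⟨⟨X, hX⟩, funext fun j => ?_⟩
    have hj : j.1 ≠ Fin.last (n + 1) := by
      intro h
      have := j.2.1.2
      rw [h, Fin.val_last] at this
      omega
    change X 0 j.1 = c j
    simp only [X, hj, if_true, if_false, sub_zero, c']
    exact dif_pos j.2
  rw [(LinearEquiv.ofBijective f ⟨hinj, hsurj⟩).finrank_eq, Module.finrank_fintype_fun_eq_card,
    Nat.card_eq_fintype_card]

/-- Forms that vanish at `(1, 0)`, such as `± v₂`, contribute nothing on this ray. What remains is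
`v₁` with multiplicity `n - 2`, which is zero for `n = 2`, and `v₁ ± v₂` with multiplicity one each.
-/
theorem rho_fst (hn : 2 ≤ n) (t : ℝ) : rho n (t, 0) = n * t / 2 := by
  classical
  let α₀ : (ℝ × ℝ) →ₗ[ℝ] ℝ := LinearMap.fst ℝ ℝ ℝ
  let α₁ : (ℝ × ℝ) →ₗ[ℝ] ℝ := LinearMap.fst ℝ ℝ ℝ - LinearMap.snd ℝ ℝ ℝ
  let α₂ : (ℝ × ℝ) →ₗ[ℝ] ℝ := LinearMap.fst ℝ ℝ ℝ + LinearMap.snd ℝ ℝ ℝ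
  have ev0 : ∀ v, α₀ v = v.1 := fun v => rfl
  have ev1 : ∀ v, α₁ v = v.1 - v.2 := fun v => rfl
  have ev2 : ∀ v, α₂ v = v.1 + v.2 := fun v => rfl
  have n0 : n ≠ 0 := by omega
  have n1 : n ≠ 1 := by omega
  have hmid : ∀ {j : Fin (n + 2)}, (2 ≤ j.val ∧ j.val < n) → ∀ v, aVec n v j = 0 := by
    intro j h v
    simp [aVec, show j.val ≠ 0 by omega, show j.val ≠ 1 by omega, show j.val ≠ n by omega,
      show j.val ≠ n + 1 by omega]
  have hone : ∀ v, aVec n v 1 = v.2 := fun v => by simp [aVec]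
  have hnn : ∀ v, aVec n v ⟨n, by omega⟩ = -v.2 := fun v => by simp [aVec, n0, n1]
  have hr0 : rootIndex n α₀ = {j | 2 ≤ j.val ∧ j.val < n} := by
    ext j
    constructor
    · rintro ⟨hj, h⟩
      rcases index_cases j with rfl | rfl | rfl | rfl | h'
      · simp at hj
      · simp at hj
      · have := h (0, 1); rw [hone, ev0] at this; norm_num at this
      · have := h (0, 1); rw [hnn, ev0] at this; norm_num at this
      · exact h'
    · intro h
      have h' : 2 ≤ j.val ∧ j.val < n := h
      exact ⟨⟨by omega, by omega⟩, fun v => by rw [hmid h', ev0, sub_zero]⟩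
  have hr1 : rootIndex n α₁ = {1} := by
    ext j
    constructor
    · rintro ⟨hj, h⟩
      rcases index_cases j with rfl | rfl | rfl | rfl | h'
      · simp at hj
      · simp at hj
      · rfl
      · have := h (0, 1); rw [hnn, ev1] at this; norm_num at this
      · have := h (0, 1); rw [hmid h', ev1] at this; norm_num at this
    · rintro rfl
      exact ⟨⟨by simp, by simp; omega⟩, fun v => by rw [hone, ev1]⟩
  have hr2 : rootIndex n α₂ = {⟨n, by omega⟩} := by
    ext j
    constructor
    · rintro ⟨hj, h⟩
      rcases index_cases j with rfl | rfl | rfl | rfl | h'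
      · simp at hj
      · simp at hj
      · have := h (0, 1); rw [hone, ev2] at this; norm_num at this
      · rfl
      · have := h (0, 1); rw [hmid h', ev2] at this; norm_num at this
    · rintro rfl
      exact ⟨⟨by simp; omega, le_rfl⟩, fun v => by rw [hnn, ev2, sub_neg_eq_add]⟩
  have hcover : ∀ α j, j ∈ rootIndex n α → α = α₀ ∨ α = α₁ ∨ α = α₂ := by
    rintro α j ⟨hj, h⟩
    rcases index_cases j with rfl | rfl | rfl | rfl | h'
    · simp at hj
    · simp at hj
    · right; left
      exact LinearMap.ext fun v => by rw [← h v, hone, ev1]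
    · right; right
      exact LinearMap.ext fun v => by rw [← h v, hnn, ev2, sub_neg_eq_add]
    · left
      exact LinearMap.ext fun v => by rw [← h v, hmid h', ev0, sub_zero]
  have d01 : α₀ ≠ α₁ := fun h => by
    have := LinearMap.congr_fun h (0, 1); rw [ev0, ev1] at this; norm_num at this
  have d02 : α₀ ≠ α₂ := fun h => by
    have := LinearMap.congr_fun h (0, 1); rw [ev0, ev2] at this; norm_num at this
  have d12 : α₁ ≠ α₂ := fun h => by
    have := LinearMap.congr_fun h (0, 1); rw [ev1, ev2] at this; norm_num at this
  have nz : ∀ α : (ℝ × ℝ) →ₗ[ℝ] ℝ, α (1, 0) = 1 → α ≠ 0 := fun α h h0 => by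
    rw [h0] at h; simp at h
  have p0 : α₀ (1, 0) = 1 := rfl
  have p1 : α₁ (1, 0) = 1 := by rw [ev1]; norm_num
  have p2 : α₂ (1, 0) = 1 := by rw [ev2]; norm_num
  have hval : ∀ α : (ℝ × ℝ) →ₗ[ℝ] ℝ, α (t, 0) = t * α (1, 0) := fun α => by
    rw [← smul_eq_mul, ← map_smul]; simp
  have hmem : (1, 0) ∈ aplus n := ⟨by simp, fun _ => le_rfl⟩
  have hc0 : Nat.card (rootIndex n α₀) = n - 2 := by
    rw [hr0, Nat.card_coe_set_eq]
    have : {j : Fin (n + 2) | 2 ≤ j.val ∧ j.val < n} =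
        ((Finset.Ico 2 n).attachFin fun m hm => by
          have := Finset.mem_Ico.1 hm; omega : Finset (Fin (n + 2))) := by
      ext j; simp
    rw [this, Set.ncard_coe_finset, Finset.card_attachFin, Nat.card_Ico]
  have hc1 : Nat.card (rootIndex n α₁) = 1 := by
    rw [hr1, Nat.card_coe_set_eq, Set.ncard_singleton]
  have hc2 : Nat.card (rootIndex n α₂) = 1 := by
    rw [hr2, Nat.card_coe_set_eq, Set.ncard_singleton]
  rw [rho, finsum_mem_eq_sum_of_inter_support_eq (t := {α₀, α₁, α₂})]
  · rw [Finset.sum_insert (by simp [d01, d02]), Finset.sum_insert (by simp [d12]),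
      Finset.sum_singleton, finrank_rootSpace hn α₀ (by rw [p0]; norm_num),
      finrank_rootSpace hn α₁ (by rw [p1]; norm_num),
      finrank_rootSpace hn α₂ (by rw [p2]; norm_num), hc0, hc1, hc2, hval, hval α₁, hval α₂,
      p0, p1, p2, Nat.cast_sub hn]
    push_cast
    ring
  · ext α
    simp only [Set.mem_inter_iff, Function.mem_support, Finset.coe_insert, Finset.coe_singleton,
      Set.mem_insert_iff, Set.mem_singleton_iff, and_congr_left_iff]
    intro hne
    constructor
    · rintro ⟨-, hpos⟩
      have h1 : α (1, 0) ≠ 0 := fun h => hne (by rw [hval, h]; simp)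
      have h2 : 0 < α (1, 0) := lt_of_le_of_ne (hpos _ hmem) h1.symm
      rw [finrank_rootSpace hn α h2] at hne
      have h3 : Nat.card (rootIndex n α) ≠ 0 := fun h => hne (by rw [h]; simp)
      obtain ⟨⟨j, hj⟩⟩ := (Nat.card_ne_zero.1 h3).1
      exact hcover α j hj
    · have hle : ∀ w ∈ aplus n, |w.2| ≤ w.1 := fun w hw => hw.1
      rintro (rfl | rfl | rfl)
      · exact ⟨nz _ p0, fun w hw => (abs_nonneg _).trans (hle w hw)⟩
      · exact ⟨nz _ p1, fun w hw => by rw [ev1]; linarith [(abs_le.1 (hle w hw)).2]⟩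
      · exact ⟨nz _ p2, fun w hw => by rw [ev2]; linarith [(abs_le.1 (hle w hw)).1]⟩

/-! ### The growth indicator -/

theorem encard_subgroup_eq {Γ : Subgroup (SpecialLinearGroup (Fin (n + 2)) ℝ)} (hΓH : Γ ≤ H n)
    (P : SpecialLinearGroup (Fin (n + 2)) ℝ → Prop) :
    {γ | γ ∈ Γ ∧ P γ}.encard = {γ : Γ.subgroupOf (H n) | P (γ : H n)}.encard := by
  have hinj : Function.Injective (fun γ : Γ.subgroupOf (H n) => (γ : H n).1) :=
    Subtype.val_injective.comp Subtype.val_injective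
  rw [← hinj.encard_image]
  congr 1
  ext γ
  constructor
  · rintro ⟨h1, h2⟩
    exact ⟨⟨⟨γ, hΓH h1⟩, h1⟩, h2, rfl⟩
  · rintro ⟨δ, h1, rfl⟩
    exact ⟨δ.2, h1⟩

theorem seminorm_fst (N : Seminorm ℝ (ℝ × ℝ)) {t : ℝ} (ht : 0 ≤ t) :
    N (t, 0) = t * N (1, 0) := by
  have : ((t, 0) : ℝ × ℝ) = t • ((1, 0) : ℝ × ℝ) := by simp
  rw [this, map_smul_eq_mul, Real.norm_of_nonneg ht]

theorem seminorm_cartanProj_le_iff (hn : 2 ≤ n) {N : Seminorm ℝ (ℝ × ℝ)} (hN : 0 < N (1, 0))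
    {h : SpecialLinearGroup (Fin (n + 2)) ℝ} (hh : h ∈ H n) {T : ℝ} (hT : 0 ≤ T) :
    N (cartanProj n h) ≤ T ↔ coshDist n h ≤ Real.cosh (T / N (1, 0)) := by
  have h1 := one_le_coshDist hn hh
  rw [cartanProj_of_mem_H hn hh, seminorm_fst N (Real.arcosh_nonneg h1), ← le_div_iff₀ hN,
    ← Real.arcosh_le_arcosh (by linarith) (Real.cosh_pos _), Real.arcosh_cosh (by positivity)]

/-- The linear factor from the number of height levels disappears in the exponential rate. -/
theorem tendsto_log_count_div (C a m : ℝ) (hC : 0 < C) (ha : 0 < a) :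
    Tendsto (fun T : ℝ => Real.log (C * (2 * (T * a) + 5) * Real.exp (m * (T * a))) / T) atTop
      (nhds (m * a)) := by
  have h1 : Tendsto (fun T : ℝ => C * (2 * (T * a) + 5)) atTop atTop := by
    refine Tendsto.const_mul_atTop hC (tendsto_atTop_add_const_right _ _ ?_)
    exact (tendsto_id.atTop_mul_const ha).const_mul_atTop two_pos
  have h2 : (fun T : ℝ => C * (2 * (T * a) + 5)) =O[atTop] (fun T : ℝ => T) := by
    refine Asymptotics.IsBigO.of_bound (C * (2 * a + 5)) ?_
    filter_upwards [eventually_ge_atTop 1] with T hT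
    have hT0 : 0 < T := by linarith
    rw [Real.norm_of_nonneg (by positivity), Real.norm_of_nonneg hT0.le, mul_assoc]
    refine mul_le_mul_of_nonneg_left ?_ hC.le
    nlinarith
  have h3 : (fun T : ℝ => Real.log (C * (2 * (T * a) + 5))) =o[atTop] (fun T : ℝ => T) :=
    (Real.isLittleO_log_id_atTop.comp_tendsto h1).trans_isBigO h2
  have h4 := h3.tendsto_div_nhds_zero.add_const (m * a)
  rw [zero_add] at h4
  refine h4.congr' ?_
  filter_upwards [eventually_ge_atTop 1] with T hT
  have hT0 : 0 < T := by linarith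
  rw [Real.log_mul (by positivity) (Real.exp_pos _).ne', Real.log_exp]
  field_simp

theorem limsup_count_le (hn : 2 ≤ n) {Γ : Subgroup (SpecialLinearGroup (Fin (n + 2)) ℝ)}
    (hΓH : Γ ≤ H n) (hΓ : IsLattice (Γ.subgroupOf (H n))) {N : Seminorm ℝ (ℝ × ℝ)}
    (hN : 0 < N (1, 0)) (C : Set (ℝ × ℝ)) :
    limsup (fun T : ℝ =>
      ENNReal.log (({γ | γ ∈ Γ ∧ cartanProj n γ ∈ C ∧ N (cartanProj n γ) ≤ T}.encard : ℕ∞) : ℝ≥0∞)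
        / (T : EReal)) atTop ≤ ((((n : ℝ) - 1) * (N (1, 0))⁻¹ : ℝ) : EReal) := by
  have := hΓ.1
  obtain ⟨A, hA, hcount⟩ := exists_count_le hn (Γ.subgroupOf (H n))
  have ha : 0 < (N (1, 0))⁻¹ := inv_pos.2 hN
  have hlim : Tendsto (fun T : ℝ => ((Real.log (A * (2 * (T * (N (1, 0))⁻¹) + 5) *
      Real.exp (((n : ℝ) - 1) * (T * (N (1, 0))⁻¹))) / T : ℝ) : EReal)) atTop
      (nhds ((((n : ℝ) - 1) * (N (1, 0))⁻¹ : ℝ) : EReal)) :=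
    (continuous_coe_real_ereal.tendsto _).comp (tendsto_log_count_div A _ _ hA ha)
  rw [← hlim.limsup_eq]
  refine limsup_le_limsup ?_
  filter_upwards [eventually_gt_atTop 0] with T hT
  rw [EReal.coe_div, ← ENNReal.log_ofReal_of_pos (by positivity)]
  refine EReal.div_le_div_right_of_nonneg (EReal.coe_nonneg.2 hT.le) (ENNReal.log_le_log ?_)
  refine le_trans ?_ (hcount (T * (N (1, 0))⁻¹) (by positivity))
  rw [encard_subgroup_eq hΓH (fun γ => cartanProj n γ ∈ C ∧ N (cartanProj n γ) ≤ T)]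
  refine ENat.toENNReal_le.2 (Set.encard_le_encard fun γ hγ => ?_)
  have := (seminorm_cartanProj_le_iff hn hN (γ : H n).2 hT.le).1 hγ.2
  rwa [div_eq_mul_inv] at this

/-- A smaller limsup would bound the count at all large radii by an exponential of rate below `n -
1`, contradicting `lattice_count_unbounded`. -/
theorem le_limsup_count (hn : 2 ≤ n) {Γ : Subgroup (SpecialLinearGroup (Fin (n + 2)) ℝ)}
    (hΓH : Γ ≤ H n) (hΓ : IsLattice (Γ.subgroupOf (H n))) {N : Seminorm ℝ (ℝ × ℝ)}
    (hN : 0 < N (1, 0)) {C : Set (ℝ × ℝ)} (hC : ∀ s : ℝ, 0 < s → (s, 0) ∈ C) :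
    ((((n : ℝ) - 1) * (N (1, 0))⁻¹ : ℝ) : EReal) ≤ limsup (fun T : ℝ =>
      ENNReal.log (({γ | γ ∈ Γ ∧ cartanProj n γ ∈ C ∧ N (cartanProj n γ) ≤ T}.encard : ℕ∞) : ℝ≥0∞)
        / (T : EReal)) atTop := by
  have := hΓ.1
  by_contra! hlt
  obtain ⟨x, hx1, hx2⟩ := EReal.lt_iff_exists_real_btwn.1 hlt
  have hx2' : x < ((n : ℝ) - 1) * (N (1, 0))⁻¹ := EReal.coe_lt_coe_iff.1 hx2
  obtain ⟨T₀, hT₀⟩ := eventually_atTop.1 ((eventually_lt_of_limsup_lt hx1).and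
    (eventually_gt_atTop 0))
  have hn1 : (1 : ℝ) ≤ n - 1 := by
    have : (2 : ℝ) ≤ n := by exact_mod_cast hn
    linarith
  have hs : max (x * N (1, 0)) 0 < (n : ℝ) - 1 := by
    refine max_lt ?_ (by linarith)
    rwa [← div_eq_mul_inv, lt_div_iff₀ hN] at hx2'
  -- The rate `x` may be negative; truncation at `0` lets `exp (s * k)` absorb the additive constant
  -- `m`.
  set s := max (x * N (1, 0)) 0 with hs_def
  -- Elements with `μ = 0` need not have their projection in the cone `C`; there are finitely many
  -- of them.
  have hfin := finite_coshDist_le hn (Γ.subgroupOf (H n)) 1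
  obtain ⟨m, hm⟩ := ENat.ne_top_iff_exists.1 hfin.encard_lt_top.ne
  obtain ⟨k₀, hk₀⟩ := exists_nat_ge (T₀ / N (1, 0))
  refine lattice_count_unbounded hn (Γ.subgroupOf (H n)) hΓ (C := Real.exp (s * 4) + m) hs
    (k₀ := k₀) fun k hk => ?_
  -- The shift by `4` turns the factor `16` into a change of radius: `exp 4 ≥ 32` gives `16 * exp k
  -- ≤ cosh (k + 4)`.
  set T : ℝ := ((k : ℝ) + 4) * N (1, 0) with hT_def
  have hk' : (k₀ : ℝ) ≤ k := by exact_mod_cast hk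
  have hTT : T₀ ≤ T := by
    rw [div_le_iff₀ hN] at hk₀
    nlinarith
  obtain ⟨h1, hTpos⟩ := hT₀ T hTT
  rw [EReal.div_lt_iff (EReal.coe_pos.2 hTpos) (EReal.coe_ne_top _), ← EReal.coe_mul,
    ← Real.log_exp (x * T), ← ENNReal.log_ofReal_of_pos (Real.exp_pos _),
    ENNReal.log_lt_log_iff,
    encard_subgroup_eq hΓH (fun γ => cartanProj n γ ∈ C ∧ N (cartanProj n γ) ≤ T)] at h1
  have hsub : {γ : Γ.subgroupOf (H n) | coshDist n (γ : H n) ≤ 16 * Real.exp k} ⊆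
      {γ : Γ.subgroupOf (H n) | cartanProj n (γ : H n) ∈ C ∧ N (cartanProj n (γ : H n)) ≤ T} ∪
      {γ : Γ.subgroupOf (H n) | coshDist n (γ : H n) ≤ 1} := by
    intro γ hγ
    rcases le_or_gt (coshDist n (γ : H n)) 1 with h | h
    · exact Or.inr h
    · refine Or.inl ⟨?_, ?_⟩
      · rw [cartanProj_of_mem_H hn (γ : H n).2]
        exact hC _ (Real.arcosh_pos h)
      · rw [seminorm_cartanProj_le_iff hn hN (γ : H n).2 hTpos.le, hT_def,
          mul_div_cancel_right₀ _ hN.ne']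
        refine le_trans hγ ?_
        rw [Real.cosh_eq, Real.exp_add]
        have h4 : (32 : ℝ) ≤ Real.exp 4 := by
          have h2 : (2.7 : ℝ) ≤ Real.exp 1 := by linarith [Real.exp_one_gt_d9]
          calc (32 : ℝ) ≤ 2.7 ^ 4 := by norm_num
            _ ≤ Real.exp 1 ^ 4 := by gcongr
            _ = Real.exp 4 := by rw [← Real.exp_nat_mul]; norm_num
        have h5 := Real.exp_pos (-((k : ℝ) + 4))
        nlinarith [Real.exp_pos (k : ℝ)]
  calc (({γ : Γ.subgroupOf (H n) | coshDist n (γ : H n) ≤ 16 * Real.exp k}.encard : ℕ∞) : ℝ≥0∞)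
      ≤ (({γ : Γ.subgroupOf (H n) | cartanProj n (γ : H n) ∈ C ∧
          N (cartanProj n (γ : H n)) ≤ T}.encard + (m : ℕ∞) : ℕ∞) : ℝ≥0∞) := by
        refine ENat.toENNReal_le.2 ((Set.encard_le_encard hsub).trans ?_)
        rw [hm]
        exact Set.encard_union_le _ _
    _ ≤ ENNReal.ofReal (Real.exp (x * T)) + ENNReal.ofReal m := by
        rw [ENat.toENNReal_add, ENat.toENNReal_coe, ENNReal.ofReal_natCast]
        exact add_le_add_left h1.le _
    _ = ENNReal.ofReal (Real.exp (x * T) + m) :=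
        (ENNReal.ofReal_add (Real.exp_pos _).le (Nat.cast_nonneg _)).symm
    _ ≤ ENNReal.ofReal ((Real.exp (s * 4) + m) * Real.exp (s * k)) := by
        refine ENNReal.ofReal_le_ofReal ?_
        rw [add_mul, ← Real.exp_add]
        have hs0 : 0 ≤ s := le_max_right _ _
        refine add_le_add (Real.exp_le_exp.2 ?_) (le_mul_of_one_le_right (Nat.cast_nonneg _)
          (Real.one_le_exp (by positivity)))
        have : x * N (1, 0) ≤ s := le_max_left _ _
        have hk4 : (0 : ℝ) ≤ k + 4 := by positivity
        rw [hT_def]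
        nlinarith [mul_le_mul_of_nonneg_right this hk4]

theorem isOpenCone_aplus (n : ℕ) : IsOpenCone n (aplus n) := by
  refine ⟨⟨Set.univ, isOpen_univ, by simp⟩, fun x hx t ht => ⟨?_, fun h => ?_⟩⟩
  · simpa [abs_mul, abs_of_pos ht] using mul_le_mul_of_nonneg_left hx.1 ht.le
  · exact mul_nonneg ht.le (hx.2 h)

theorem growthIndicator_fst (hn : 2 ≤ n) {Γ : Subgroup (SpecialLinearGroup (Fin (n + 2)) ℝ)}
    (hΓH : Γ ≤ H n) (hΓ : IsLattice (Γ.subgroupOf (H n))) {N : Seminorm ℝ (ℝ × ℝ)}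
    (hN : 0 < N (1, 0)) {t : ℝ} (ht : 0 ≤ t) :
    growthIndicator n N Γ (t, 0) = ((((n : ℝ) - 1) * t : ℝ) : EReal) := by
  unfold growthIndicator
  -- At the origin the factor `N v` is zero, and zero times any extended real is zero.
  rcases ht.eq_or_lt with rfl | ht
  · rw [seminorm_fst N le_rfl]
    simp
  have hinf : (⨅ (C : Set (ℝ × ℝ)) (_ : IsOpenCone n C ∧ (t, 0) ∈ C),
      limsup (fun T : ℝ => ENNReal.log
        (({γ | γ ∈ Γ ∧ cartanProj n γ ∈ C ∧ N (cartanProj n γ) ≤ T}.encard : ℕ∞) : ℝ≥0∞)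
          / (T : EReal)) atTop) = ((((n : ℝ) - 1) * (N (1, 0))⁻¹ : ℝ) : EReal) := by
    -- The whole chamber gives the upper bound. Every admissible cone contains the open ray, hence
    -- all nonzero values of `μ` on `Γ`.
    refine le_antisymm ?_ (le_iInf₂ fun C hC => le_limsup_count hn hΓH hΓ hN fun s hs => ?_)
    · exact (iInf₂_le (aplus n) ⟨isOpenCone_aplus n, by simp [aplus, ht.le]⟩).trans
        (limsup_count_le hn hΓH hΓ hN _)
    · have := hC.1.2 _ hC.2 (s / t) (by positivity)
      simpa [ht.ne'] using this
  rw [hinf, ← EReal.coe_mul, seminorm_fst N ht.le]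
  congr 1
  field_simp

/-- The open cone `v₂ ≠ 0` contains `v` and misses `μ(H)`, so its count is zero at every radius. -/
theorem growthIndicator_eq_bot (hn : 2 ≤ n) {Γ : Subgroup (SpecialLinearGroup (Fin (n + 2)) ℝ)}
    (hΓH : Γ ≤ H n) {N : Seminorm ℝ (ℝ × ℝ)} {v : ℝ × ℝ} (hN : 0 < N v) (hv : v ∈ aplus n)
    (hv2 : v.2 ≠ 0) : growthIndicator n N Γ v = ⊥ := by
  unfold growthIndicator
  have hcone : IsOpenCone n (aplus n ∩ {w | w.2 ≠ 0}) := by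
    refine ⟨⟨_, isOpen_ne_fun continuous_snd continuous_const, rfl⟩, fun x hx t ht =>
      ⟨(isOpenCone_aplus n).2 x hx.1 t ht, mul_ne_zero ht.ne' hx.2⟩⟩
  have hinf : (⨅ (C : Set (ℝ × ℝ)) (_ : IsOpenCone n C ∧ v ∈ C),
      limsup (fun T : ℝ => ENNReal.log
        (({γ | γ ∈ Γ ∧ cartanProj n γ ∈ C ∧ N (cartanProj n γ) ≤ T}.encard : ℕ∞) : ℝ≥0∞)
          / (T : EReal)) atTop) = ⊥ := by
    refine le_bot_iff.1 ((iInf₂_le _ ⟨hcone, hv, hv2⟩).trans ?_)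
    refine limsup_le_of_le (h := ?_)
    filter_upwards [eventually_gt_atTop 0] with T hT
    have : {γ | γ ∈ Γ ∧ cartanProj n γ ∈ aplus n ∩ {w | w.2 ≠ 0} ∧ N (cartanProj n γ) ≤ T} = ∅ := by
      refine Set.eq_empty_of_forall_notMem fun γ hγ => hγ.2.1.2 ?_
      rw [cartanProj_of_mem_H hn (hΓH hγ.1)]
    rw [this, Set.encard_empty, ENat.toENNReal_zero, ENNReal.log_zero,
      EReal.bot_div_of_pos_ne_top (EReal.coe_pos.2 hT) (EReal.coe_ne_top _)]
  rw [hinf, EReal.coe_mul_bot_of_pos hN]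

end SOn2

end

theorem mainTheorem9 (n : ℕ) (hn : 2 ≤ n)
    (Γ : Subgroup (Matrix.SpecialLinearGroup (Fin (n + 2)) ℝ))
    (hΓH : Γ ≤ SOn2.H n) (hΓ : SOn2.IsLattice (Γ.subgroupOf (SOn2.H n)))
    (N : Seminorm ℝ (ℝ × ℝ)) (hN : ∀ v, N v = 0 → v = 0) :
    SOn2.cartanProj n '' (SOn2.H n : Set (Matrix.SpecialLinearGroup (Fin (n + 2)) ℝ))
        = {v | 0 ≤ v.1 ∧ v.2 = 0} ∧
    (∀ t : ℝ, 0 ≤ t →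
      SOn2.growthIndicator n N Γ (t, 0) = ((((n : ℝ) - 1) * t : ℝ) : EReal)) ∧
    (∀ v ∈ SOn2.aplus n,
      v ∉ SOn2.cartanProj n '' (SOn2.H n : Set (Matrix.SpecialLinearGroup (Fin (n + 2)) ℝ)) →
      SOn2.growthIndicator n N Γ v = ⊥) ∧
    (∀ v ∈ SOn2.aplus n,
      SOn2.growthIndicator n N Γ v ≤ ((2 * ((n : ℝ) - 1) / n * SOn2.rho n v : ℝ) : EReal)) ∧
    (∀ v ∈ SOn2.cartanProj n '' (SOn2.H n : Set (Matrix.SpecialLinearGroup (Fin (n + 2)) ℝ)),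
      SOn2.growthIndicator n N Γ v = ((2 * ((n : ℝ) - 1) / n * SOn2.rho n v : ℝ) : EReal)) := by
  have hpos : ∀ v, v ≠ 0 → 0 < N v := fun v hv =>
    (apply_nonneg N v).lt_of_ne fun h => hv (hN v h.symm)
  have h1 : 0 < N (1, 0) := hpos _ (by simp)
  have himage := SOn2.cartanProj_image_H hn
  have hray : ∀ t : ℝ, 0 ≤ t →
      SOn2.growthIndicator n N Γ (t, 0) = ((((n : ℝ) - 1) * t : ℝ) : EReal) :=
    fun t ht => SOn2.growthIndicator_fst hn hΓH hΓ h1 ht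
  have hoff : ∀ v ∈ SOn2.aplus n,
      v ∉ SOn2.cartanProj n '' (SOn2.H n : Set (Matrix.SpecialLinearGroup (Fin (n + 2)) ℝ)) →
      SOn2.growthIndicator n N Γ v = ⊥ := by
    intro v hv hv'
    have hv2 : v.2 ≠ 0 := fun h =>
      hv' (himage ▸ ⟨(abs_nonneg _).trans hv.1, h⟩)
    exact SOn2.growthIndicator_eq_bot hn hΓH (hpos v fun h => hv2 (by simp [h])) hv hv2
  have hrho : ∀ v ∈ SOn2.cartanProj n '' (SOn2.H n : Set _),
      SOn2.growthIndicator n N Γ v = ((2 * ((n : ℝ) - 1) / n * SOn2.rho n v : ℝ) : EReal) := by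
    rintro v hv
    rw [himage] at hv
    obtain ⟨t, s⟩ := v
    obtain ⟨ht, rfl⟩ : 0 ≤ t ∧ s = 0 := hv
    rw [hray t ht, SOn2.rho_fst hn]
    congr 1
    have : (n : ℝ) ≠ 0 := by positivity
    field_simp
  refine ⟨himage, hray, hoff, fun v hv => ?_, hrho⟩
  -- Off the ray the left side is `-∞`, so no value or sign of `ρ` is needed there.
  by_cases hv' : v ∈ SOn2.cartanProj n '' (SOn2.H n : Set _)
  · exact (hrho v hv').le
  · exact (hoff v hv hv').le.trans bot_le
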